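/- **Setting.** Logarithms are to base 2. Let $n\ge 2$, $k\ge 1$, $[k]=\{0,\dots,k-1\}$ with addition modulo $k$, $[k]^{<n}$ the set of strings over $[k]$ of length less than $n$. Alice gets $(x,f)$ and Bob gets $(y,g)$, where $x,y:[k]^{<n}\to[k]$ and $f,g:[k]^n\to\{0,1\}$. For $0\le j<n$, a string $z$ with $j<|z|\le n$ is *consistent* with $x,y,j$ if $x(z_{\le j})+y(z_{\le j})=z_{j+1}$. Let $p(x,y,f,g,j)$ be the distribution in which $j$ is uniform in $\{0,\dots,n-1\}$ and, given $j$, $(x,y,f,g)$ is uniform subject to $x(z)=y(z)$ for all $z$ with $|z|<j$. Let $\mathcal E_0$ (respectively $\mathcal E_1$) be the event that $x(z)=y(z)$ for every consistent $z$ with $|z|<n$, and $f(z)=g(z)$ (respectively $f(z)\ne g(z)$) for every consistent $z$ with $|z|=n$. Let $\mu=p(\,\cdot\mid\mathcal E_0\vee\mathcal E_1)$, and let $\mu'$ be the distribution in which $j$ is uniform in $\{0,\dots,n-1\}$ and, given $j$, $(x,y,f,g)$ has law $p(\,\cdot\mid j,\ \mathcal E_0\vee\mathcal E_1)$. The index $j$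 is hidden from both players. Let $\hat z\in[k]^n$ be the string with $\hat z_{r+1}=x(\hat z_{\le r})+y(\hat z_{\le r})$ for $0\le r<n$. The task is that both players output $f(\hat z)+g(\hat z)\bmod 2$; the error is the probability, over inputs and protocol, that they do not both do so. **Protocols.** A classical protocol uses public coins $R$ and private coins; with transcript $M$, its information cost on an input distribution is $IC=I(X;MR\mid Y)+I(Y;MR\mid X)$, where $X=(x,f)$ and $Y=(y,g)$ are the two inputs. A quantum protocol has finite-dimensional registers and a pre-shared pure state; the players alternately apply isometries controlled by their own inputs and send quantum messages $C_1,C_2,\dots$ (Alice sends the odd ones). It is run on the canonical purification $\sum_{X,Y}\sqrt{\mu(X,Y)}\,|X\,X\,Y\,Y\rangle$ of the input distribution, with purifying registers $R_XR_Y$, and the final state on $R_X$, $R_Y$ and the two output registers must be classical. Its quantum information cost is $$QIC=\sum_{i\ \mathrm{odd}} I(C_i;R_XR_Y\mid B_i)+\sum_{i\ \mathrm{even}} I(C_i;R_XR_Y\mid A_i),$$ where $A_i,B_i$ are all registers (input included) that Alice and Bob hold while $C_i$ is in transit. **Theorem.** There is a universal constant $K>0$ such that for all integers $n\ge2$ and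 $k\ge1$ there are a quantum protocol $\Pi'$ and a classical protocol $\Pi$ such that, for the input distribution $\mu$, and also for $\mu'$, both protocols accomplish the task with error at most $\frac1{\log n}$, and $$QIC(\Pi')\;\le\; IC(\Pi)\;\le\; K\cdot\log(k\log n)\cdot 2^{\frac{2\log n}{k}} .$$ -/

import Mathlib

/-! ## Classical information theory (finite alphabets, logarithms to base 2) -/

/-- Shannon entropy, in bits, of a probability mass function on a finite set. -/
noncomputable def shannonEntropy {α : Type} [Fintype α] (p : α → ℝ) : ℝ :=
  ∑ a, -(p a * Real.logb 2 (p a))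

/-- Conditional mutual information `I(P ; Q | Z)` of a joint probability mass function of
`(P, Q, Z)`, i.e. `H(PZ) + H(QZ) - H(PQZ) - H(Z)`. -/
noncomputable def condMutInf {P Q Z : Type} [Fintype P] [Fintype Q] [Fintype Z]
    (p : P × Q × Z → ℝ) : ℝ :=
  shannonEntropy (fun i : P × Z => ∑ q, p (i.1, q, i.2))
    + shannonEntropy (fun i : Q × Z => ∑ a, p (a, i.1, i.2))
    - shannonEntropy p
    - shannonEntropy (fun z : Z => ∑ a, ∑ q, p (a, q, z))

/-! ## Classical two-party protocols -/

/-- A classical communication protocol between Alice (input in `X`) and Bob (input in `Y`) with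
public and private randomness, both players giving an output in `O`. The messages have numbers
`0, 1, 2, …`; Alice sends those with even number, Bob those with odd number. Private randomness is
expressed by the message (and the output) being drawn from a distribution that depends on the
player's own input, the public coins and the messages sent so far. -/
structure ClassicalProtocol (X Y O : Type) [Fintype O] where
  /-- number of messages -/
  rounds : ℕ
  /-- values of the public coins -/
  R : Type
  /-- message alphabet -/
  M : Type
  [fintypeR : Fintype R]
  [fintypeM : Fintype M]
  /-- distribution of the public coins -/
  coins : stdSimplex ℝ R
  /-- distribution of message number `i` if Alice sends it -/
  alice : X → R → (i : ℕ) → (Fin i → M) → stdSimplex ℝ M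
  /-- distribution of message number `i` if Bob sends it -/
  bob : Y → R → (i : ℕ) → (Fin i → M) → stdSimplex ℝ M
  /-- distribution of Alice's output -/
  outA : X → R → (Fin rounds → M) → stdSimplex ℝ O
  /-- distribution of Bob's output -/
  outB : Y → R → (Fin rounds → M) → stdSimplex ℝ O

namespace ClassicalProtocol

attribute [instance] fintypeR fintypeM

variable {X Y O : Type} [Fintype X] [Fintype Y] [Fintype O]

/-- Probability that the first `i` messages are `m`, given inputs `x, y` and public coins `r`. -/
noncomputable def messagesProb (Pi : ClassicalProtocol X Y O) (x : X) (y : Y) (r : Pi.R) :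
    (i : ℕ) → (Fin i → Pi.M) → ℝ
  | 0, _ => 1
  | i + 1, m => messagesProb Pi x y r i (Fin.init m) *
      (if Even i then Pi.alice x r i (Fin.init m) (m (Fin.last i))
        else Pi.bob y r i (Fin.init m) (m (Fin.last i)))

/-- Probability of public coins `r` and transcript `m`, given inputs `x, y`. -/
noncomputable def transcriptProb (Pi : ClassicalProtocol X Y O) (x : X) (y : Y)
    (t : Pi.R × (Fin Pi.rounds → Pi.M)) : ℝ :=
  Pi.coins t.1 * Pi.messagesProb x y t.1 Pi.rounds t.2

/-- Probability that Alice outputs `a` and Bob outputs `b`, given inputs `x, y`. -/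
noncomputable def outputProb (Pi : ClassicalProtocol X Y O) (x : X) (y : Y) (a b : O) : ℝ :=
  ∑ t : Pi.R × (Fin Pi.rounds → Pi.M),
    Pi.transcriptProb x y t * (Pi.outA x t.1 t.2 a * Pi.outB y t.1 t.2 b)

open Classical in
/-- Probability, for inputs drawn from `mu`, that the outputs of the two players are not both
equal to `v x y`. -/
noncomputable def errorProb (Pi : ClassicalProtocol X Y O) (mu : X × Y → ℝ) (v : X → Y → O) : ℝ :=
  ∑ x : X, ∑ y : Y, ∑ a : O, ∑ b : O,
    if a = v x y ∧ b = v x y then 0 else mu (x, y) * Pi.outputProb x y a b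

/-- (Internal) information cost `I(X ; M R | Y) + I(Y ; M R | X)`, where `M` is the transcript and
`R` the public coins, for inputs drawn from `mu`. -/
noncomputable def IC (Pi : ClassicalProtocol X Y O) (mu : X × Y → ℝ) : ℝ :=
  condMutInf (fun i : X × (Pi.R × (Fin Pi.rounds → Pi.M)) × Y =>
      mu (i.1, i.2.2) * Pi.transcriptProb i.1 i.2.2 i.2.1)
    + condMutInf (fun i : Y × (Pi.R × (Fin Pi.rounds → Pi.M)) × X =>
      mu (i.2.2, i.1) * Pi.transcriptProb i.2.2 i.1 i.2.1)

end ClassicalProtocol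

/-! ## Quantum information theory

A register is a finite type, the labels of an orthonormal basis of its Hilbert space. -/

open Classical in
/-- Von Neumann entropy `-Tr ρ log ρ`, to base 2, of a density matrix `ρ`, through its eigenvalues
(0 if the matrix is not Hermitian). -/
noncomputable def vonNeumannEntropy {S : Type} [Fintype S] (rho : Matrix S S ℂ) : ℝ :=
  if h : rho.IsHermitian then ∑ i, -(h.eigenvalues i * Real.logb 2 (h.eigenvalues i)) else 0

/-- Reduced state on `S` of the pure state `psi` on `S ⊗ E`: the partial trace over `E`. -/
noncomputable def reducedState {S E : Type} [Fintype E] (psi : S × E → ℂ) : Matrix S S ℂ :=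
  Matrix.of fun i j => ∑ e, psi (i, e) * star (psi (j, e))

/-- Quantum conditional mutual information `I(P ; Q | Z)` of a state on `P ⊗ Q ⊗ Z`, i.e.
`S(PZ) + S(QZ) - S(PQZ) - S(Z)`, the entropies being those of the marginal states. -/
noncomputable def quantumCondMutInf {P Q Z : Type} [Fintype P] [Fintype Q] [Fintype Z]
    (rho : Matrix (P × Q × Z) (P × Q × Z) ℂ) : ℝ :=
  vonNeumannEntropy (Matrix.of fun i j : P × Z => ∑ q, rho (i.1, q, i.2) (j.1, q, j.2))
    + vonNeumannEntropy (Matrix.of fun i j : Q × Z => ∑ p, rho (p, i.1, i.2) (p, j.1, j.2))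
    - vonNeumannEntropy rho
    - vonNeumannEntropy (Matrix.of fun i j : Z => ∑ p, ∑ q, rho (p, q, i) (p, q, j))

/-! ## Quantum two-party protocols -/

open Classical in
/-- `U` is the matrix of an isometry from the Hilbert space with basis `I` to the one with
basis `J`: its columns are orthonormal. -/
def IsIsometryMatrix {I J : Type} [Fintype J] (U : Matrix J I ℂ) : Prop :=
  ∀ i i' : I, ∑ j, star (U j i) * U j i' = if i = i' then 1 else 0

/-- A quantum communication protocol with pre-shared entanglement and quantum messages, for
classical inputs in `X` (Alice) and `Y` (Bob) and outputs in `O` of both players. All the isometries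
that a player applies are controlled by that player's input. There are `2 * turns` messages, sent
alternately, Alice starting. Before turn `s` Alice holds the memory `A s` and the message `CB s`,
and Bob the memory `B s`. In turn `s` Alice applies the isometry `U s` and sends `CA s`, then Bob
applies `V s` and sends `CB (s + 1)`. `CB 0` is not a message, but a part of Alice's
initial memory. Registers may have dimension 1, so a message may be void. -/
structure QuantumProtocol (X Y O : Type) [Fintype O] where
  turns : ℕ
  /-- Alice's memory -/
  A : ℕ → Type
  /-- Bob's memory -/
  B : ℕ → Type
  /-- messages from Alice to Bob -/
  CA : ℕ → Type
  /-- messages from Bob to Alice -/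
  CB : ℕ → Type
  /-- Alice's discarded final memory -/
  Af : Type
  /-- Bob's discarded final memory -/
  Bf : Type
  [fintypeA : ∀ s, Fintype (A s)]
  [fintypeB : ∀ s, Fintype (B s)]
  [fintypeCA : ∀ s, Fintype (CA s)]
  [fintypeCB : ∀ s, Fintype (CB s)]
  [fintypeAf : Fintype Af]
  [fintypeBf : Fintype Bf]
  /-- the pre-shared pure state -/
  shared : A 0 → B 0 → CB 0 → ℂ
  shared_unit : ∑ a, ∑ b, ∑ c, ‖shared a b c‖ ^ 2 = 1
  U : (s : ℕ) → X → Matrix (A (s + 1) × CA s) (A s × CB s) ℂ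
  V : (s : ℕ) → Y → Matrix (B (s + 1) × CB (s + 1)) (B s × CA s) ℂ
  /-- Alice's last isometry, which prepares her output register -/
  Uf : X → Matrix (O × Af) (A turns × CB turns) ℂ
  /-- Bob's last isometry, which prepares his output register -/
  Vf : Y → Matrix (O × Bf) (B turns) ℂ
  isometry_U : ∀ s x, IsIsometryMatrix (U s x)
  isometry_V : ∀ s y, IsIsometryMatrix (V s y)
  isometry_Uf : ∀ x, IsIsometryMatrix (Uf x)
  isometry_Vf : ∀ y, IsIsometryMatrix (Vf y)

namespace QuantumProtocol

attribute [instance] fintypeA fintypeB fintypeCA fintypeCB fintypeAf fintypeBf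

variable {X Y O : Type} [Fintype X] [Fintype Y] [Fintype O]

open Classical in
/-- Amplitudes `⟨rx ry x y|ρ_μ⟩` of the canonical purification
`∑ x y, √(mu (x, y)) |x x y y⟩` on the registers `R_X, R_Y, X, Y`. -/
noncomputable def inputState (mu : X × Y → ℝ) (rx : X) (ry : Y) (x : X) (y : Y) : ℂ :=
  if rx = x ∧ ry = y then ((Real.sqrt (mu (x, y)) : ℝ) : ℂ) else 0

/-- Action of Alice's controlled isometry of turn `s` on a global state with registers
`R_X, R_Y, X, Y`, Alice's memory, Bob's memory, message. -/
noncomputable def applyAlice (Pi : QuantumProtocol X Y O) (s : ℕ)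
    (psi : X → Y → X → Y → Pi.A s → Pi.B s → Pi.CB s → ℂ) :
    X → Y → X → Y → Pi.A (s + 1) → Pi.B s → Pi.CA s → ℂ :=
  fun rx ry x y a' b c' => ∑ a, ∑ c, Pi.U s x (a', c') (a, c) * psi rx ry x y a b c

/-- Action of Bob's controlled isometry of turn `s`. -/
noncomputable def applyBob (Pi : QuantumProtocol X Y O) (s : ℕ)
    (psi : X → Y → X → Y → Pi.A (s + 1) → Pi.B s → Pi.CA s → ℂ) :
    X → Y → X → Y → Pi.A (s + 1) → Pi.B (s + 1) → Pi.CB (s + 1) → ℂ :=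
  fun rx ry x y a b' c' => ∑ b, ∑ c, Pi.V s y (b', c') (b, c) * psi rx ry x y a b c

/-- Global pure state after `s` turns, i.e. after `2 * s` messages. -/
noncomputable def stateEven (Pi : QuantumProtocol X Y O) (mu : X × Y → ℝ) :
    (s : ℕ) → X → Y → X → Y → Pi.A s → Pi.B s → Pi.CB s → ℂ
  | 0 => fun rx ry x y a b c => inputState mu rx ry x y * Pi.shared a b c
  | s + 1 => Pi.applyBob s (Pi.applyAlice s (stateEven Pi mu s))

/-- Global pure state after Alice's message of turn `s`, i.e. after `2 * s + 1` messages. -/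
noncomputable def stateOdd (Pi : QuantumProtocol X Y O) (mu : X × Y → ℝ) (s : ℕ) :
    X → Y → X → Y → Pi.A (s + 1) → Pi.B s → Pi.CA s → ℂ :=
  Pi.applyAlice s (Pi.stateEven mu s)

/-- Quantum information cost: the sum, over the messages `C` from Alice to Bob, of
`I(C ; R_X R_Y | Bob's registers)` and, over the messages `C` from Bob to Alice, of
`I(C ; R_X R_Y | Alice's registers)`, each taken in the global state right after the sender's
isometry. The registers of a player include the player's input register. -/
noncomputable def QIC (Pi : QuantumProtocol X Y O) (mu : X × Y → ℝ) : ℝ :=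
  ∑ s ∈ Finset.range Pi.turns,
    (quantumCondMutInf (reducedState
        fun i : (Pi.CA s × (X × Y) × (Y × Pi.B s)) × (X × Pi.A (s + 1)) =>
          Pi.stateOdd mu s i.1.2.1.1 i.1.2.1.2 i.2.1 i.1.2.2.1 i.2.2 i.1.2.2.2 i.1.1)
      + quantumCondMutInf (reducedState
        fun i : (Pi.CB (s + 1) × (X × Y) × (X × Pi.A (s + 1))) × (Y × Pi.B (s + 1)) =>
          Pi.stateEven mu (s + 1) i.1.2.1.1 i.1.2.1.2 i.1.2.2.1 i.2.1 i.1.2.2.2 i.2.2 i.1.1))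

/-- Global pure state after the last isometries of Alice and Bob, on the registers
`R_X, R_Y, A_out, B_out` and the registers `X, Y, Af, Bf`, which are traced out in the end. -/
noncomputable def finalState (Pi : QuantumProtocol X Y O) (mu : X × Y → ℝ) :
    ((X × Y) × (O × O)) × (X × Y × Pi.Af × Pi.Bf) → ℂ :=
  fun i => ∑ a, ∑ b, ∑ c,
    Pi.Uf i.2.1 (i.1.2.1, i.2.2.2.1) (a, c) * Pi.Vf i.2.2.1 (i.1.2.2, i.2.2.2.2) b *
      Pi.stateEven mu Pi.turns i.1.1.1 i.1.1.2 i.2.1 i.2.2.1 a b c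

/-- The output of the protocol: the final marginal state on `R_X R_Y A_out B_out`. -/
noncomputable def output (Pi : QuantumProtocol X Y O) (mu : X × Y → ℝ) :
    Matrix ((X × Y) × (O × O)) ((X × Y) × (O × O)) ℂ :=
  reducedState (Pi.finalState mu)

open Classical in
/-- Probability, for inputs drawn from `mu`, that the outputs of the two players are not both
equal to `v x y`. -/
noncomputable def errorProb (Pi : QuantumProtocol X Y O) (mu : X × Y → ℝ) (v : X → Y → O) : ℝ :=
  ∑ x : X, ∑ y : Y, ∑ a : O, ∑ b : O,
    if a = v x y ∧ b = v x y then 0 else (Pi.output mu ((x, y), (a, b)) ((x, y), (a, b))).re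

/-- For inputs drawn from `mu`, the final state on `R_X R_Y A_out B_out` is classical, and the
protocol computes `v` with error at most `ε`. -/
def Solves (Pi : QuantumProtocol X Y O) (mu : X × Y → ℝ) (v : X → Y → O) (ε : ℝ) : Prop :=
  (Pi.output mu).IsDiag ∧ Pi.errorProb mu v ≤ ε

end QuantumProtocol

/-! ## Symmetric `k`-ary pointer jumping -/

namespace PointerJumping

/-- Strings of length `< n` over `{0, …, k-1}`: the internal nodes of the `k`-ary tree. -/
abbrev Node (n k : ℕ) : Type := (r : Fin n) × (Fin r → Fin k)

/-- Strings of length `n`: the leaves. -/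
abbrev Leaf (n k : ℕ) : Type := Fin n → Fin k

/-- The input of one player: `(x, f)` for Alice, `(y, g)` for Bob. -/
abbrev Input (n k : ℕ) : Type := (Node n k → Fin k) × (Leaf n k → ZMod 2)

/-- The prefix of length `j` of a string of length `r ≥ j`. -/
def pre {k r : ℕ} (z : Fin r → Fin k) (j : ℕ) (h : j ≤ r) : Fin j → Fin k :=
  fun i => z (Fin.castLE h i)

/-- The string `z`, of length `r`, is consistent with `x, y, j`: it is longer than `j`, and
`x(z_{≤ j}) + y(z_{≤ j})` is its character number `j + 1` modulo `k`
(addition in `Fin k` is modulo `k`, and characters are indexed from 0 here). -/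
def Consistent {n k : ℕ} (x y : Node n k → Fin k) (j : Fin n) {r : ℕ} (z : Fin r → Fin k) : Prop :=
  ∃ h : (j : ℕ) < r, x ⟨j, pre z j h.le⟩ + y ⟨j, pre z j h.le⟩ = z ⟨j, h⟩

/-- `x` and `y` agree on all strings of length less than `j`. -/
def AgreeBelow {n k : ℕ} (j : Fin n) (u v : Input n k) : Prop :=
  ∀ z : Node n k, z.1 < j → u.1 z = v.1 z

open Classical in
/-- The fooling distribution `p(x, y, f, g, j)`: `j` is uniform, and then `(x, f), (y, g)` is
uniform among the pairs with `x` and `y` equal on all strings of length less than `j`. -/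
noncomputable def foolingDist (n k : ℕ) (i : (Input n k × Input n k) × Fin n) : ℝ :=
  1 / (n : ℝ) *
    (if AgreeBelow i.2 i.1.1 i.1.2 then
      1 / (Fintype.card {w : Input n k × Input n k // AgreeBelow i.2 w.1 w.2} : ℝ) else 0)

/-- On consistent nodes `x = y`, and on consistent leaves `f = g`. -/
def Event0 {n k : ℕ} (i : (Input n k × Input n k) × Fin n) : Prop :=
  (∀ z : Node n k, Consistent i.1.1.1 i.1.2.1 i.2 z.2 → i.1.1.1 z = i.1.2.1 z) ∧
    ∀ z : Leaf n k, Consistent i.1.1.1 i.1.2.1 i.2 z → i.1.1.2 z = i.1.2.2 z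

/-- On consistent nodes `x = y`, and on consistent leaves `f ≠ g`. -/
def Event1 {n k : ℕ} (i : (Input n k × Input n k) × Fin n) : Prop :=
  (∀ z : Node n k, Consistent i.1.1.1 i.1.2.1 i.2 z.2 → i.1.1.1 z = i.1.2.1 z) ∧
    ∀ z : Leaf n k, Consistent i.1.1.1 i.1.2.1 i.2 z → i.1.1.2 z ≠ i.1.2.2 z

open Classical in
/-- The hard distribution `mu(x, y, f, g, j)`: the fooling distribution conditioned on
`Event0 ∨ Event1`. -/
noncomputable def hardDistFull (n k : ℕ) (i : (Input n k × Input n k) × Fin n) : ℝ :=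
  (if Event0 i ∨ Event1 i then foolingDist n k i else 0) /
    ∑ w, if Event0 w ∨ Event1 w then foolingDist n k w else 0

/-- The distribution of the inputs `((x, f), (y, g))` under the hard distribution; the index `j`
is hidden. -/
noncomputable def hardDist (n k : ℕ) (i : Input n k × Input n k) : ℝ :=
  ∑ j : Fin n, hardDistFull n k (i, j)

open Classical in
/-- The variant of the input distribution in which `j` is uniform, and then `(x, f), (y, g)` is
drawn from the conditional fooling distribution given `j`, conditioned on `Event0 ∨ Event1`. -/
noncomputable def hardDistUniform (n k : ℕ) (i : Input n k × Input n k) : ℝ :=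
  ∑ j : Fin n, 1 / (n : ℝ) *
    ((if Event0 (i, j) ∨ Event1 (i, j) then foolingDist n k (i, j) else 0) /
      ∑ w, if Event0 (w, j) ∨ Event1 (w, j) then foolingDist n k (w, j) else 0)

/-- The string of length `r ≤ n` found by jumping from the empty string, where the character
that follows the string `z` is `x(z) + y(z)`. -/
def path {n k : ℕ} (x y : Node n k → Fin k) : (r : ℕ) → r ≤ n → (Fin r → Fin k)
  | 0, _ => Fin.elim0
  | r + 1, h =>
    Fin.snoc (path x y r (Nat.le_of_succ_le h))
      (x ⟨⟨r, h⟩, path x y r (Nat.le_of_succ_le h)⟩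
        + y ⟨⟨r, h⟩, path x y r (Nat.le_of_succ_le h)⟩)

/-- The value that Alice and Bob have to output: `f(ẑ) + g(ẑ)` modulo 2, where `ẑ` is the leaf
reached by jumping. -/
def target {n k : ℕ} (u v : Input n k) : ZMod 2 :=
  u.2 (path u.1 v.1 n le_rfl) + v.2 (path u.1 v.1 n le_rfl)

end PointerJumping

/-!
The classical protocol is a walk down the tree in which every message is a noisy version of the
sender's value at the node that the previous messages lead to: with probability `1 - ε` the value
itself, with probability `ε` a uniform element of `[k]`. A player cannot know whether a node
lies above, on or below level `j`, and need not: above level `j` and on the consistent subtree the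
two values agree, so each player can predict the distribution of the other's message from his own
value and the message carries no information. At a node where the values differ, the message costs
at most `log₂ (k / ε)`, a bound for the divergence of the two noisy distributions. This comparison
with a predicted message distribution is `condMutInf_le_divergence`, which together with the chain rule for
the transcript gives `MessageScheme.IC_toClassical_le`.

The sum of the two messages is the next step of the walk, so the walk reaches an inconsistent node
only if the noise strikes at level `j`. At an inconsistent node the two values are independent, so
there the two messages differ with probability `1 - 1 / k`. The protocol aborts after `m`
consecutive rounds with different messages. With `ε = 1 / (16 log₂ n)` and `m = ⌊log₂ n⌋ + 3`, it is
unlikely that noise alone produces such a run in one of the `n` rounds. Then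

* the error is bounded by a potential in the current length of the run (`failurePotential`,
  `sum_prob_wrong_le`), for each fixed pair of inputs of positive probability;
* the number of rounds spent at inconsistent nodes before the abort has mean
  `O(m (1 - 1 / k)⁻ᵐ)`, the waiting time for `m` differences in a row (`exists_roundsBound`). The
  walk gets there only with probability `O(ε)`, so that the mean number of disagreements is
  `O(1 + ε m 2 ^ (2 m / k))` (`sum_disagreements_le`). The independence of the two values at an
  inconsistent node is used by resampling one of them, which changes neither the event defining the
  input distribution nor the probability of reaching the node (`hard_setValue`, `prob_setValue`).

Both `hardDist` and `hardDistUniform` are mixtures over `j` of uniform distributions on the hard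
pairs (`PointerJumping.IsHardMixture`), and nothing else about them is used. For `n = 2` the error
allowed is `1`, and the protocol without messages does.

Since the classical protocol has no public coins, it can be run coherently: the sender of a message
with distribution `p` prepares `∑ a, √(p a) |a⟩ |a⟩`, keeps one half and sends the other. All
reduced states occurring in the quantum information cost are then, after reordering registers, of
the form `G * Gᴴ` with `Gᴴ * G` diagonal, so that their entropies are Shannon entropies
(`vonNeumannEntropy_mul_conjTranspose`), and the quantum information cost equals the classical one
(`MessageScheme.QIC_toQuantum`).
-/

/-! ### Entropy of finite distributions -/

/-- The contribution `-x log₂ x` of a probability `x` to the Shannon entropy. -/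
noncomputable def entropyTerm (x : ℝ) : ℝ := -(x * Real.logb 2 x)

@[simp] theorem entropyTerm_zero : entropyTerm 0 = 0 := by simp [entropyTerm]

theorem shannonEntropy_eq {α : Type} [Fintype α] (p : α → ℝ) :
    shannonEntropy p = ∑ a, entropyTerm (p a) := rfl

theorem entropyTerm_mul (a b : ℝ) :
    entropyTerm (a * b) = b * entropyTerm a + a * entropyTerm b := by
  unfold entropyTerm
  rcases eq_or_ne a 0 with rfl | ha
  · simp
  rcases eq_or_ne b 0 with rfl | hb
  · simp
  rw [Real.logb_mul ha hb]
  ring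

/-- Chain rule for a distribution `p` followed by a stochastic kernel `κ`. -/
theorem sum_entropyTerm_mul {α β : Type} [Fintype α] [Fintype β] (p : α → ℝ) (κ : α → β → ℝ)
    (hκ : ∀ a, ∑ b, κ a b = 1) :
    ∑ a, ∑ b, entropyTerm (p a * κ a b)
      = ∑ a, entropyTerm (p a) + ∑ a, p a * ∑ b, entropyTerm (κ a b) := by
  rw [← Finset.sum_add_distrib]
  refine Finset.sum_congr rfl fun a _ => ?_
  simp only [entropyTerm_mul, Finset.sum_add_distrib, ← Finset.sum_mul, ← Finset.mul_sum, hκ,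
    one_mul]

/-- The inequality `log t ≤ t - 1` at `t = s q / r`, which is what Gibbs' inequality sums. -/
theorem entropyTerm_add_le {r s q : ℝ} (hr : 0 ≤ r) (hs : 0 ≤ s) (hq : 0 ≤ q)
    (hrs : r ≠ 0 → s ≠ 0) (hrq : r ≠ 0 → q ≠ 0) :
    entropyTerm r + r * Real.logb 2 s + r * Real.logb 2 q ≤ (s * q - r) / Real.log 2 := by
  have h2 : 0 < Real.log 2 := Real.log_pos (by norm_num)
  rcases eq_or_ne r 0 with rfl | h
  · simp only [entropyTerm_zero, zero_mul, add_zero, sub_zero]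
    positivity
  have hs' := hrs h
  have hq' := hrq h
  have hpos : 0 < s * q / r := by positivity
  have key := Real.log_le_sub_one_of_pos hpos
  rw [Real.log_div (by positivity) h, Real.log_mul hs' hq'] at key
  unfold entropyTerm Real.logb
  rw [le_div_iff₀ h2]
  have e : (-(r * (Real.log r / Real.log 2)) + r * (Real.log s / Real.log 2)
      + r * (Real.log q / Real.log 2)) * Real.log 2
      = r * (Real.log s + Real.log q - Real.log r) := by
    field_simp
    ring
  rw [e]
  calc r * (Real.log s + Real.log q - Real.log r) ≤ r * (s * q / r - 1) := by gcongr
    _ = s * q - r := by field_simp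

/-- The conditional mutual information between `P` and the output `Q` of a kernel `κ` applied to
`(P, Z)` is at most the average divergence of `κ` from any kernel `q` that sees `Z` only. -/
theorem condMutInf_le_divergence {P Q Z : Type} [Fintype P] [Fintype Q] [Fintype Z]
    (mu : P → Z → ℝ) (κ : P → Z → Q → ℝ) (q : Z → Q → ℝ)
    (hmu : ∀ x z, 0 ≤ mu x z) (hκ : ∀ x z t, 0 ≤ κ x z t) (hκ1 : ∀ x z, ∑ t, κ x z t = 1)
    (hq : ∀ z t, 0 ≤ q z t) (hq1 : ∀ z, ∑ t, q z t ≤ 1)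
    (hac : ∀ x z t, κ x z t ≠ 0 → mu x z ≠ 0 → q z t ≠ 0) :
    condMutInf (fun i : P × Q × Z => mu i.1 i.2.2 * κ i.1 i.2.2 i.2.1)
      ≤ ∑ x, ∑ z, mu x z * ∑ t, κ x z t * Real.logb 2 (κ x z t / q z t) := by
  have h2 : 0 < Real.log 2 := Real.log_pos (by norm_num)
  -- entropies of the marginals on `PZ`, `PQZ` and `Z`
  have hPZ : shannonEntropy (fun i : P × Z => ∑ t, mu i.1 i.2 * κ i.1 i.2 t)
      = ∑ x, ∑ z, entropyTerm (mu x z) := by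
    simp only [shannonEntropy_eq, Fintype.sum_prod_type, ← Finset.mul_sum, hκ1, mul_one]
  have hPQZ : shannonEntropy (fun i : P × Q × Z => mu i.1 i.2.2 * κ i.1 i.2.2 i.2.1)
      = ∑ x, ∑ z, entropyTerm (mu x z) + ∑ x, ∑ z, mu x z * ∑ t, entropyTerm (κ x z t) := by
    rw [← Finset.sum_add_distrib]
    simp only [shannonEntropy_eq, Fintype.sum_prod_type]
    refine Finset.sum_congr rfl fun x _ => ?_
    rw [Finset.sum_comm]
    exact sum_entropyTerm_mul (mu x) (κ x) (hκ1 x)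
  have hZ : shannonEntropy (fun z : Z => ∑ x, ∑ t, mu x z * κ x z t)
      = ∑ z, entropyTerm (∑ x, mu x z) := by
    simp only [shannonEntropy_eq, ← Finset.mul_sum, hκ1, mul_one]
  set s : Z → ℝ := fun z => ∑ x, mu x z with hs
  set r : Q → Z → ℝ := fun t z => ∑ x, mu x z * κ x z t with hr
  have hs0 : ∀ z, 0 ≤ s z := fun z => Finset.sum_nonneg fun x _ => hmu x z
  have hr0 : ∀ t z, 0 ≤ r t z := fun t z =>
    Finset.sum_nonneg fun x _ => mul_nonneg (hmu x z) (hκ x z t)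
  have hrx : ∀ t z, r t z ≠ 0 → ∃ x, mu x z ≠ 0 ∧ κ x z t ≠ 0 := by
    intro t z h
    obtain ⟨x, -, hx⟩ := Finset.exists_ne_zero_of_sum_ne_zero h
    exact ⟨x, left_ne_zero_of_mul hx, right_ne_zero_of_mul hx⟩
  have hrsum : ∀ z, ∑ t, r t z = s z := by
    intro z
    simp only [hr, hs]
    rw [Finset.sum_comm]
    simp only [← Finset.mul_sum, hκ1, mul_one]
  have gibbs : ∑ t, ∑ z, (entropyTerm (r t z) + r t z * Real.logb 2 (s z)
      + r t z * Real.logb 2 (q z t)) ≤ 0 := by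
    calc _ ≤ ∑ t, ∑ z, (s z * q z t - r t z) / Real.log 2 := by
          refine Finset.sum_le_sum fun t _ => Finset.sum_le_sum fun z _ => ?_
          refine entropyTerm_add_le (hr0 t z) (hs0 z) (hq z t) (fun h => ?_) (fun h => ?_)
          · obtain ⟨x, hx, -⟩ := hrx t z h
            exact ne_of_gt (lt_of_lt_of_le (lt_of_le_of_ne (hmu x z) hx.symm)
              (Finset.single_le_sum (f := fun x => mu x z) (fun x _ => hmu x z)
                (Finset.mem_univ x)))
          · obtain ⟨x, hx, hx'⟩ := hrx t z h
            exact hac x z t hx' hx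
      _ = (∑ z, (s z * ∑ t, q z t - ∑ t, r t z)) / Real.log 2 := by
          rw [Finset.sum_comm, Finset.sum_div]
          refine Finset.sum_congr rfl fun z _ => ?_
          rw [← Finset.sum_div, Finset.sum_sub_distrib, Finset.mul_sum]
      _ ≤ 0 := by
          refine div_nonpos_of_nonpos_of_nonneg (Finset.sum_nonpos fun z _ => ?_) h2.le
          rw [hrsum]
          have := mul_le_mul_of_nonneg_left (hq1 z) (hs0 z)
          linarith
  have hlogs : ∑ t, ∑ z, r t z * Real.logb 2 (s z) = -∑ z, entropyTerm (s z) := by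
    rw [Finset.sum_comm, ← Finset.sum_neg_distrib]
    refine Finset.sum_congr rfl fun z _ => ?_
    rw [← Finset.sum_mul, hrsum]
    simp [entropyTerm]
  have hlogq : ∑ t, ∑ z, r t z * Real.logb 2 (q z t)
      = ∑ x, ∑ z, mu x z * ∑ t, κ x z t * Real.logb 2 (q z t) := by
    simp only [hr, Finset.sum_mul, Finset.mul_sum]
    rw [Finset.sum_comm, Finset.sum_congr rfl fun z _ => Finset.sum_comm, Finset.sum_comm]
    refine Finset.sum_congr rfl fun x _ => Finset.sum_congr rfl fun z _ =>
      Finset.sum_congr rfl fun t _ => by ring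
  have hdiv : ∑ x, ∑ z, mu x z * ∑ t, κ x z t * Real.logb 2 (κ x z t / q z t)
      = -∑ x, ∑ z, mu x z * ∑ t, entropyTerm (κ x z t)
        - ∑ x, ∑ z, mu x z * ∑ t, κ x z t * Real.logb 2 (q z t) := by
    rw [← Finset.sum_neg_distrib, ← Finset.sum_sub_distrib]
    refine Finset.sum_congr rfl fun x _ => ?_
    rw [← Finset.sum_neg_distrib, ← Finset.sum_sub_distrib]
    refine Finset.sum_congr rfl fun z _ => ?_
    rcases eq_or_ne (mu x z) 0 with h | h
    · simp [h]
    rw [← mul_neg, ← mul_sub, ← Finset.sum_neg_distrib, ← Finset.sum_sub_distrib]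
    congr 1
    refine Finset.sum_congr rfl fun t _ => ?_
    rcases eq_or_ne (κ x z t) 0 with h' | h'
    · simp [h']
    rw [Real.logb_div h' (hac x z t h' h)]
    unfold entropyTerm
    ring
  simp only [Finset.sum_add_distrib] at gibbs
  have hQZ : shannonEntropy (fun i : Q × Z => r i.1 i.2) = ∑ t, ∑ z, entropyTerm (r t z) := by
    simp only [shannonEntropy_eq, Fintype.sum_prod_type]
  unfold condMutInf
  rw [hPQZ]
  simp only [hPZ, hZ]
  rw [hdiv]
  linarith [hlogs, hlogq, gibbs]

/-! ### Sequences of messages -/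

theorem sum_snoc {M : Type} [Fintype M] {A : Type*} [AddCommMonoid A] {i : ℕ}
    (F : (Fin (i + 1) → M) → A) :
    ∑ h, F h = ∑ h : Fin i → M, ∑ m, F (Fin.snoc h m) := by
  rw [← (Fin.snocEquiv fun _ => M).sum_comp, Fintype.sum_prod_type_right]
  rfl

/-- Probability of the messages `h` when message number `i` is drawn from the kernel `κ i`, given
the messages before it. -/
def seqProb {M : Type} (κ : (i : ℕ) → (Fin i → M) → M → ℝ) : (i : ℕ) → (Fin i → M) → ℝ
  | 0, _ => 1
  | i + 1, h => seqProb κ i (Fin.init h) * κ i (Fin.init h) (h (Fin.last i))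

section seqProb

variable {M : Type} (κ κ' : (i : ℕ) → (Fin i → M) → M → ℝ)

theorem seqProb_snoc (i : ℕ) (h : Fin i → M) (m : M) :
    seqProb κ (i + 1) (Fin.snoc h m : Fin (i + 1) → M) = seqProb κ i h * κ i h m := by
  simp [seqProb]

variable {κ κ'}

theorem seqProb_nonneg (hκ : ∀ i h m, 0 ≤ κ i h m) : ∀ i h, 0 ≤ seqProb κ i h
  | 0, _ => zero_le_one
  | i + 1, _ => mul_nonneg (seqProb_nonneg hκ i _) (hκ _ _ _)

theorem seqProb_ne_zero (hac : ∀ i h m, κ i h m ≠ 0 → κ' i h m ≠ 0) :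
    ∀ i h, seqProb κ i h ≠ 0 → seqProb κ' i h ≠ 0
  | 0, _ => fun _ => one_ne_zero
  | i + 1, _ => fun H => mul_ne_zero (seqProb_ne_zero hac i _ (left_ne_zero_of_mul H))
      (hac _ _ _ (right_ne_zero_of_mul H))

variable [Fintype M]

theorem sum_seqProb (hκ : ∀ i h, ∑ m, κ i h m = 1) : ∀ i, ∑ h, seqProb κ i h = 1
  | 0 => by simp [seqProb]
  | i + 1 => by
    simp only [sum_snoc, seqProb_snoc, ← Finset.mul_sum, hκ, mul_one, sum_seqProb hκ i]

/-- Chain rule for the divergence of message sequences. -/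
theorem sum_seqProb_logb (hκ : ∀ i h, ∑ m, κ i h m = 1)
    (hac : ∀ i h m, κ i h m ≠ 0 → κ' i h m ≠ 0) : ∀ N : ℕ,
    ∑ h, seqProb κ N h * Real.logb 2 (seqProb κ N h / seqProb κ' N h)
      = ∑ i ∈ Finset.range N, ∑ h, seqProb κ i h *
          ∑ m, κ i h m * Real.logb 2 (κ i h m / κ' i h m)
  | 0 => by simp [seqProb]
  | N + 1 => by
    rw [Finset.sum_range_succ, ← sum_seqProb_logb hκ hac N, ← Finset.sum_add_distrib, sum_snoc]
    refine Finset.sum_congr rfl fun h _ => ?_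
    simp only [seqProb_snoc]
    rcases eq_or_ne (seqProb κ N h) 0 with h0 | h0
    · simp [h0]
    have h0' := seqProb_ne_zero hac N h h0
    have : ∀ m, seqProb κ N h * κ N h m *
          Real.logb 2 (seqProb κ N h * κ N h m / (seqProb κ' N h * κ' N h m))
        = κ N h m * (seqProb κ N h * Real.logb 2 (seqProb κ N h / seqProb κ' N h))
          + seqProb κ N h * (κ N h m * Real.logb 2 (κ N h m / κ' N h m)) := by
      intro m
      rcases eq_or_ne (κ N h m) 0 with h1 | h1
      · simp [h1]
      rw [mul_div_mul_comm, Real.logb_mul (div_ne_zero h0 h0') (div_ne_zero h1 (hac N h m h1))]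
      ring
    simp only [this, Finset.sum_add_distrib, ← Finset.sum_mul, ← Finset.mul_sum, hκ, one_mul]

end seqProb

/-! ### Von Neumann entropy of Gram matrices -/

open Matrix Polynomial in
/-- If the columns of `G` are orthogonal with squared norms `lam`, then `G Gᴴ` has the nonzero
eigenvalues `lam`: the polynomials `charpoly (G Gᴴ)` and `charpoly (Gᴴ G)` differ by a power
of `X`. -/
theorem vonNeumannEntropy_mul_conjTranspose {S T : Type} [Fintype S] [Fintype T] [DecidableEq T]
    (G : Matrix S T ℂ) (lam : T → ℝ) (h : Gᴴ * G = diagonal fun t => (lam t : ℂ)) :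
    vonNeumannEntropy (G * Gᴴ) = shannonEntropy lam := by
  classical
  have hH : (G * Gᴴ).IsHermitian := isHermitian_mul_conjTranspose_self G
  have key := charpoly_mul_comm' G Gᴴ
  rw [h] at key
  have hroots := congrArg Polynomial.roots key
  rw [roots_mul (mul_ne_zero (pow_ne_zero _ X_ne_zero) (charpoly_monic _).ne_zero),
    roots_mul (mul_ne_zero (pow_ne_zero _ X_ne_zero) (charpoly_monic _).ne_zero),
    roots_pow, roots_pow, roots_X, hH.roots_charpoly_eq_eigenvalues, charpoly_diagonal,
    roots_prod _ _ (Finset.prod_ne_zero_iff.2 fun t _ => X_sub_C_ne_zero _)] at hroots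
  simp only [roots_X_sub_C, Multiset.bind_singleton] at hroots
  have hsum := congrArg (fun s => (s.map fun z : ℂ => entropyTerm z.re).sum) hroots
  simp only [Multiset.map_add, Multiset.sum_add, Multiset.map_nsmul, Multiset.sum_nsmul,
    Multiset.map_singleton, Multiset.sum_singleton, Complex.zero_re, entropyTerm_zero,
    smul_zero, zero_add, Multiset.map_map, Function.comp_def] at hsum
  rw [vonNeumannEntropy, dif_pos hH]
  simpa [entropyTerm, shannonEntropy] using hsum

open Matrix in
theorem vonNeumannEntropy_diagonal {S : Type} [Fintype S] [DecidableEq S] (lam : S → ℝ)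
    (hlam : ∀ s, 0 ≤ lam s) :
    vonNeumannEntropy (diagonal fun s => (lam s : ℂ)) = shannonEntropy lam := by
  have e : ∀ s, ((√(lam s) : ℝ) : ℂ) * ((√(lam s) : ℝ) : ℂ) = lam s := fun s => by
    rw [← Complex.ofReal_mul, Real.mul_self_sqrt (hlam s)]
  have := vonNeumannEntropy_mul_conjTranspose (diagonal fun s => ((√(lam s) : ℝ) : ℂ)) lam
    (by simp [diagonal_conjTranspose, diagonal_mul_diagonal, e])
  simpa [diagonal_conjTranspose, diagonal_mul_diagonal, e] using this

/-! ### Sending a classical message coherently -/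

section Message

variable {S T M Q : Type} {n : ℕ}

open Classical in
/-- Purification of a classical message: the sender, with input `s`, and the receiver, with
input `t`, both hold the messages `h` sent before, with joint distribution `w`; the new
message `c`, drawn from `κ s h`, is in transit and the sender keeps a copy. The register `Q` holds
copies of both inputs. -/
noncomputable def messageState (e : Q ≃ S × T) (w : S → T → (Fin n → M) → ℝ)
    (κ : S → (Fin n → M) → M → ℝ) :
    (M × Q × (T × (Fin n → M))) × (S × (Fin (n + 1) → M)) → ℂ :=
  fun a => if e a.1.2.1 = (a.2.1, a.1.2.2.1) ∧ a.2.2 = Fin.snoc a.1.2.2.2 a.1.1 then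
    ((√(w a.2.1 a.1.2.2.1 a.1.2.2.2 * κ a.2.1 a.1.2.2.2 a.1.1) : ℝ) : ℂ) else 0

variable (e : Q ≃ S × T) (w : S → T → (Fin n → M) → ℝ) (κ : S → (Fin n → M) → M → ℝ)

open Classical in
theorem messageState_apply (c : M) (q : Q) (t : T) (h : Fin n → M) (s : S)
    (h' : Fin (n + 1) → M) :
    messageState e w κ ((c, q, (t, h)), (s, h'))
      = if e q = (s, t) ∧ h' = Fin.snoc h c then ((√(w s t h * κ s h c) : ℝ) : ℂ) else 0 := rfl

open Classical in
theorem messageState_snoc (c : M) (s₀ s : S) (t₀ t : T) (h h' : Fin n → M) (c' : M) :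
    messageState e w κ ((c, e.symm (s₀, t₀), (t, h)), (s, Fin.snoc h' c'))
      = if s₀ = s then if t₀ = t then if h' = h then if c' = c then
          ((√(w s t h * κ s h c) : ℝ) : ℂ) else 0 else 0 else 0 else 0 := by
  simp only [messageState, Equiv.apply_symm_apply, Prod.mk.injEq, Fin.snoc_inj, ite_and]

theorem ofReal_sqrt_mul_self {a : ℝ} (ha : 0 ≤ a) : ((√a : ℝ) : ℂ) * ((√a : ℝ) : ℂ) = a := by
  rw [← Complex.ofReal_mul, Real.mul_self_sqrt ha]

theorem star_ofReal (a : ℝ) : star (a : ℂ) = a := Complex.conj_ofReal a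

variable {w κ} [Fintype S] [Fintype T] [Fintype M] [Fintype Q]

open Classical in
theorem messageState_marginal_PZ (hw : ∀ s t h, 0 ≤ w s t h) (hκ : ∀ s h c, 0 ≤ κ s h c) :
    (Matrix.of fun i j : M × (T × (Fin n → M)) =>
      ∑ q, reducedState (messageState e w κ) (i.1, q, i.2) (j.1, q, j.2))
      = Matrix.diagonal fun a : M × (T × (Fin n → M)) =>
        ((∑ s, w s a.2.1 a.2.2 * κ s a.2.2 a.1 : ℝ) : ℂ) := by
  ext ⟨c, t, h⟩ ⟨c', t', h'⟩
  rw [Matrix.of_apply, ← e.symm.sum_comp]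
  simp only [reducedState, Matrix.of_apply, Fintype.sum_prod_type, sum_snoc, messageState_snoc]
  simp only [apply_ite (star : ℂ → ℂ), Finset.sum_ite_irrel, Matrix.diagonal_apply,
    star_ofReal, star_zero, mul_ite, mul_zero, ite_mul, zero_mul,
    Finset.sum_ite_eq, Finset.sum_ite_eq', Finset.sum_const_zero, Finset.mem_univ, if_true,
    Complex.ofReal_sum, Prod.mk.injEq]
  by_cases H : c = c' ∧ t = t' ∧ h = h'
  · obtain ⟨rfl, rfl, rfl⟩ := H
    simp [ofReal_sqrt_mul_self (mul_nonneg (hw _ _ _) (hκ _ _ _))]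
  · rw [if_neg H]
    split_ifs with h1 h2 h3
    · exact absurd ⟨h3.symm, h1.symm, h2.symm⟩ H
    all_goals rfl

open Classical in
theorem messageState_marginal_Z (hw : ∀ s t h, 0 ≤ w s t h) (hκ : ∀ s h c, 0 ≤ κ s h c)
    (hκ1 : ∀ s h, ∑ c, κ s h c = 1) :
    (Matrix.of fun i j : T × (Fin n → M) =>
      ∑ c, ∑ q, reducedState (messageState e w κ) (c, q, i) (c, q, j))
      = Matrix.diagonal fun a : T × (Fin n → M) => ((∑ s, w s a.1 a.2 : ℝ) : ℂ) := by
  have h1 := messageState_marginal_PZ e hw hκ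
  ext a b
  have h2 : ∀ c, ∑ q, reducedState (messageState e w κ) (c, q, a) (c, q, b)
      = if a = b then ((∑ s, w s a.1 a.2 * κ s a.2 c : ℝ) : ℂ) else 0 := fun c => by
    have := congrFun (congrFun h1 (c, a)) (c, b)
    simpa [Matrix.diagonal_apply] using this
  simp only [Matrix.of_apply, h2, Matrix.diagonal_apply, Finset.sum_ite_irrel,
    Finset.sum_const_zero]
  congr 1
  rw [← Complex.ofReal_sum, Finset.sum_comm]
  simp only [← Finset.mul_sum, hκ1, mul_one]

open Classical in
theorem messageState_marginal_QZ (hw : ∀ s t h, 0 ≤ w s t h) (hκ : ∀ s h c, 0 ≤ κ s h c)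
    (hκ1 : ∀ s h, ∑ c, κ s h c = 1) :
    vonNeumannEntropy (Matrix.of fun i j : Q × (T × (Fin n → M)) =>
      ∑ c, reducedState (messageState e w κ) (c, i.1, i.2) (c, j.1, j.2))
      = shannonEntropy fun a : S × (Fin n → M) => ∑ t, w a.1 t a.2 := by
  -- The message is a function of the sender's registers, so that conditionally on `s` and `h`
  -- the marginal is a pure state.
  let G : Matrix (Q × (T × (Fin n → M))) (S × (Fin n → M)) ℂ := Matrix.of fun a b =>
    if (e a.1).1 = b.1 then if (e a.1).2 = a.2.1 then if b.2 = a.2.2 then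
      ((√(w b.1 a.2.1 a.2.2) : ℝ) : ℂ) else 0 else 0 else 0
  have hG : (Matrix.of fun i j : Q × (T × (Fin n → M)) =>
      ∑ c, reducedState (messageState e w κ) (c, i.1, i.2) (c, j.1, j.2))
      = G * G.conjTranspose := by
    ext ⟨q, t, h⟩ ⟨q', t', h'⟩
    obtain ⟨⟨s₀, t₀⟩, rfl⟩ := e.symm.surjective q
    obtain ⟨⟨s₁, t₁⟩, rfl⟩ := e.symm.surjective q'
    simp only [reducedState, Matrix.of_apply, Fintype.sum_prod_type, sum_snoc, messageState_snoc,
      Matrix.mul_apply, Matrix.conjTranspose_apply, G, Equiv.apply_symm_apply]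
    simp only [apply_ite (star : ℂ → ℂ), Finset.sum_ite_irrel,
      star_ofReal, star_zero, mul_ite, mul_zero, ite_mul, zero_mul,
      Finset.sum_ite_eq, Finset.sum_ite_eq', Finset.sum_const_zero, Finset.mem_univ, if_true]
    split_ifs <;> try rfl
    have (c : M) (a b : ℝ) (ha : 0 ≤ a) (hb : 0 ≤ b) :
        ((√(a * κ s₁ h' c) : ℝ) : ℂ) * ((√(b * κ s₁ h' c) : ℝ) : ℂ)
          = ((√a * √b * κ s₁ h' c : ℝ) : ℂ) := by
      rw [← Complex.ofReal_mul, Real.sqrt_mul ha, Real.sqrt_mul hb, mul_mul_mul_comm,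
        Real.mul_self_sqrt (hκ _ _ _)]
    subst_vars
    simp only [this _ _ _ (hw _ _ _) (hw _ _ _)]
    rw [← Complex.ofReal_sum, ← Finset.mul_sum, hκ1, mul_one, Complex.ofReal_mul]
  rw [hG]
  refine vonNeumannEntropy_mul_conjTranspose G _ ?_
  ext ⟨s, h⟩ ⟨s', h'⟩
  simp only [Matrix.mul_apply, Matrix.conjTranspose_apply, G, Fintype.sum_prod_type]
  rw [← e.symm.sum_comp]
  simp only [Fintype.sum_prod_type, Equiv.apply_symm_apply, Matrix.of_apply]
  simp only [apply_ite (star : ℂ → ℂ), Finset.sum_ite_irrel, Matrix.diagonal_apply,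
    star_ofReal, star_zero, mul_ite, mul_zero, ite_mul, zero_mul,
    Finset.sum_ite_eq, Finset.sum_ite_eq', Finset.sum_const_zero, Finset.mem_univ, if_true,
    Complex.ofReal_sum, Prod.mk.injEq]
  by_cases H : s = s' ∧ h = h'
  · obtain ⟨rfl, rfl⟩ := H
    simp [ofReal_sqrt_mul_self (hw _ _ _)]
  · rw [if_neg H]
    split_ifs with h1 h2
    · exact absurd ⟨h1.symm, h2⟩ H
    all_goals rfl

open Classical in
theorem vonNeumannEntropy_messageState (hw : ∀ s t h, 0 ≤ w s t h) (hκ : ∀ s h c, 0 ≤ κ s h c) :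
    vonNeumannEntropy (reducedState (messageState e w κ))
      = shannonEntropy fun a : S × (Fin (n + 1) → M) =>
        (∑ t, w a.1 t (Fin.init a.2)) * κ a.1 (Fin.init a.2) (a.2 (Fin.last n)) := by
  have hG : reducedState (messageState e w κ)
      = Matrix.of (fun a b => messageState e w κ (a, b)) *
        (Matrix.of (fun a b => messageState e w κ (a, b))).conjTranspose := by
    ext a b
    simp [reducedState, Matrix.mul_apply]
  rw [hG]
  refine vonNeumannEntropy_mul_conjTranspose _ _ ?_
  ext ⟨s, h⟩ ⟨s', h'⟩
  induction h using Fin.snocCases with | snoc h c =>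
  induction h' using Fin.snocCases with | snoc h' c' =>
  simp only [Matrix.mul_apply, Matrix.conjTranspose_apply, Fintype.sum_prod_type]
  rw [Finset.sum_congr rfl fun _ _ => (e.symm.sum_comp _).symm]
  simp only [Fintype.sum_prod_type, Matrix.of_apply, messageState_snoc]
  simp only [apply_ite (star : ℂ → ℂ), Finset.sum_ite_irrel, Matrix.diagonal_apply,
    star_ofReal, star_zero, mul_ite, mul_zero, ite_mul, zero_mul,
    Finset.sum_ite_eq, Finset.sum_ite_eq', Finset.sum_const_zero, Finset.mem_univ, if_true,
    Prod.mk.injEq]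
  by_cases H : s = s' ∧ h = h' ∧ c = c'
  · obtain ⟨rfl, rfl, rfl⟩ := H
    simp [ofReal_sqrt_mul_self (mul_nonneg (hw _ _ _) (hκ _ _ _)), Finset.sum_mul]
  · have H' : ¬(s = s' ∧ (Fin.snoc h c : Fin (n + 1) → M) = Fin.snoc h' c') := by
      rwa [Fin.snoc_inj]
    rw [if_neg H']
    split_ifs with h1 h2 h3
    · exact absurd ⟨h1.symm, h2, h3⟩ H
    all_goals rfl

/-- The quantum conditional mutual information of a coherently sent classical message, in terms of
the entropies of the classical marginals. -/
theorem quantumCondMutInf_messageState (hw : ∀ s t h, 0 ≤ w s t h)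
    (hκ : ∀ s h c, 0 ≤ κ s h c) (hκ1 : ∀ s h, ∑ c, κ s h c = 1) :
    quantumCondMutInf (reducedState (messageState e w κ))
      = ∑ t, ∑ h, ∑ c, entropyTerm (∑ s, w s t h * κ s h c)
        + ∑ s, ∑ h, entropyTerm (∑ t, w s t h)
        - ∑ s, ∑ h, ∑ c, entropyTerm ((∑ t, w s t h) * κ s h c)
        - ∑ t, ∑ h, entropyTerm (∑ s, w s t h) := by
  classical
  unfold quantumCondMutInf
  rw [messageState_marginal_PZ e hw hκ, messageState_marginal_Z e hw hκ hκ1,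
    messageState_marginal_QZ e hw hκ hκ1, vonNeumannEntropy_messageState e hw hκ,
    vonNeumannEntropy_diagonal _ fun _ => Finset.sum_nonneg fun _ _ => mul_nonneg (hw _ _ _)
      (hκ _ _ _), vonNeumannEntropy_diagonal _ fun _ => Finset.sum_nonneg fun _ _ => hw _ _ _]
  simp only [shannonEntropy_eq, Fintype.sum_prod_type, sum_snoc, Fin.init_snoc, Fin.snoc_last]
  congr 3
  rw [Finset.sum_comm]
  exact Finset.sum_congr rfl fun t _ => Finset.sum_comm

end Message

/-! ### Protocols without public coins and their coherent simulation -/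

/-- A classical protocol without public coins, with `2 * turns` messages over the alphabet `M` and
deterministic outputs. As in `ClassicalProtocol`, Alice sends the messages with even number. -/
structure MessageScheme (X Y O M : Type) [Fintype M] where
  turns : ℕ
  alice : X → (i : ℕ) → (Fin i → M) → stdSimplex ℝ M
  bob : Y → (i : ℕ) → (Fin i → M) → stdSimplex ℝ M
  outA : X → (Fin (2 * turns) → M) → O
  outB : Y → (Fin (2 * turns) → M) → O

theorem stdSimplex_nonneg {α : Type} [Fintype α] (p : stdSimplex ℝ α) (a : α) : 0 ≤ p a :=
  p.2.1 a

theorem stdSimplex_sum {α : Type} [Fintype α] (p : stdSimplex ℝ α) : ∑ a, p a = 1 := p.2.2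

namespace MessageScheme

variable {X Y O M : Type} [Fintype M] (P : MessageScheme X Y O M)

open Classical in
/-- The scheme as a classical protocol whose public coins are constant. -/
noncomputable def toClassical [Fintype O] : ClassicalProtocol X Y O where
  rounds := 2 * P.turns
  R := Unit
  M := M
  coins := ⟨fun _ => 1, by simp, by simp⟩
  alice x _ := P.alice x
  bob y _ := P.bob y
  outA x _ h := ⟨Pi.single (P.outA x h) 1, single_mem_stdSimplex ℝ _⟩
  outB y _ h := ⟨Pi.single (P.outB y h) 1, single_mem_stdSimplex ℝ _⟩

/-- The distribution of message number `i`, given the inputs and the messages before it. -/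
noncomputable def kernel (x : X) (y : Y) (i : ℕ) (h : Fin i → M) (m : M) : ℝ :=
  if Even i then P.alice x i h m else P.bob y i h m

theorem kernel_nonneg (x : X) (y : Y) (i : ℕ) (h : Fin i → M) (m : M) :
    0 ≤ P.kernel x y i h m := by
  unfold kernel
  split_ifs
  exacts [stdSimplex_nonneg _ _, stdSimplex_nonneg _ _]

theorem sum_kernel (x : X) (y : Y) (i : ℕ) (h : Fin i → M) : ∑ m, P.kernel x y i h m = 1 := by
  unfold kernel
  split_ifs
  exacts [stdSimplex_sum _, stdSimplex_sum _]

/-- Probability that the first `i` messages are `h`, given the inputs. -/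
noncomputable def prob (x : X) (y : Y) (i : ℕ) (h : Fin i → M) : ℝ := seqProb (P.kernel x y) i h

theorem prob_nonneg (x : X) (y : Y) (i : ℕ) (h : Fin i → M) : 0 ≤ P.prob x y i h :=
  seqProb_nonneg (P.kernel_nonneg x y) i h

theorem sum_prob (x : X) (y : Y) (i : ℕ) : ∑ h, P.prob x y i h = 1 :=
  sum_seqProb (P.sum_kernel x y) i

theorem prob_snoc (x : X) (y : Y) (i : ℕ) (h : Fin i → M) (m : M) :
    P.prob x y (i + 1) (Fin.snoc h m : Fin (i + 1) → M) = P.prob x y i h * P.kernel x y i h m :=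
  seqProb_snoc _ i h m

theorem kernel_even (x : X) (y : Y) (s : ℕ) (h : Fin (2 * s) → M) (m : M) :
    P.kernel x y (2 * s) h m = P.alice x (2 * s) h m := by
  simp [kernel]

theorem kernel_odd (x : X) (y : Y) (s : ℕ) (h : Fin (2 * s + 1) → M) (m : M) :
    P.kernel x y (2 * s + 1) h m = P.bob y (2 * s + 1) h m := by
  simp [kernel]

section Classical

variable [Fintype O]

theorem messagesProb_toClassical (x : X) (y : Y) (r : Unit) :
    ∀ (i : ℕ) (h : Fin i → M), P.toClassical.messagesProb x y r i h = P.prob x y i h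
  | 0, _ => rfl
  | i + 1, h => by
    have := messagesProb_toClassical x y r i (Fin.init h)
    exact congrArg (· * P.kernel x y i (Fin.init h) (h (Fin.last i))) this

theorem transcriptProb_toClassical (x : X) (y : Y) (t : Unit × (Fin (2 * P.turns) → M)) :
    P.toClassical.transcriptProb x y t = P.prob x y (2 * P.turns) t.2 := by
  have h1 : P.toClassical.coins t.1 = 1 := rfl
  unfold ClassicalProtocol.transcriptProb
  rw [h1, one_mul]
  exact P.messagesProb_toClassical x y t.1 _ t.2

open Classical in
theorem outputProb_toClassical (x : X) (y : Y) (a b : O) :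
    P.toClassical.outputProb x y a b
      = ∑ h : Fin (2 * P.turns) → M,
        if a = P.outA x h ∧ b = P.outB y h then P.prob x y (2 * P.turns) h else 0 := by
  have h1 : ∀ t : Unit × (Fin (2 * P.turns) → M),
      P.toClassical.transcriptProb x y t *
        (P.toClassical.outA x t.1 t.2 a * P.toClassical.outB y t.1 t.2 b)
      = if a = P.outA x t.2 ∧ b = P.outB y t.2 then P.prob x y (2 * P.turns) t.2 else 0 := by
    intro t
    rw [transcriptProb_toClassical]
    have hA : P.toClassical.outA x t.1 t.2 a = (Pi.single (P.outA x t.2) 1 : O → ℝ) a := rfl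
    have hB : P.toClassical.outB y t.1 t.2 b = (Pi.single (P.outB y t.2) 1 : O → ℝ) b := rfl
    rw [hA, hB, Pi.single_apply, Pi.single_apply]
    split_ifs <;> simp_all
  unfold ClassicalProtocol.outputProb
  refine (Finset.sum_congr rfl fun t _ => h1 t).trans ?_
  exact (Fintype.sum_prod_type _).trans (Fintype.sum_unique (ι := Unit) _)

open Classical in
/-- The error is the probability of the transcripts on which one of the outputs is wrong. -/
theorem errorProb_toClassical [Fintype X] [Fintype Y] (mu : X × Y → ℝ) (v : X → Y → O) :
    P.toClassical.errorProb mu v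
      = ∑ x, ∑ y, mu (x, y) * ∑ h : Fin (2 * P.turns) → M,
        if P.outA x h = v x y ∧ P.outB y h = v x y then 0 else P.prob x y (2 * P.turns) h := by
  unfold ClassicalProtocol.errorProb
  refine Finset.sum_congr rfl fun x _ => Finset.sum_congr rfl fun y _ => ?_
  simp only [outputProb_toClassical, Finset.mul_sum]
  have h1 : ∀ (a b : O), (if a = v x y ∧ b = v x y then (0 : ℝ) else
      ∑ h : Fin (2 * P.turns) → M, mu (x, y) *
        if a = P.outA x h ∧ b = P.outB y h then P.prob x y (2 * P.turns) h else 0)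
      = ∑ h : Fin (2 * P.turns) → M, if a = P.outA x h then if b = P.outB y h then
          if a = v x y ∧ b = v x y then 0 else mu (x, y) * P.prob x y (2 * P.turns) h
          else 0 else 0 := by
    intro a b
    split_ifs with h
    · simp
    · refine Finset.sum_congr rfl fun t _ => ?_
      split_ifs <;> simp_all
  simp only [h1]
  rw [Finset.sum_congr rfl fun a _ => Finset.sum_comm, Finset.sum_comm]
  refine Finset.sum_congr rfl fun h _ => ?_
  simp only [Finset.sum_ite_irrel, Finset.sum_ite_eq', Finset.mem_univ, if_true,
    Finset.sum_const_zero, mul_ite, mul_zero]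

variable [Fintype X] [Fintype Y] (mu : X × Y → ℝ)

/-- Entropy of Bob's input and the first `i` messages. -/
noncomputable def entY (i : ℕ) : ℝ :=
  ∑ y, ∑ h : Fin i → M, entropyTerm (∑ x, mu (x, y) * P.prob x y i h)

/-- Entropy of Alice's input and the first `i` messages. -/
noncomputable def entX (i : ℕ) : ℝ :=
  ∑ x, ∑ h : Fin i → M, entropyTerm (∑ y, mu (x, y) * P.prob x y i h)

/-- Entropy of both inputs and the first `i` messages. -/
noncomputable def entXY (i : ℕ) : ℝ :=
  ∑ x, ∑ y, ∑ h : Fin i → M, entropyTerm (mu (x, y) * P.prob x y i h)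

theorem IC_toClassical :
    P.toClassical.IC mu
      = (P.entY mu (2 * P.turns) - P.entY mu 0) + (P.entX mu (2 * P.turns) - P.entX mu 0)
        - 2 * (P.entXY mu (2 * P.turns) - P.entXY mu 0) := by
  have key1 : condMutInf (fun i : X × (Unit × (Fin (2 * P.turns) → M)) × Y =>
      mu (i.1, i.2.2) * P.prob i.1 i.2.2 (2 * P.turns) i.2.1.2)
      = P.entXY mu 0 + P.entY mu (2 * P.turns) - P.entXY mu (2 * P.turns) - P.entY mu 0 := by
    unfold condMutInf entXY entY
    simp only [shannonEntropy_eq, Fintype.sum_prod_type, ← Finset.mul_sum, sum_prob,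
      Finset.univ_unique, Finset.sum_singleton]
    simp only [prob, seqProb, mul_one]
    congr 2
    · congr 1
      exact Finset.sum_comm
    · exact Finset.sum_congr rfl fun x _ => Finset.sum_comm
  have key2 : condMutInf (fun i : Y × (Unit × (Fin (2 * P.turns) → M)) × X =>
      mu (i.2.2, i.1) * P.prob i.2.2 i.1 (2 * P.turns) i.2.1.2)
      = P.entXY mu 0 + P.entX mu (2 * P.turns) - P.entXY mu (2 * P.turns) - P.entX mu 0 := by
    unfold condMutInf entXY entX
    simp only [shannonEntropy_eq, Fintype.sum_prod_type, ← Finset.mul_sum, sum_prob,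
      Finset.univ_unique, Finset.sum_singleton]
    simp only [prob, seqProb, mul_one]
    congr 2
    · congr 1
      · exact Finset.sum_comm
      · exact Finset.sum_comm
    · rw [Finset.sum_congr rfl fun y _ => Finset.sum_comm, Finset.sum_comm]
  have h1 : P.toClassical.IC mu
      = condMutInf (fun i : X × (Unit × (Fin (2 * P.turns) → M)) × Y =>
          mu (i.1, i.2.2) * P.prob i.1 i.2.2 (2 * P.turns) i.2.1.2)
        + condMutInf (fun i : Y × (Unit × (Fin (2 * P.turns) → M)) × X =>
          mu (i.2.2, i.1) * P.prob i.2.2 i.1 (2 * P.turns) i.2.1.2) := by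
    have e1 : ∀ x y t, P.toClassical.transcriptProb x y t = P.prob x y (2 * P.turns) t.2 :=
      P.transcriptProb_toClassical
    unfold ClassicalProtocol.IC
    simp only [e1]
    rfl
  rw [h1, key1, key2]
  ring

omit [Fintype O] in
/-- When Alice speaks, the message is independent of Bob's input given hers and the history. -/
theorem entXY_sub_entX_even (s : ℕ) :
    P.entXY mu (2 * s + 1) - P.entXY mu (2 * s) = P.entX mu (2 * s + 1) - P.entX mu (2 * s) := by
  unfold entXY entX
  simp only [sum_snoc, prob_snoc, kernel_even, ← mul_assoc]
  have h1 := fun x y => sum_entropyTerm_mul (fun h => mu (x, y) * P.prob x y (2 * s) h)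
    (fun h c => P.alice x (2 * s) h c) fun h => stdSimplex_sum _
  have h2 := fun x => sum_entropyTerm_mul (fun h => ∑ y, mu (x, y) * P.prob x y (2 * s) h)
    (fun h c => P.alice x (2 * s) h c) fun h => stdSimplex_sum _
  simp only [← Finset.sum_mul, h1, h2, Finset.sum_add_distrib]
  simp only [Finset.sum_mul]
  rw [add_sub_cancel_left, add_sub_cancel_left]
  exact Finset.sum_congr rfl fun x _ => Finset.sum_comm

omit [Fintype O] in
/-- When Bob speaks, the message is independent of Alice's input given his and the history. -/
theorem entXY_sub_entY_odd (s : ℕ) :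
    P.entXY mu (2 * s + 2) - P.entXY mu (2 * s + 1)
      = P.entY mu (2 * s + 2) - P.entY mu (2 * s + 1) := by
  unfold entXY entY
  simp only [sum_snoc (i := 2 * s + 1), prob_snoc _ _ _ (2 * s + 1), kernel_odd, ← mul_assoc]
  have h1 := fun x y => sum_entropyTerm_mul (fun h => mu (x, y) * P.prob x y (2 * s + 1) h)
    (fun h c => P.bob y (2 * s + 1) h c) fun h => stdSimplex_sum _
  have h2 := fun y => sum_entropyTerm_mul (fun h => ∑ x, mu (x, y) * P.prob x y (2 * s + 1) h)
    (fun h c => P.bob y (2 * s + 1) h c) fun h => stdSimplex_sum _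
  simp only [← Finset.sum_mul, h1, h2, Finset.sum_add_distrib]
  simp only [Finset.sum_mul]
  rw [add_sub_cancel_left, add_sub_cancel_left, Finset.sum_comm]
  exact Finset.sum_congr rfl fun x _ => Finset.sum_comm

end Classical

/-! ### The coherent simulation -/

section Quantum

/-- Alice's memory: the messages up to her own last one. -/
def AliceReg (M : Type) : ℕ → Type
  | 0 => Unit
  | s + 1 => Fin (2 * s + 1) → M

/-- Bob's message in transit; there is none at the beginning. -/
def BobMsg (M : Type) : ℕ → Type
  | 0 => Unit
  | _ + 1 => M

instance : ∀ s, Fintype (AliceReg M s)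
  | 0 => inferInstanceAs (Fintype Unit)
  | s + 1 => inferInstanceAs (Fintype (Fin (2 * s + 1) → M))

instance : ∀ s, Fintype (BobMsg M s)
  | 0 => inferInstanceAs (Fintype Unit)
  | _ + 1 => inferInstanceAs (Fintype M)

/-- The messages up to Bob's last one, from Alice's memory and that message. -/
def history : (s : ℕ) → AliceReg M s × BobMsg M s ≃ (Fin (2 * s) → M)
  | 0 => ⟨fun _ => Fin.elim0, fun _ => ((), ()), fun _ => rfl, fun _ => funext fun i => Fin.elim0 i⟩
  | s + 1 => (Equiv.prodComm (Fin (2 * s + 1) → M) M).trans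
      (Fin.snocEquiv (n := 2 * s + 1) fun _ => M)

omit [Fintype M] in
theorem history_succ (s : ℕ) (a : Fin (2 * s + 1) → M) (c : M) :
    history (M := M) (s + 1) (a, c) = (Fin.snoc a c : Fin (2 * s + 2) → M) := rfl

open Classical in
/-- The isometry `|h⟩ ↦ ∑ c, √(κ h c) |h c⟩ |c⟩` by which a player draws a message coherently and
keeps a copy; `f` reads off the history `h` from the player's registers. -/
noncomputable def drawMessage {I : Type} {n : ℕ} (f : I ≃ (Fin n → M))
    (κ : (Fin n → M) → stdSimplex ℝ M) : Matrix ((Fin (n + 1) → M) × M) I ℂ :=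
  Matrix.of fun j i => if j.1 = Fin.snoc (f i) j.2 then ((√(κ (f i) j.2) : ℝ) : ℂ) else 0

theorem isIsometryMatrix_drawMessage {I : Type} {n : ℕ} (f : I ≃ (Fin n → M))
    (κ : (Fin n → M) → stdSimplex ℝ M) : IsIsometryMatrix (drawMessage f κ) := by
  classical
  intro i i'
  simp only [drawMessage, Matrix.of_apply, Fintype.sum_prod_type, sum_snoc, Fin.snoc_inj, ite_and,
    apply_ite (star : ℂ → ℂ), star_zero, star_ofReal, ite_mul, mul_ite, zero_mul, mul_zero,
    Finset.sum_ite_irrel, Finset.sum_ite_eq, Finset.sum_ite_eq', Finset.mem_univ, if_true,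
    Finset.sum_const_zero]
  rcases eq_or_ne i i' with rfl | hne
  · simp only [if_true, ofReal_sqrt_mul_self (stdSimplex_nonneg _ _)]
    rw [← Complex.ofReal_sum, stdSimplex_sum, Complex.ofReal_one]
  · rw [if_neg hne, if_neg fun H => hne (f.injective H).symm]

open Classical in
/-- The isometry `|h⟩ ↦ |out h⟩ |h⟩` which writes the output. -/
noncomputable def writeOutput {I : Type} {n : ℕ} (f : I ≃ (Fin n → M)) (out : (Fin n → M) → O) :
    Matrix (O × (Fin n → M)) I ℂ :=
  Matrix.of fun j i => if j.2 = f i ∧ j.1 = out (f i) then 1 else 0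

theorem isIsometryMatrix_writeOutput [Fintype O] {I : Type} {n : ℕ} (f : I ≃ (Fin n → M))
    (out : (Fin n → M) → O) : IsIsometryMatrix (writeOutput f out) := by
  classical
  intro i i'
  simp only [writeOutput, Matrix.of_apply, Fintype.sum_prod_type, ite_and,
    apply_ite (star : ℂ → ℂ), star_zero, star_one, mul_ite, mul_zero, mul_one,
    Finset.sum_ite_eq', Finset.mem_univ, if_true]
  rcases eq_or_ne i i' with rfl | hne
  · simp
  · simp [hne, hne.symm]

variable [Fintype O]

/-- The coherent simulation of the scheme: each message is sent in superposition with its classical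
amplitudes, and the sender keeps a copy. -/
noncomputable def toQuantum : QuantumProtocol X Y O where
  turns := P.turns
  A := AliceReg M
  B s := Fin (2 * s) → M
  CA _ := M
  CB := BobMsg M
  Af := Fin (2 * P.turns) → M
  Bf := Fin (2 * P.turns) → M
  fintypeB s := inferInstance
  fintypeAf := inferInstance
  fintypeBf := inferInstance
  shared _ _ _ := 1
  shared_unit := by
    show ∑ a : Unit, ∑ b : Fin 0 → M, ∑ c : Unit, ‖(1 : ℂ)‖ ^ 2 = 1
    simp
  U s x := drawMessage (history s) (P.alice x (2 * s))
  V s y := drawMessage (n := 2 * s + 1)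
    ((Equiv.prodComm (Fin (2 * s) → M) M).trans (Fin.snocEquiv (n := 2 * s) fun _ => M))
    (P.bob y (2 * s + 1))
  Uf x := writeOutput (history P.turns) (P.outA x)
  Vf y := writeOutput (Equiv.refl _) (P.outB y)
  isometry_U s x := isIsometryMatrix_drawMessage _ _
  isometry_V s y := isIsometryMatrix_drawMessage _ _
  isometry_Uf x := isIsometryMatrix_writeOutput _ _
  isometry_Vf y := isIsometryMatrix_writeOutput _ _

end Quantum

end MessageScheme

namespace MessageScheme

variable {X Y O M : Type} [Fintype M] [Fintype X] [Fintype Y] [Fintype O]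
  (P : MessageScheme X Y O M) (mu : X × Y → ℝ)

omit [Fintype X] [Fintype Y] in
theorem inputState_eq (rx : X) (ry : Y) (x : X) (y : Y) :
    QuantumProtocol.inputState mu rx ry x y
      = (open Classical in if rx = x ∧ ry = y then ((√(mu (x, y)) : ℝ) : ℂ) else 0) := by
  unfold QuantumProtocol.inputState
  rfl

omit [Fintype X] [Fintype Y] in
open Classical in
theorem applyAlice_toQuantum (s : ℕ)
    (psi : X → Y → X → Y → AliceReg M s → (Fin (2 * s) → M) → BobMsg M s → ℂ)
    (hpsi : ∀ rx ry x y a b c, psi rx ry x y a b c = if rx = x ∧ ry = y ∧ b = history s (a, c) then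
        ((√(mu (x, y) * P.prob x y (2 * s) b) : ℝ) : ℂ) else 0)
    (rx : X) (ry : Y) (x : X) (y : Y) (a : Fin (2 * s + 1) → M) (b : Fin (2 * s) → M) (c : M) :
    P.toQuantum.applyAlice s psi rx ry x y a b c
      = if rx = x ∧ ry = y ∧ a = Fin.snoc b c then
        ((√(mu (x, y) * P.prob x y (2 * s + 1) a) : ℝ) : ℂ) else 0 := by
  have h1 : P.toQuantum.applyAlice s psi rx ry x y a b c
      = ∑ i : AliceReg M s × BobMsg M s,
        drawMessage (history s) (P.alice x (2 * s)) (a, c) i * psi rx ry x y i.1 b i.2 :=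
    (Fintype.sum_prod_type fun i : AliceReg M s × BobMsg M s =>
      drawMessage (history s) (P.alice x (2 * s)) (a, c) i * psi rx ry x y i.1 b i.2).symm
  rw [h1, ← (history s).symm.sum_comp]
  simp only [hpsi, drawMessage, Matrix.of_apply, Equiv.apply_symm_apply, Prod.mk.eta]
  rw [Finset.sum_eq_single b (fun h _ hb => mul_eq_zero_of_right _ (if_neg fun H => hb H.2.2.symm))
    (fun h => absurd (Finset.mem_univ _) h)]
  by_cases H : rx = x ∧ ry = y ∧ a = Fin.snoc b c
  · obtain ⟨rfl, rfl, rfl⟩ := H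
    simp only [and_self, if_true, prob_snoc, kernel_even]
    rw [← Complex.ofReal_mul, ← Real.sqrt_mul (stdSimplex_nonneg _ _)]
    congr 2
    ring
  · rw [if_neg H]
    split_ifs <;> simp_all

omit [Fintype X] [Fintype Y] in
open Classical in
theorem applyBob_toQuantum (s : ℕ)
    (psi : X → Y → X → Y → (Fin (2 * s + 1) → M) → (Fin (2 * s) → M) → M → ℂ)
    (hpsi : ∀ rx ry x y a b c, psi rx ry x y a b c = if rx = x ∧ ry = y ∧ a = Fin.snoc b c then
        ((√(mu (x, y) * P.prob x y (2 * s + 1) a) : ℝ) : ℂ) else 0)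
    (rx : X) (ry : Y) (x : X) (y : Y) (a : Fin (2 * s + 1) → M) (b : Fin (2 * s + 2) → M) (c : M) :
    P.toQuantum.applyBob s psi rx ry x y a b c
      = if rx = x ∧ ry = y ∧ b = Fin.snoc a c then
        ((√(mu (x, y) * P.prob x y (2 * s + 2) b) : ℝ) : ℂ) else 0 := by
  have h1 : P.toQuantum.applyBob s psi rx ry x y a b c
      = ∑ i : (Fin (2 * s) → M) × M,
        drawMessage (n := 2 * s + 1)
          ((Equiv.prodComm (Fin (2 * s) → M) M).trans (Fin.snocEquiv (n := 2 * s) fun _ => M))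
          (P.bob y (2 * s + 1)) (b, c) i * psi rx ry x y a i.1 i.2 :=
    (Fintype.sum_prod_type fun i : (Fin (2 * s) → M) × M =>
      drawMessage (n := 2 * s + 1)
          ((Equiv.prodComm (Fin (2 * s) → M) M).trans (Fin.snocEquiv (n := 2 * s) fun _ => M))
          (P.bob y (2 * s + 1)) (b, c) i * psi rx ry x y a i.1 i.2).symm
  have h2 : ∀ h : Fin (2 * s + 1) → M, (Fin.snoc (Fin.init h) (h (Fin.last _)) : Fin (2 * s + 1) → M)
      = h := Fin.snoc_init_self
  rw [h1, ← ((Equiv.prodComm (Fin (2 * s) → M) M).trans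
    (Fin.snocEquiv (n := 2 * s) fun _ => M)).symm.sum_comp]
  simp only [hpsi, drawMessage, Matrix.of_apply, Equiv.apply_symm_apply]
  have h3 : ∀ h : Fin (2 * s + 1) → M, (Fin.snoc
      (((Equiv.prodComm (Fin (2 * s) → M) M).trans
        (Fin.snocEquiv (n := 2 * s) fun _ => M)).symm h).1
      (((Equiv.prodComm (Fin (2 * s) → M) M).trans
        (Fin.snocEquiv (n := 2 * s) fun _ => M)).symm h).2 : Fin (2 * s + 1) → M) = h := h2
  simp only [h3]
  rw [Finset.sum_eq_single a (fun h _ hb => mul_eq_zero_of_right _ (if_neg fun H => hb H.2.2.symm))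
    (fun h => absurd (Finset.mem_univ _) h)]
  by_cases H : rx = x ∧ ry = y ∧ b = Fin.snoc a c
  · obtain ⟨rfl, rfl, rfl⟩ := H
    simp only [and_self, if_true, prob_snoc, kernel_odd]
    rw [← Complex.ofReal_mul, ← Real.sqrt_mul (stdSimplex_nonneg _ _)]
    congr 2
    ring
  · rw [if_neg H]
    split_ifs <;> simp_all

omit [Fintype X] [Fintype Y] in
open Classical in
theorem stateEven_toQuantum : ∀ (s : ℕ) (rx : X) (ry : Y) (x : X) (y : Y)
    (a : AliceReg M s) (b : Fin (2 * s) → M) (c : BobMsg M s),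
    P.toQuantum.stateEven mu s rx ry x y a b c
      = if rx = x ∧ ry = y ∧ b = history s (a, c) then
        ((√(mu (x, y) * P.prob x y (2 * s) b) : ℝ) : ℂ) else 0
  | 0, rx, ry, x, y, a, b, c => by
    have hb : b = history 0 (a, c) := funext fun i => Fin.elim0 i
    have h1 : P.toQuantum.stateEven mu 0 rx ry x y a b c
      = QuantumProtocol.inputState mu rx ry x y * 1 := rfl
    have h2 : P.prob x y (2 * 0) b = 1 := rfl
    rw [h1, inputState_eq, h2, mul_one, mul_one]
    simp only [hb, and_true]
  | s + 1, rx, ry, x, y, a, b, c =>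
    P.applyBob_toQuantum mu s _
      (P.applyAlice_toQuantum mu s _ (stateEven_toQuantum s)) rx ry x y a b c

omit [Fintype X] [Fintype Y] in
open Classical in
theorem stateOdd_toQuantum (s : ℕ) (rx : X) (ry : Y) (x : X) (y : Y)
    (a : Fin (2 * s + 1) → M) (b : Fin (2 * s) → M) (c : M) :
    P.toQuantum.stateOdd mu s rx ry x y a b c
      = if rx = x ∧ ry = y ∧ a = Fin.snoc b c then
        ((√(mu (x, y) * P.prob x y (2 * s + 1) a) : ℝ) : ℂ) else 0 :=
  P.applyAlice_toQuantum mu s _ (P.stateEven_toQuantum mu s) rx ry x y a b c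

theorem quantumCondMutInf_alice (hmu : ∀ i, 0 ≤ mu i) (s : ℕ) :
    quantumCondMutInf (reducedState
        fun i : (M × (X × Y) × (Y × (Fin (2 * s) → M))) × (X × (Fin (2 * s + 1) → M)) =>
          P.toQuantum.stateOdd mu s i.1.2.1.1 i.1.2.1.2 i.2.1 i.1.2.2.1 i.2.2 i.1.2.2.2 i.1.1)
      = P.entY mu (2 * s + 1) + P.entX mu (2 * s) - P.entX mu (2 * s + 1) - P.entY mu (2 * s) := by
  have h1 : (fun i : (M × (X × Y) × (Y × (Fin (2 * s) → M))) × (X × (Fin (2 * s + 1) → M)) =>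
        P.toQuantum.stateOdd mu s i.1.2.1.1 i.1.2.1.2 i.2.1 i.1.2.2.1 i.2.2 i.1.2.2.2 i.1.1)
      = messageState (Equiv.refl (X × Y)) (fun x y h => mu (x, y) * P.prob x y (2 * s) h)
        (fun x h c => P.alice x (2 * s) h c) := by
    funext ⟨⟨c, ⟨rx, ry⟩, y, b⟩, x, a⟩
    refine (P.stateOdd_toQuantum mu s rx ry x y a b c).trans ?_
    rw [messageState_apply]
    by_cases H : rx = x ∧ ry = y ∧ a = Fin.snoc b c
    · rw [if_pos H, if_pos ⟨Prod.ext H.1 H.2.1, H.2.2⟩, H.2.2, prob_snoc, kernel_even, mul_assoc]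
    · rw [if_neg H, if_neg fun H' => H ⟨congrArg Prod.fst H'.1, congrArg Prod.snd H'.1, H'.2⟩]
  have h2 := quantumCondMutInf_messageState (Equiv.refl (X × Y))
    (w := fun x y h => mu (x, y) * P.prob x y (2 * s) h)
    (κ := fun x h c => P.alice x (2 * s) h c)
    (fun x y h => mul_nonneg (hmu _) (P.prob_nonneg x y _ h))
    (fun x h c => stdSimplex_nonneg _ _) (fun x h => stdSimplex_sum _)
  rw [h1, h2]
  unfold entY entX
  simp only [sum_snoc, prob_snoc, kernel_even, ← mul_assoc, ← Finset.sum_mul]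

theorem quantumCondMutInf_bob (hmu : ∀ i, 0 ≤ mu i) (s : ℕ) :
    quantumCondMutInf (reducedState
        fun i : (M × (X × Y) × (X × (Fin (2 * s + 1) → M))) × (Y × (Fin (2 * s + 2) → M)) =>
          P.toQuantum.stateEven mu (s + 1) i.1.2.1.1 i.1.2.1.2 i.1.2.2.1 i.2.1 i.1.2.2.2 i.2.2 i.1.1)
      = P.entX mu (2 * s + 2) + P.entY mu (2 * s + 1) - P.entY mu (2 * s + 2)
        - P.entX mu (2 * s + 1) := by
  have h1 : (fun i : (M × (X × Y) × (X × (Fin (2 * s + 1) → M))) × (Y × (Fin (2 * s + 2) → M)) =>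
        P.toQuantum.stateEven mu (s + 1) i.1.2.1.1 i.1.2.1.2 i.1.2.2.1 i.2.1 i.1.2.2.2 i.2.2 i.1.1)
      = messageState (Equiv.prodComm X Y) (fun y x h => mu (x, y) * P.prob x y (2 * s + 1) h)
        (fun y h c => P.bob y (2 * s + 1) h c) := by
    funext ⟨⟨c, ⟨rx, ry⟩, x, a⟩, y, b⟩
    refine (P.stateEven_toQuantum mu (s + 1) rx ry x y a b c).trans ?_
    rw [history_succ]
    rw [messageState_apply]
    by_cases H : rx = x ∧ ry = y ∧ b = Fin.snoc a c
    · refine (if_pos H).trans (Eq.trans ?_ (if_pos ⟨Prod.ext H.2.1 H.1, H.2.2⟩).symm)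
      rw [← kernel_odd P x y s a c, mul_assoc, ← prob_snoc, H.2.2]
      rfl
    · exact (if_neg H).trans
        (if_neg fun H' => H ⟨congrArg Prod.snd H'.1, congrArg Prod.fst H'.1, H'.2⟩).symm
  have h2 := quantumCondMutInf_messageState (Equiv.prodComm X Y)
    (w := fun y x h => mu (x, y) * P.prob x y (2 * s + 1) h)
    (κ := fun y h c => P.bob y (2 * s + 1) h c)
    (fun y x h => mul_nonneg (hmu _) (P.prob_nonneg x y _ h))
    (fun y h c => stdSimplex_nonneg _ _) (fun y h => stdSimplex_sum _)
  rw [h1, h2]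
  unfold entY entX
  simp only [sum_snoc (i := 2 * s + 1), prob_snoc _ _ _ (2 * s + 1), kernel_odd, ← mul_assoc,
    ← Finset.sum_mul]

/-- The coherent simulation reveals exactly as much as the classical scheme. -/
theorem QIC_toQuantum (hmu : ∀ i, 0 ≤ mu i) : P.toQuantum.QIC mu = P.toClassical.IC mu := by
  have h1 : P.toQuantum.QIC mu = ∑ s ∈ Finset.range P.turns,
      ((P.entY mu (2 * s + 1) + P.entX mu (2 * s) - P.entX mu (2 * s + 1) - P.entY mu (2 * s))
        + (P.entX mu (2 * s + 2) + P.entY mu (2 * s + 1) - P.entY mu (2 * s + 2)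
          - P.entX mu (2 * s + 1))) :=
    Finset.sum_congr rfl fun s _ =>
      congrArg₂ (· + ·) (P.quantumCondMutInf_alice mu hmu s) (P.quantumCondMutInf_bob mu hmu s)
  rw [h1, IC_toClassical]
  have h2 : ∀ N : ℕ, ∑ s ∈ Finset.range N,
      ((P.entY mu (2 * s + 1) + P.entX mu (2 * s) - P.entX mu (2 * s + 1) - P.entY mu (2 * s))
        + (P.entX mu (2 * s + 2) + P.entY mu (2 * s + 1) - P.entY mu (2 * s + 2)
          - P.entX mu (2 * s + 1)))
      = (P.entY mu (2 * N) - P.entY mu 0) + (P.entX mu (2 * N) - P.entX mu 0)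
        - 2 * (P.entXY mu (2 * N) - P.entXY mu 0) := by
    intro N
    induction N with
    | zero => simp
    | succ N ih =>
      rw [Finset.sum_range_succ, ih, mul_add 2 N 1, mul_one]
      have h3 := P.entXY_sub_entX_even mu N
      have h4 := P.entXY_sub_entY_odd mu N
      linarith
  exact h2 _

omit [Fintype X] [Fintype Y] in
open Classical in
theorem finalState_toQuantum (rx : X) (ry : Y) (o o' : O) (x : X) (y : Y)
    (a b : Fin (2 * P.turns) → M) :
    P.toQuantum.finalState mu (((rx, ry), (o, o')), (x, y, a, b))
      = if rx = x then if ry = y then if a = b then if o = P.outA x a then if o' = P.outB y b then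
        ((√(mu (x, y) * P.prob x y (2 * P.turns) b) : ℝ) : ℂ) else 0 else 0 else 0 else 0
        else 0 := by
  have h1 : P.toQuantum.finalState mu (((rx, ry), (o, o')), (x, y, a, b))
      = ∑ a' : AliceReg M P.turns, ∑ b' : Fin (2 * P.turns) → M, ∑ c' : BobMsg M P.turns,
        writeOutput (history P.turns) (P.outA x) (o, a) (a', c') *
          writeOutput (Equiv.refl _) (P.outB y) (o', b) b' *
          P.toQuantum.stateEven mu P.turns rx ry x y a' b' c' := rfl
  have h2 : ∑ a' : AliceReg M P.turns, ∑ b' : Fin (2 * P.turns) → M, ∑ c' : BobMsg M P.turns,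
        writeOutput (history P.turns) (P.outA x) (o, a) (a', c') *
          writeOutput (Equiv.refl _) (P.outB y) (o', b) b' *
          P.toQuantum.stateEven mu P.turns rx ry x y a' b' c'
      = ∑ i : AliceReg M P.turns × BobMsg M P.turns, ∑ b' : Fin (2 * P.turns) → M,
        writeOutput (history P.turns) (P.outA x) (o, a) i *
          writeOutput (Equiv.refl _) (P.outB y) (o', b) b' *
          P.toQuantum.stateEven mu P.turns rx ry x y i.1 b' i.2 := by
    rw [Fintype.sum_prod_type]
    exact Finset.sum_congr rfl fun _ _ => Finset.sum_comm
  rw [h1, h2, ← (history P.turns).symm.sum_comp]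
  have h3 := P.stateEven_toQuantum mu P.turns
  simp only [h3, writeOutput, Matrix.of_apply, Equiv.apply_symm_apply, Prod.mk.eta,
    Equiv.refl_apply]
  rw [Finset.sum_eq_single a (fun h _ ha => Finset.sum_eq_zero fun b' _ => by
      rw [if_neg fun H => ha H.1.symm, zero_mul, zero_mul])
      (fun h => absurd (Finset.mem_univ _) h),
    Finset.sum_eq_single a (fun h _ hb => mul_eq_zero_of_right _ (if_neg fun H => hb H.2.2))
      (fun h => absurd (Finset.mem_univ _) h)]
  by_cases e1 : rx = x
  · by_cases e2 : ry = y
    · by_cases e3 : a = b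
      · subst e3
        by_cases e4 : o = P.outA x a <;> by_cases e5 : o' = P.outB y a <;> simp [e1, e2, e4, e5]
      · simp [e3, Ne.symm e3]
    · simp [e2]
  · simp [e1]

open Classical in
theorem output_toQuantum (hmu : ∀ i, 0 ≤ mu i) (x x' : X) (y y' : Y) (o₁ o₁' o₂ o₂' : O) :
    P.toQuantum.output mu ((x, y), (o₁, o₂)) ((x', y'), (o₁', o₂'))
      = if x = x' ∧ y = y' ∧ o₁ = o₁' ∧ o₂ = o₂' then
        ((mu (x, y) * P.toClassical.outputProb x y o₁ o₂ : ℝ) : ℂ) else 0 := by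
  let H := Fin (2 * P.turns) → M
  let F : ((X × Y) × (O × O)) × (X × Y × H × H) → ℂ := fun i =>
    if i.1.1.1 = i.2.1 then if i.1.1.2 = i.2.2.1 then if i.2.2.2.1 = i.2.2.2.2 then
      if i.1.2.1 = P.outA i.2.1 i.2.2.2.1 then if i.1.2.2 = P.outB i.2.2.1 i.2.2.2.2 then
        ((√(mu (i.2.1, i.2.2.1) * P.prob i.2.1 i.2.2.1 (2 * P.turns) i.2.2.2.2) : ℝ) : ℂ)
      else 0 else 0 else 0 else 0 else 0
  have hF : P.toQuantum.finalState mu = F :=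
    funext fun ⟨⟨⟨rx, ry⟩, o, o'⟩, x, y, a, b⟩ =>
      P.finalState_toQuantum mu rx ry o o' x y a b
  have h1 : P.toQuantum.output mu ((x, y), (o₁, o₂)) ((x', y'), (o₁', o₂'))
      = reducedState F ((x, y), (o₁, o₂)) ((x', y'), (o₁', o₂')) :=
    congrArg (fun G : ((X × Y) × (O × O)) × (X × Y × H × H) → ℂ =>
      reducedState G ((x, y), (o₁, o₂)) ((x', y'), (o₁', o₂'))) hF
  rw [h1, outputProb_toClassical]
  simp only [reducedState, Matrix.of_apply, F, H, Fintype.sum_prod_type]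
  simp only [apply_ite (star : ℂ → ℂ), star_zero, star_ofReal, mul_ite, ite_mul, mul_zero,
    zero_mul, Finset.sum_ite_irrel, Finset.sum_ite_eq, Finset.mem_univ,
    if_true, Finset.sum_const_zero]
  by_cases K : x = x' ∧ y = y' ∧ o₁ = o₁' ∧ o₂ = o₂'
  · obtain ⟨rfl, rfl, rfl, rfl⟩ := K
    simp only [and_self, if_true, Complex.ofReal_mul, Complex.ofReal_sum, Finset.mul_sum]
    refine Finset.sum_congr rfl fun h _ => ?_
    have := ofReal_sqrt_mul_self (mul_nonneg (hmu (x, y)) (P.prob_nonneg x y _ h))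
    by_cases e4 : o₁ = P.outA x h <;> by_cases e5 : o₂ = P.outB y h <;>
      simp only [e4, e5, if_true, if_false, and_self, and_true, and_false, this,
        Complex.ofReal_mul, Complex.ofReal_zero, mul_zero]
  · rw [if_neg K]
    refine Finset.sum_eq_zero fun h _ => ?_
    split_ifs with a1 a2 a3 a4 a5 a6
    · exact absurd ⟨a3, a4, a5.trans a1.symm, a6.trans a2.symm⟩ K
    all_goals rfl

theorem isDiag_output_toQuantum (hmu : ∀ i, 0 ≤ mu i) : (P.toQuantum.output mu).IsDiag := by
  classical
  rintro ⟨⟨x, y⟩, o₁, o₂⟩ ⟨⟨x', y'⟩, o₁', o₂'⟩ hne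
  rw [output_toQuantum P mu hmu, if_neg]
  rintro ⟨rfl, rfl, rfl, rfl⟩
  exact hne rfl

theorem errorProb_toQuantum (hmu : ∀ i, 0 ≤ mu i) (v : X → Y → O) :
    P.toQuantum.errorProb mu v = P.toClassical.errorProb mu v := by
  classical
  unfold QuantumProtocol.errorProb ClassicalProtocol.errorProb
  simp only [output_toQuantum P mu hmu, and_self, if_true, Complex.ofReal_re]

/-! ### Divergence bound on the information cost -/

/-- Relative entropy, in bits, of two distributions on a finite set. -/
noncomputable def klDiv {α : Type} [Fintype α] (p q : α → ℝ) : ℝ :=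
  ∑ a, p a * Real.logb 2 (p a / q a)

theorem klDiv_self {α : Type} [Fintype α] (p : α → ℝ) : klDiv p p = 0 := by
  refine Finset.sum_eq_zero fun a _ => ?_
  rcases eq_or_ne (p a) 0 with h | h
  · simp [h]
  · simp [div_self h]

theorem sum_range_two_mul (f : ℕ → ℝ) : ∀ T : ℕ,
    ∑ i ∈ Finset.range (2 * T), f i = ∑ s ∈ Finset.range T, (f (2 * s) + f (2 * s + 1))
  | 0 => by simp
  | T + 1 => by
    rw [mul_add, mul_one, Finset.sum_range_succ, Finset.sum_range_succ, sum_range_two_mul f T,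
      Finset.sum_range_succ, add_assoc]

/-- If Bob predicts Alice's messages by `guessA` and Alice predicts Bob's by `guessB`, then the
information cost is at most the average total divergence of the messages from the predictions. -/
theorem IC_toClassical_le (hmu : ∀ i, 0 ≤ mu i)
    (guessA : Y → (i : ℕ) → (Fin i → M) → stdSimplex ℝ M)
    (guessB : X → (i : ℕ) → (Fin i → M) → stdSimplex ℝ M)
    (hA : ∀ x y i h m, P.alice x i h m ≠ 0 → guessA y i h m ≠ 0)
    (hB : ∀ x y i h m, P.bob y i h m ≠ 0 → guessB x i h m ≠ 0) :
    P.toClassical.IC mu ≤ ∑ x, ∑ y, mu (x, y) * ∑ s ∈ Finset.range P.turns,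
      (∑ h, P.prob x y (2 * s) h * klDiv (P.alice x (2 * s) h) (guessA y (2 * s) h)
      + ∑ h, P.prob x y (2 * s + 1) h *
          klDiv (P.bob y (2 * s + 1) h) (guessB x (2 * s + 1) h)) := by
  let qA : Y → (i : ℕ) → (Fin i → M) → M → ℝ := fun y i h m =>
    if Even i then guessA y i h m else P.bob y i h m
  let qB : X → (i : ℕ) → (Fin i → M) → M → ℝ := fun x i h m =>
    if Even i then P.alice x i h m else guessB x i h m
  have qA0 : ∀ y i h m, 0 ≤ qA y i h m := fun y i h m => by
    simp only [qA]
    split_ifs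
    exacts [stdSimplex_nonneg _ _, stdSimplex_nonneg _ _]
  have qB0 : ∀ x i h m, 0 ≤ qB x i h m := fun y i h m => by
    simp only [qB]
    split_ifs
    exacts [stdSimplex_nonneg _ _, stdSimplex_nonneg _ _]
  have qA1 : ∀ y i h, ∑ m, qA y i h m = 1 := fun y i h => by
    simp only [qA]
    split_ifs
    exacts [stdSimplex_sum _, stdSimplex_sum _]
  have qB1 : ∀ x i h, ∑ m, qB x i h m = 1 := fun y i h => by
    simp only [qB]
    split_ifs
    exacts [stdSimplex_sum _, stdSimplex_sum _]
  have acA : ∀ x y i h m, P.kernel x y i h m ≠ 0 → qA y i h m ≠ 0 := fun x y i h m => by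
    simp only [qA, kernel]
    split_ifs
    exacts [hA x y i h m, id]
  have acB : ∀ x y i h m, P.kernel x y i h m ≠ 0 → qB x i h m ≠ 0 := fun x y i h m => by
    simp only [qB, kernel]
    split_ifs
    exacts [id, hB x y i h m]
  have hU : ∀ f : (Fin (2 * P.turns) → M) → ℝ,
      ∑ t : Unit × (Fin (2 * P.turns) → M), f t.2 = ∑ h, f h := fun f => by
    rw [Fintype.sum_prod_type, Fintype.sum_unique]
  have b1 := condMutInf_le_divergence (fun x y => mu (x, y))
    (fun x y (t : Unit × (Fin (2 * P.turns) → M)) => P.prob x y (2 * P.turns) t.2)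
    (fun y t => seqProb (qA y) (2 * P.turns) t.2) (fun _ _ => hmu _)
    (fun x y t => P.prob_nonneg x y _ _) (fun x y => by rw [hU]; exact P.sum_prob x y _)
    (fun y t => seqProb_nonneg (qA0 y) _ _)
    (fun y => le_of_eq (by rw [hU]; exact sum_seqProb (qA1 y) _))
    (fun x y t h _ => seqProb_ne_zero (acA x y) _ _ h)
  have b2 := condMutInf_le_divergence (fun y x => mu (x, y))
    (fun y x (t : Unit × (Fin (2 * P.turns) → M)) => P.prob x y (2 * P.turns) t.2)
    (fun x t => seqProb (qB x) (2 * P.turns) t.2) (fun _ _ => hmu _)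
    (fun y x t => P.prob_nonneg x y _ _) (fun y x => by rw [hU]; exact P.sum_prob x y _)
    (fun x t => seqProb_nonneg (qB0 x) _ _)
    (fun x => le_of_eq (by rw [hU]; exact sum_seqProb (qB1 x) _))
    (fun y x t h _ => seqProb_ne_zero (acB x y) _ _ h)
  have h1 : P.toClassical.IC mu
      = condMutInf (fun i : X × (Unit × (Fin (2 * P.turns) → M)) × Y =>
          mu (i.1, i.2.2) * P.prob i.1 i.2.2 (2 * P.turns) i.2.1.2)
        + condMutInf (fun i : Y × (Unit × (Fin (2 * P.turns) → M)) × X =>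
          mu (i.2.2, i.1) * P.prob i.2.2 i.1 (2 * P.turns) i.2.1.2) := by
    have e1 : ∀ x y t, P.toClassical.transcriptProb x y t = P.prob x y (2 * P.turns) t.2 :=
      P.transcriptProb_toClassical
    unfold ClassicalProtocol.IC
    simp only [e1]
    rfl
  rw [h1]
  refine (add_le_add b1 b2).trans (le_of_eq ?_)
  refine (congrArg₂ (· + ·) rfl Finset.sum_comm).trans ?_
  rw [← Finset.sum_add_distrib]
  refine Finset.sum_congr rfl fun x _ => ?_
  rw [← Finset.sum_add_distrib]
  refine Finset.sum_congr rfl fun y _ => ?_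
  rw [← mul_add]
  congr 1
  have c1 := sum_seqProb_logb (P.sum_kernel x y) (acA x y) (2 * P.turns)
  have c2 := sum_seqProb_logb (P.sum_kernel x y) (acB x y) (2 * P.turns)
  rw [sum_range_two_mul] at c1 c2
  refine (congrArg₂ (· + ·) ((hU _).trans c1) ((hU _).trans c2)).trans ?_
  rw [← Finset.sum_add_distrib]
  refine Finset.sum_congr rfl fun s _ => ?_
  have z : ∀ p : stdSimplex ℝ M, ∑ m, p m * Real.logb 2 (p m / p m) = 0 := fun p => klDiv_self _
  simp only [kernel_even, kernel_odd, qA, qB, even_two_mul, if_true, Nat.not_even_bit1, if_false, z,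
    mul_zero, Finset.sum_const_zero, add_zero, zero_add]
  rfl

end MessageScheme

/-! ### The noisy jumping protocol -/

namespace PointerJumping

/-- The distribution of a pair of independent variables. -/
def prodSimplex {α β : Type} [Fintype α] [Fintype β] (p : stdSimplex ℝ α) (q : stdSimplex ℝ β) :
    stdSimplex ℝ (α × β) :=
  ⟨fun i => p i.1 * q i.2, fun i => mul_nonneg (p.2.1 _) (q.2.1 _), by
    have hp := stdSimplex_sum p
    have hq := stdSimplex_sum q
    rw [Fintype.sum_prod_type]
    simp only [← Finset.mul_sum, hq, hp, mul_one]⟩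

theorem prodSimplex_apply {α β : Type} [Fintype α] [Fintype β] (p : stdSimplex ℝ α)
    (q : stdSimplex ℝ β) (i : α × β) : prodSimplex p q i = p i.1 * q i.2 := rfl

/-- The distribution concentrated at one point. -/
noncomputable def pointMass {α : Type} [Fintype α] [DecidableEq α] (a : α) : stdSimplex ℝ α :=
  ⟨Pi.single a 1, single_mem_stdSimplex ℝ a⟩

theorem pointMass_apply {α : Type} [Fintype α] [DecidableEq α] (a b : α) :
    pointMass a b = if b = a then 1 else 0 := Pi.single_apply a 1 b

/-- The uniform distribution. -/
noncomputable def uniform (α : Type) [Fintype α] [Nonempty α] : stdSimplex ℝ α :=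
  ⟨fun _ => 1 / (Fintype.card α : ℝ), fun _ => by positivity, by
    rw [Finset.sum_const, Finset.card_univ, nsmul_eq_mul]
    exact mul_one_div_cancel (by exact_mod_cast Fintype.card_ne_zero)⟩

theorem uniform_apply {α : Type} [Fintype α] [Nonempty α] (a : α) :
    uniform α a = 1 / (Fintype.card α : ℝ) := rfl

variable {n k : ℕ} [NeZero k]

/-- The character `c`, replaced with probability `ε` by a uniformly random one. -/
noncomputable def noisy (ε : unitInterval) (c : Fin k) : stdSimplex ℝ (Fin k) :=
  ⟨fun a => (1 - ε) * (if a = c then 1 else 0) + ε / k, fun a => by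
    have h1 := ε.2.1
    have h2 : 0 ≤ 1 - (ε : ℝ) := sub_nonneg.2 ε.2.2
    positivity, by
    have hk : (k : ℝ) ≠ 0 := NeZero.ne _
    rw [Finset.sum_add_distrib, ← Finset.mul_sum, Finset.sum_ite_eq', if_pos (Finset.mem_univ _),
      Finset.sum_const, Finset.card_univ, Fintype.card_fin, nsmul_eq_mul, mul_div_cancel₀ _ hk]
    ring⟩

theorem noisy_apply (ε : unitInterval) (c a : Fin k) :
    noisy ε c a = (1 - (ε : ℝ)) * (if a = c then 1 else 0) + ε / k := rfl

/-- The string of jumps made by the messages `ω`: each character is the sum of the characters sent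
by Alice and Bob in one round. -/
def walk (ω : ℕ → Fin k) (r : ℕ) : Fin r → Fin k := fun s => ω (2 * s) + ω (2 * s + 1)

/-- The number of rounds, among the first `r`, since Alice and Bob last sent equal characters; once
it has reached `m` it stays there, and the protocol is aborted. -/
def strikes (m : ℕ) (ω : ℕ → Fin k) : ℕ → ℕ
  | 0 => 0
  | r + 1 => if m ≤ strikes m ω r then strikes m ω r else
      if ω (2 * r) = ω (2 * r + 1) then 0 else strikes m ω r + 1

omit [NeZero k] in
theorem walk_update (ω : ℕ → Fin k) {r i : ℕ} (hi : 2 * r ≤ i) (a : Fin k) :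
    walk (Function.update ω i a) r = walk ω r := by
  funext s
  have := s.2
  simp only [walk]
  rw [Function.update_of_ne (by omega), Function.update_of_ne (by omega)]

omit [NeZero k] in
theorem strikes_update (m : ℕ) (ω : ℕ → Fin k) (i : ℕ) (a : Fin k) :
    ∀ r : ℕ, 2 * r ≤ i → strikes m (Function.update ω i a) r = strikes m ω r
  | 0, _ => rfl
  | r + 1, hi => by
    simp only [strikes]
    rw [strikes_update m ω i a r (by omega), Function.update_of_ne (by omega),
      Function.update_of_ne (by omega)]

omit [NeZero k] in
theorem walk_round (ω : ℕ → Fin k) (r : ℕ) (a b : Fin k) :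
    walk (Function.update (Function.update ω (2 * r) a) (2 * r + 1) b) (r + 1)
      = Fin.snoc (walk ω r) (a + b) := by
  funext s
  induction s using Fin.lastCases with
  | last => simp [walk]
  | cast s =>
    have := s.2
    simp only [walk, Fin.snoc_castSucc, Fin.val_castSucc]
    rw [Function.update_of_ne (by omega), Function.update_of_ne (by omega),
      Function.update_of_ne (by omega), Function.update_of_ne (by omega)]

omit [NeZero k] in
theorem strikes_round (m : ℕ) (ω : ℕ → Fin k) (r : ℕ) (a b : Fin k) :
    strikes m (Function.update (Function.update ω (2 * r) a) (2 * r + 1) b) (r + 1)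
      = if m ≤ strikes m ω r then strikes m ω r else if a = b then 0 else strikes m ω r + 1 := by
  simp only [strikes]
  rw [strikes_update m _ _ _ r (by omega), strikes_update m _ _ _ r (by omega),
    Function.update_self, Function.update_of_ne (by omega), Function.update_self]

/-- The characters in a sequence of messages, continued by zeros. -/
def chars {i : ℕ} (h : Fin i → Fin k × ZMod 2) : ℕ → Fin k :=
  fun t => if ht : t < i then (h ⟨t, ht⟩).1 else 0

theorem chars_snoc {i : ℕ} (h : Fin i → Fin k × ZMod 2) (p : Fin k × ZMod 2) :
    chars (Fin.snoc h p : Fin (i + 1) → Fin k × ZMod 2) = Function.update (chars h) i p.1 := by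
  funext t
  unfold chars
  rcases lt_trichotomy t i with ht | rfl | ht
  · rw [Function.update_of_ne ht.ne, dif_pos (by omega), dif_pos ht]
    congr 1
    exact Fin.snoc_castSucc (α := fun _ => Fin k × ZMod 2) p h ⟨t, ht⟩
  · rw [Function.update_self, dif_pos (by omega)]
    congr 1
    exact Fin.snoc_last (α := fun _ => Fin k × ZMod 2) p h
  · rw [Function.update_of_ne ht.ne', dif_neg (by omega), dif_neg (by omega)]

/-- The message in round `r`, after the characters `ω`, of the player with input `u`. If the
protocol has been aborted, it carries no information; for `r < n` it is the noisy value of the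
player's function at the node reached; then it is a bit with distribution `last b`, where `b` is the
player's bit at the leaf reached. The protocol uses `last = pointMass`; a player who does not
know `b` predicts the message with the uniform `last`. -/
noncomputable def roundMessage (m : ℕ) (ε : unitInterval)
    (last : ZMod 2 → stdSimplex ℝ (ZMod 2)) (u : Input n k) (r : ℕ) (ω : ℕ → Fin k) :
    stdSimplex ℝ (Fin k × ZMod 2) :=
  if m ≤ strikes m ω r then prodSimplex (uniform (Fin k)) (pointMass 0)
  else if hr : r < n then prodSimplex (noisy ε (u.1 ⟨⟨r, hr⟩, walk ω r⟩)) (pointMass 0)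
  else prodSimplex (uniform (Fin k)) (last (u.2 (walk ω n)))

theorem roundMessage_update (m : ℕ) (ε : unitInterval) (last : ZMod 2 → stdSimplex ℝ (ZMod 2))
    (u : Input n k) {r i : ℕ} (ω : ℕ → Fin k) (a : Fin k) (hi : 2 * r ≤ i) :
    roundMessage m ε last u r (Function.update ω i a) = roundMessage m ε last u r ω := by
  unfold roundMessage
  rw [strikes_update m ω i a r hi, walk_update ω hi]
  split_ifs with h1 h2
  · rfl
  · rfl
  · rw [walk_update ω (by omega)]

/-- The noisy jumping protocol: `n` rounds in which the players send noisy values and jump, with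
abortion after `m` consecutive rounds of disagreement, and a round in which they exchange their
bits at the leaf reached. -/
noncomputable def noisyJump (n k : ℕ) [NeZero k] (m : ℕ) (ε : unitInterval) :
    MessageScheme (Input n k) (Input n k) (ZMod 2) (Fin k × ZMod 2) where
  turns := n + 1
  alice u i h := roundMessage m ε pointMass u (i / 2) (chars h)
  bob v i h := roundMessage m ε pointMass v (i / 2) (chars h)
  outA _ h := if m ≤ strikes m (chars h) n then 0 else
    (h ⟨2 * n, by omega⟩).2 + (h ⟨2 * n + 1, by omega⟩).2
  outB _ h := if m ≤ strikes m (chars h) n then 0 else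
    (h ⟨2 * n, by omega⟩).2 + (h ⟨2 * n + 1, by omega⟩).2

variable (m : ℕ) (ε : unitInterval) (u v : Input n k)

theorem prob_round (s : ℕ) (h : Fin (2 * s) → Fin k × ZMod 2) (p q : Fin k × ZMod 2) :
    (noisyJump n k m ε).prob u v (2 * s + 2)
      (Fin.snoc (Fin.snoc h p : Fin (2 * s + 1) → Fin k × ZMod 2) q :
        Fin (2 * s + 2) → Fin k × ZMod 2)
      = (noisyJump n k m ε).prob u v (2 * s) h * (roundMessage m ε pointMass u s (chars h) p *
        roundMessage m ε pointMass v s (chars h) q) := by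
  rw [MessageScheme.prob_snoc, MessageScheme.prob_snoc, MessageScheme.kernel_even,
    MessageScheme.kernel_odd, mul_assoc]
  have h1 : 2 * s / 2 = s := by omega
  have h2 : (2 * s + 1) / 2 = s := by omega
  simp only [noisyJump, h1, h2, chars_snoc]
  rw [roundMessage_update m ε pointMass v _ _ le_rfl]

theorem sum_prob_round (s : ℕ) (F : (Fin (2 * s + 2) → Fin k × ZMod 2) → ℝ) :
    ∑ h, (noisyJump n k m ε).prob u v (2 * s + 2) h * F h
      = ∑ h : Fin (2 * s) → Fin k × ZMod 2, (noisyJump n k m ε).prob u v (2 * s) h *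
        ∑ p, ∑ q, roundMessage m ε pointMass u s (chars h) p *
          roundMessage m ε pointMass v s (chars h) q *
          F (Fin.snoc (Fin.snoc h p : Fin (2 * s + 1) → Fin k × ZMod 2) q :
            Fin (2 * s + 2) → Fin k × ZMod 2) := by
  rw [sum_snoc (i := 2 * s + 1), sum_snoc (i := 2 * s)]
  simp only [prob_round, Finset.mul_sum, mul_assoc]

/-- Expectation of a function of the node reached and of the strikes after `s` rounds. -/
noncomputable def expect (s : ℕ) (G : (Fin s → Fin k) → ℕ → ℝ) : ℝ :=
  ∑ h : Fin (2 * s) → Fin k × ZMod 2, (noisyJump n k m ε).prob u v (2 * s) h *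
    G (walk (chars h) s) (strikes m (chars h) s)

theorem expect_succ {s : ℕ} (hs : s < n) (G : (Fin (s + 1) → Fin k) → ℕ → ℝ) :
    expect m ε u v (s + 1) G = expect m ε u v s fun z c =>
      if m ≤ c then
        ∑ a, uniform (Fin k) a * ∑ b, uniform (Fin k) b * G (Fin.snoc z (a + b)) c
      else
        ∑ a, noisy ε (u.1 ⟨⟨s, hs⟩, z⟩) a * ∑ b, noisy ε (v.1 ⟨⟨s, hs⟩, z⟩) b *
          G (Fin.snoc z (a + b)) (if a = b then 0 else c + 1) := by
  unfold expect
  refine (sum_prob_round m ε u v s fun h =>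
    G (walk (chars h) (s + 1)) (strikes m (chars h) (s + 1))).trans ?_
  refine Finset.sum_congr rfl fun h _ => congrArg _ ?_
  simp only [chars_snoc, walk_round, strikes_round, mul_assoc, ← Finset.mul_sum]
  unfold roundMessage
  split_ifs with h1 <;>
  simp only [Fintype.sum_prod_type, prodSimplex_apply, pointMass_apply, mul_ite, mul_one, mul_zero,
    ite_mul, zero_mul, Finset.sum_ite_eq', Finset.mem_univ, if_true]

theorem expect_zero (G : (Fin 0 → Fin k) → ℕ → ℝ) : expect m ε u v 0 G = G Fin.elim0 0 := by
  have h1 := (noisyJump n k m ε).sum_prob u v 0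
  have h2 : ∀ h : Fin 0 → Fin k × ZMod 2, walk (chars h) 0 = Fin.elim0 := fun h =>
    funext fun i => Fin.elim0 i
  have h3 : ∀ h : Fin 0 → Fin k × ZMod 2, strikes m (chars h) 0 = 0 := fun h => rfl
  show ∑ h : Fin 0 → Fin k × ZMod 2, _ = _
  simp only [h2, h3, ← Finset.sum_mul]
  rw [h1, one_mul]

variable {m ε u v}

theorem expect_mono {s : ℕ} {G G' : (Fin s → Fin k) → ℕ → ℝ} (h : ∀ z c, G z c ≤ G' z c) :
    expect m ε u v s G ≤ expect m ε u v s G' :=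
  Finset.sum_le_sum fun _ _ => mul_le_mul_of_nonneg_left (h _ _)
    (MessageScheme.prob_nonneg _ _ _ _ _)

variable (m ε u v)

theorem expect_add (s : ℕ) (G G' : (Fin s → Fin k) → ℕ → ℝ) :
    expect m ε u v s (fun z c => G z c + G' z c)
      = expect m ε u v s G + expect m ε u v s G' := by
  simp only [expect, mul_add, Finset.sum_add_distrib]

theorem expect_const_mul (s : ℕ) (a : ℝ) (G : (Fin s → Fin k) → ℕ → ℝ) :
    expect m ε u v s (fun z c => a * G z c) = a * expect m ε u v s G := by
  simp only [expect, Finset.mul_sum]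
  exact Finset.sum_congr rfl fun _ _ => by ring

theorem expect_const (s : ℕ) (a : ℝ) : expect m ε u v s (fun _ _ => a) = a := by
  simp only [expect, ← Finset.sum_mul]
  rw [MessageScheme.sum_prob, one_mul]

end PointerJumping

/-! ### Consistent strings -/

namespace PointerJumping

variable {n k : ℕ}

/-- The pairs of inputs on which the hard distributions with hidden index `j` are supported. -/
def Hard (j : Fin n) (u v : Input n k) : Prop :=
  AgreeBelow j u v ∧ (Event0 ((u, v), j) ∨ Event1 ((u, v), j))

theorem Hard.node_eq {j : Fin n} {u v : Input n k} (h : Hard j u v) (z : Node n k)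
    (hz : Consistent u.1 v.1 j z.2) : u.1 z = v.1 z :=
  h.2.elim (fun H => H.1 z hz) fun H => H.1 z hz

theorem consistent_snoc_of_lt {x y : Node n k → Fin k} {j : Fin n} {s : ℕ} (hs : (j : ℕ) < s)
    (z : Fin s → Fin k) (t : Fin k) :
    Consistent x y j (Fin.snoc z t : Fin (s + 1) → Fin k) ↔ Consistent x y j z := by
  have h1 : ∀ (i : ℕ) (hi : i < s), (Fin.snoc z t : Fin (s + 1) → Fin k) ⟨i, by omega⟩ = z ⟨i, hi⟩ :=
    fun i hi => Fin.snoc_castSucc (α := fun _ => Fin k) t z ⟨i, hi⟩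
  have h2 : pre (Fin.snoc z t : Fin (s + 1) → Fin k) j (by omega) = pre z j hs.le := by
    funext i
    exact h1 i (by omega)
  unfold Consistent
  constructor
  · rintro ⟨_, h⟩
    exact ⟨hs, by rw [h2, h1 _ hs] at h; exact h⟩
  · rintro ⟨_, h⟩
    exact ⟨by omega, by rw [h2, h1 _ hs]; exact h⟩

theorem consistent_snoc_self {x y : Node n k → Fin k} {j : Fin n} (z : Fin j → Fin k) (t : Fin k) :
    Consistent x y j (Fin.snoc z t : Fin (j + 1) → Fin k) ↔ x ⟨j, z⟩ + y ⟨j, z⟩ = t := by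
  have h1 : (Fin.snoc z t : Fin (j + 1) → Fin k) ⟨j, by omega⟩ = t :=
    Fin.snoc_last (α := fun _ => Fin k) t z
  have h2 : pre (Fin.snoc z t : Fin (j + 1) → Fin k) j (by omega) = z := by
    funext i
    exact Fin.snoc_castSucc (α := fun _ => Fin k) t z i
  have h3 := congrArg (fun w => x ⟨j, w⟩ + y ⟨j, w⟩) h2
  exact ⟨fun ⟨_, h⟩ => h3.symm.trans (h.trans h1),
    fun h => ⟨Nat.lt_succ_self _, h3.trans (h.trans h1.symm)⟩⟩

theorem consistent_path (x y : Node n k → Fin k) (j : Fin n) :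
    ∀ (r : ℕ) (hr : r ≤ n), (j : ℕ) < r → Consistent x y j (path x y r hr)
  | 0, _, h => absurd h (Nat.not_lt_zero _)
  | r + 1, hr, h => by
    rcases Nat.lt_succ_iff_lt_or_eq.1 h with h' | rfl
    · exact (consistent_snoc_of_lt h' _ _).2 (consistent_path x y j r _ h')
    · exact (consistent_snoc_self _ _).2 rfl

/-- All consistent leaves give the value that has to be computed. -/
theorem Hard.add_eq_target {j : Fin n} {u v : Input n k} (h : Hard j u v) (z : Leaf n k)
    (hz : Consistent u.1 v.1 j z) : u.2 z + v.2 z = target u v := by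
  have hp := consistent_path u.1 v.1 j n le_rfl j.2
  have two : ∀ a : ZMod 2, a + a = 0 := by decide
  have one : ∀ a b : ZMod 2, a ≠ b → a + b = 1 := by decide
  unfold target
  rcases h.2 with H | H
  · have e1 : u.2 z = v.2 z := H.2 z hz
    have e2 : u.2 (path u.1 v.1 n le_rfl) = v.2 (path u.1 v.1 n le_rfl) := H.2 _ hp
    rw [e1, e2, two, two]
  · rw [one _ _ (H.2 z hz), one _ _ (H.2 _ hp)]

/-- The string `z` has passed level `j` with a wrong jump there. -/
def OffPath (j : Fin n) (u v : Input n k) {s : ℕ} (z : Fin s → Fin k) : Prop :=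
  (j : ℕ) < s ∧ ¬Consistent u.1 v.1 j z

theorem offPath_snoc_of_lt {j : Fin n} {u v : Input n k} {s : ℕ} (hs : (j : ℕ) < s)
    (z : Fin s → Fin k) (t : Fin k) :
    OffPath j u v (Fin.snoc z t : Fin (s + 1) → Fin k) ↔ OffPath j u v z := by
  unfold OffPath
  rw [consistent_snoc_of_lt hs]
  exact ⟨fun h => ⟨hs, h.2⟩, fun h => ⟨by omega, h.2⟩⟩

theorem not_offPath_of_le {j : Fin n} {u v : Input n k} {s : ℕ} (hs : s ≤ j)
    (z : Fin s → Fin k) : ¬OffPath j u v z := fun h => absurd h.1 (by omega)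

/-- Away from level `j` the two functions agree unless a wrong jump was made. -/
theorem Hard.eq_of_not_offPath {j : Fin n} {u v : Input n k} (h : Hard j u v) {s : ℕ} (hs : s < n)
    (hsj : s ≠ j) (z : Fin s → Fin k) (hz : ¬OffPath j u v z) :
    u.1 ⟨⟨s, hs⟩, z⟩ = v.1 ⟨⟨s, hs⟩, z⟩ := by
  rcases lt_or_gt_of_ne hsj with h1 | h1
  · exact h.1 ⟨⟨s, hs⟩, z⟩ h1
  · exact h.node_eq ⟨⟨s, hs⟩, z⟩ (by_contra fun H => hz ⟨h1, H⟩)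

/-! ### Error of the noisy jumping protocol -/

variable [NeZero k] {m : ℕ} {ε : unitInterval}

/-- A noisy character differs from the true one only with probability `ε`. -/
theorem sum_noisy_mul_le (c : Fin k) (f : Fin k → ℝ) {B : ℝ} (h0 : ∀ a, 0 ≤ f a)
    (hB : ∀ a, f a ≤ B) : ∑ a, noisy ε c a * f a ≤ f c + ε * B := by
  have hk : (k : ℝ) ≠ 0 := NeZero.ne _
  have hε := ε.2.1
  calc ∑ a, noisy ε c a * f a ≤ ∑ a, ((if a = c then f a else 0) + ε / k * B) := by
        refine Finset.sum_le_sum fun a _ => ?_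
        rw [noisy_apply, add_mul]
        refine add_le_add ?_ (mul_le_mul_of_nonneg_left (hB a) (by positivity))
        split_ifs
        · rw [mul_one]
          exact mul_le_of_le_one_left (h0 a) (by linarith)
        · simp
    _ = f c + ε * B := by
        rw [Finset.sum_add_distrib, Finset.sum_ite_eq', if_pos (Finset.mem_univ _),
          Finset.sum_const, Finset.card_univ, Fintype.card_fin, nsmul_eq_mul]
        field_simp

theorem sum_noisy_noisy_mul_le (c d : Fin k) (F : Fin k → Fin k → ℝ) {B : ℝ}
    (h0 : ∀ a b, 0 ≤ F a b) (hB : ∀ a b, F a b ≤ B) :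
    ∑ a, noisy ε c a * ∑ b, noisy ε d b * F a b ≤ F c d + 2 * ε * B := by
  calc ∑ a, noisy ε c a * ∑ b, noisy ε d b * F a b
      ≤ ∑ a, noisy ε c a * (F a d + ε * B) := by
        refine Finset.sum_le_sum fun a _ => mul_le_mul_of_nonneg_left ?_ (stdSimplex_nonneg _ _)
        exact sum_noisy_mul_le d (F a) (h0 a) (hB a)
    _ = ∑ a, noisy ε c a * F a d + ε * B := by
        simp only [mul_add, Finset.sum_add_distrib, ← Finset.sum_mul, stdSimplex_sum, one_mul]
    _ ≤ (F c d + ε * B) + ε * B := by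
        gcongr
        exact sum_noisy_mul_le c (fun a => F a d) (fun a => h0 a d) fun a => hB a d
    _ = F c d + 2 * ε * B := by ring

open Classical in
/-- An upper bound for the probability of failing eventually: failure has occurred if the protocol
is aborted or a wrong jump was made at level `j`; otherwise `m - c` more disagreements are needed,
each of probability at most `2 ε`. -/
noncomputable def failurePotential (m : ℕ) (ε : unitInterval) (j : Fin n) (u v : Input n k) (s : ℕ)
    (z : Fin s → Fin k) (c : ℕ) : ℝ :=
  if m ≤ c ∨ OffPath j u v z then 1 else (2 * ε) ^ (m - c)

section

variable {j : Fin n} {u v : Input n k}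

omit [NeZero k] in
theorem failurePotential_nonneg (s : ℕ) (z : Fin s → Fin k) (c : ℕ) :
    0 ≤ failurePotential m ε j u v s z c := by
  have := ε.2.1
  unfold failurePotential
  split_ifs <;> positivity

omit [NeZero k] in
theorem failurePotential_le_one (hε : 2 * (ε : ℝ) ≤ 1) (s : ℕ) (z : Fin s → Fin k) (c : ℕ) :
    failurePotential m ε j u v s z c ≤ 1 := by
  have := ε.2.1
  unfold failurePotential
  split_ifs
  · exact le_rfl
  · exact pow_le_one₀ (by positivity) hε

theorem sum_uniform_uniform_mul_le (F : Fin k → Fin k → ℝ) {B : ℝ} (hB : ∀ a b, F a b ≤ B) :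
    ∑ a, uniform (Fin k) a * ∑ b, uniform (Fin k) b * F a b ≤ B := by
  have h1 : ∀ f : Fin k → ℝ, (∀ a, f a ≤ B) → ∑ a, uniform (Fin k) a * f a ≤ B := fun f hf =>
    calc ∑ a, uniform (Fin k) a * f a ≤ ∑ a, uniform (Fin k) a * B :=
          Finset.sum_le_sum fun a _ => mul_le_mul_of_nonneg_left (hf a) (stdSimplex_nonneg _ _)
      _ = B := by rw [← Finset.sum_mul, stdSimplex_sum, one_mul]
  exact h1 _ fun a => h1 _ (hB a)

theorem sum_noisy_noisy_mul_le_of_le (c d : Fin k) (F : Fin k → Fin k → ℝ) {B : ℝ}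
    (hB : ∀ a b, F a b ≤ B) : ∑ a, noisy ε c a * ∑ b, noisy ε d b * F a b ≤ B := by
  have h1 : ∀ (c : Fin k) (f : Fin k → ℝ), (∀ a, f a ≤ B) → ∑ a, noisy ε c a * f a ≤ B :=
    fun c f hf =>
    calc ∑ a, noisy ε c a * f a ≤ ∑ a, noisy ε c a * B :=
          Finset.sum_le_sum fun a _ => mul_le_mul_of_nonneg_left (hf a) (stdSimplex_nonneg _ _)
      _ = B := by rw [← Finset.sum_mul, stdSimplex_sum, one_mul]
  exact h1 _ _ fun a => h1 _ _ (hB a)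

/-- Away from level `j` the failure potential increases by at most `(2 ε) ^ m` per round. -/
theorem expect_failurePotential_succ (h : Hard j u v) (hε : 2 * (ε : ℝ) ≤ 1) {s : ℕ} (hs : s < n)
    (hsj : s ≠ j) :
    expect m ε u v (s + 1) (failurePotential m ε j u v (s + 1))
      ≤ expect m ε u v s (failurePotential m ε j u v s) + (2 * ε) ^ m := by
  have hε0 := ε.2.1
  rw [expect_succ _ _ _ _ hs, ← expect_const m ε u v s ((2 * (ε : ℝ)) ^ m), ← expect_add]
  refine expect_mono fun z c => ?_
  have hδ : 0 ≤ (2 * (ε : ℝ)) ^ m := by positivity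
  by_cases H : m ≤ c ∨ OffPath j u v z
  · have h1 : failurePotential m ε j u v s z c = 1 := if_pos H
    rw [h1]
    have h2 := fun t c' => failurePotential_le_one (m := m) (j := j) (u := u) (v := v) hε (s + 1)
      (Fin.snoc z t) c'
    split_ifs
    · linarith [sum_uniform_uniform_mul_le (fun a b =>
        failurePotential m ε j u v (s + 1) (Fin.snoc z (a + b)) c) (fun a b => h2 _ _)]
    · linarith [sum_noisy_noisy_mul_le_of_le (ε := ε) (u.1 ⟨⟨s, hs⟩, z⟩) (v.1 ⟨⟨s, hs⟩, z⟩)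
        (fun a b => failurePotential m ε j u v (s + 1) (Fin.snoc z (a + b))
          (if a = b then 0 else c + 1)) (fun a b => h2 _ _)]
  · have h1 : failurePotential m ε j u v s z c = (2 * ε) ^ (m - c) := if_neg H
    push Not at H
    rw [h1, if_neg (by omega), h.eq_of_not_offPath hs hsj z H.2]
    have h2 : ∀ t, ¬OffPath j u v (Fin.snoc z t : Fin (s + 1) → Fin k) := fun t => by
      rcases lt_or_gt_of_ne hsj with h3 | h3
      · exact not_offPath_of_le (by omega) _
      · rw [offPath_snoc_of_lt h3]
        exact H.2
    have h3 : ∀ c' t, c' ≤ m → failurePotential m ε j u v (s + 1) (Fin.snoc z t) c'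
        = (2 * ε) ^ (m - c') := fun c' t hc => by
      unfold failurePotential
      split_ifs with h4
      · rcases h4 with h4 | h4
        · rw [show m - c' = 0 by omega, pow_zero]
        · exact absurd h4 (h2 t)
      · rfl
    refine (sum_noisy_noisy_mul_le (ε := ε) (v.1 ⟨⟨s, hs⟩, z⟩) (v.1 ⟨⟨s, hs⟩, z⟩)
      (fun a b => failurePotential m ε j u v (s + 1) (Fin.snoc z (a + b))
          (if a = b then 0 else c + 1)) (B := (2 * ε) ^ (m - (c + 1)))
      (fun a b => failurePotential_nonneg _ _ _) fun a b => ?_).trans ?_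
    · split_ifs
      · rw [h3 _ _ (Nat.zero_le _)]
        exact pow_le_pow_of_le_one (by positivity) hε (by omega)
      · rw [h3 _ _ (by omega)]
    · simp only [if_true]
      rw [h3 _ _ (Nat.zero_le _), ← pow_succ', show m - (c + 1) + 1 = m - c by omega, Nat.sub_zero,
        add_comm]

/-- At level `j` a disagreement is expected, and a wrong jump has probability at most `2 ε`. -/
theorem expect_failurePotential_level (hε0 : 0 < (ε : ℝ)) (hε : 2 * (ε : ℝ) ≤ 1) :
    expect m ε u v (j + 1) (failurePotential m ε j u v (j + 1))
      ≤ (2 * (ε : ℝ))⁻¹ * expect m ε u v j (failurePotential m ε j u v j) + 2 * ε := by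
  have hinv : 1 ≤ (2 * (ε : ℝ))⁻¹ := (one_le_inv₀ (by positivity)).2 hε
  have hrhs : (2 * (ε : ℝ))⁻¹ * expect m ε u v j (failurePotential m ε j u v j) + 2 * ε
      = expect m ε u v j fun z c => (2 * (ε : ℝ))⁻¹ * failurePotential m ε j u v j z c + 2 * ε := by
    rw [expect_add, expect_const_mul, expect_const]
  rw [expect_succ _ _ _ _ j.2, hrhs]
  refine expect_mono fun z c => ?_
  have hoff := not_offPath_of_le (u := u) (v := v) le_rfl z
  have h2 := fun t c' => failurePotential_le_one (m := m) (j := j) (u := u) (v := v) hε (j + 1)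
      (Fin.snoc z t) c'
  split_ifs with hc
  · have h1 : failurePotential m ε j u v j z c = 1 := if_pos (Or.inl hc)
    rw [h1]
    linarith [sum_uniform_uniform_mul_le (fun a b =>
        failurePotential m ε j u v (j + 1) (Fin.snoc z (a + b)) c) (fun a b => h2 _ _)]
  · have h1 : failurePotential m ε j u v j z c = (2 * ε) ^ (m - c) :=
      if_neg fun h => h.elim hc hoff
    refine (sum_noisy_noisy_mul_le (ε := ε) (u.1 ⟨j, z⟩) (v.1 ⟨j, z⟩)
      (fun a b => failurePotential m ε j u v (j + 1) (Fin.snoc z (a + b))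
          (if a = b then 0 else c + 1)) (B := 1)
      (fun a b => failurePotential_nonneg _ _ _) fun a b => h2 _ _).trans ?_
    rw [h1, mul_one]
    gcongr
    have hpow : (2 * (ε : ℝ))⁻¹ * (2 * ε) ^ (m - c) = (2 * ε) ^ (m - (c + 1)) := by
      rw [show m - c = m - (c + 1) + 1 by omega, pow_succ', ← mul_assoc,
        inv_mul_cancel₀ (by positivity), one_mul]
    rw [hpow]
    have hgood : ¬OffPath j u v (Fin.snoc z (u.1 ⟨j, z⟩ + v.1 ⟨j, z⟩) : Fin (j + 1) → Fin k) :=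
      fun h => h.2 ((consistent_snoc_self z _).2 rfl)
    have h3 : (if u.1 ⟨j, z⟩ = v.1 ⟨j, z⟩ then 0 else c + 1) ≤ c + 1 := by
      split_ifs <;> omega
    generalize (if u.1 ⟨j, z⟩ = v.1 ⟨j, z⟩ then 0 else c + 1) = c' at h3
    unfold failurePotential
    split_ifs with h4
    · rcases h4 with h4 | h4
      · rw [show m - (c + 1) = 0 by omega, pow_zero]
      · exact absurd h4 hgood
    · exact pow_le_pow_of_le_one (by positivity) hε (by omega)

/-- Failure after `n` rounds is unlikely on every hard pair of inputs. -/
theorem expect_failurePotential_le (h : Hard j u v) (hε0 : 0 < (ε : ℝ)) (hε : 2 * (ε : ℝ) ≤ 1) :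
    expect m ε u v n (failurePotential m ε j u v n)
      ≤ (2 * (ε : ℝ))⁻¹ * (n * (2 * ε) ^ m) + 2 * ε := by
  have hinv : 1 ≤ (2 * (ε : ℝ))⁻¹ := (one_le_inv₀ (by positivity)).2 hε
  have hδ : 0 ≤ (2 * (ε : ℝ)) ^ m := by positivity
  have before : ∀ s : ℕ, s ≤ j → expect m ε u v s (failurePotential m ε j u v s)
      ≤ (s + 1) * (2 * ε) ^ m := by
    intro s
    induction s with
    | zero =>
      intro _
      rw [expect_zero]
      unfold failurePotential
      split_ifs with h1
      · rcases h1 with h1 | h1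
        · rw [show m = 0 by omega]
          simp
        · exact absurd h1 (not_offPath_of_le (Nat.zero_le _) _)
      · simp
    | succ s ih =>
      intro hs
      have := expect_failurePotential_succ (m := m) h hε (s := s) (by omega) (by omega)
      have := ih (by omega)
      push_cast
      linarith
  have after : ∀ s : ℕ, j + 1 ≤ s → s ≤ n → expect m ε u v s (failurePotential m ε j u v s)
      ≤ (2 * (ε : ℝ))⁻¹ * (s * (2 * ε) ^ m) + 2 * ε := by
    intro s hs
    induction s, hs using Nat.le_induction with
    | base =>
      intro _
      have h1 := expect_failurePotential_level (m := m) (j := j) (u := u) (v := v) hε0 hε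
      have h2 := mul_le_mul_of_nonneg_left (before j le_rfl) (zero_le_one.trans hinv)
      push_cast
      linarith
    | succ s hs ih =>
      intro hn
      have h1 := expect_failurePotential_succ (m := m) h hε (s := s) (by omega) (by omega)
      have h2 := ih (by omega)
      have h3 := mul_le_mul_of_nonneg_right hinv hδ
      push_cast
      rw [add_mul, mul_add, one_mul]
      linarith
  exact after n j.2 le_rfl

open Classical in
theorem sum_prob_wrong_le (h : Hard j u v) (hε0 : 0 < (ε : ℝ)) (hε : 2 * (ε : ℝ) ≤ 1) :
    ∑ t : Fin (2 * (n + 1)) → Fin k × ZMod 2,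
      (if (noisyJump n k m ε).outA u t = target u v ∧ (noisyJump n k m ε).outB v t = target u v
        then 0 else (noisyJump n k m ε).prob u v (2 * (n + 1)) t)
      ≤ (2 * (ε : ℝ))⁻¹ * (n * (2 * ε) ^ m) + 2 * ε := by
  refine le_trans ?_ (expect_failurePotential_le (m := m) h hε0 hε)
  have h1 : ∀ t : Fin (2 * n + 2) → Fin k × ZMod 2,
      (if (noisyJump n k m ε).outA u t = target u v ∧ (noisyJump n k m ε).outB v t = target u v
        then 0 else (noisyJump n k m ε).prob u v (2 * (n + 1)) t)
      = (noisyJump n k m ε).prob u v (2 * n + 2) t *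
        if (noisyJump n k m ε).outA u t = target u v then 0 else 1 := by
    intro t
    by_cases ho : (noisyJump n k m ε).outA u t = target u v
    · rw [if_pos ho, mul_zero]
      exact if_pos ⟨ho, ho⟩
    · rw [if_neg ho, mul_one]
      exact if_neg fun H => ho H.1
  refine (Finset.sum_congr rfl fun t _ => h1 t).trans_le ?_
  rw [sum_prob_round m ε u v n]
  refine Finset.sum_le_sum fun t _ => mul_le_mul_of_nonneg_left ?_
    (MessageScheme.prob_nonneg _ _ _ _ _)
  have hsum : ∑ p, ∑ q, roundMessage m ε pointMass u n (chars t) p *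
      roundMessage m ε pointMass v n (chars t) q = 1 := by
    simp only [← Finset.mul_sum, stdSimplex_sum, mul_one]
  have hle : ∀ F : Fin k × ZMod 2 → Fin k × ZMod 2 → ℝ, (∀ p q, F p q ≤ 1) →
      ∑ p, ∑ q, roundMessage m ε pointMass u n (chars t) p *
      roundMessage m ε pointMass v n (chars t) q * F p q ≤ 1 := fun F hF => by
    rw [← hsum]
    exact Finset.sum_le_sum fun p _ => Finset.sum_le_sum fun q _ => mul_le_of_le_one_right
      (mul_nonneg (stdSimplex_nonneg _ _) (stdSimplex_nonneg _ _)) (hF p q)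
  by_cases H : m ≤ strikes m (chars t) n ∨ OffPath j u v (walk (chars t) n)
  · have h2 : failurePotential m ε j u v n (walk (chars t) n) (strikes m (chars t) n) = 1 :=
      if_pos H
    rw [h2]
    refine hle _ fun p q => ?_
    split_ifs <;> norm_num
  · refine le_trans (le_of_eq ?_) (failurePotential_nonneg _ _ _)
    push Not at H
    refine Finset.sum_eq_zero fun p _ => Finset.sum_eq_zero fun q _ => ?_
    have hc : Consistent u.1 v.1 j (walk (chars t) n) := by_contra fun h' => H.2 ⟨j.2, h'⟩
    have hout : (noisyJump n k m ε).outA u (Fin.snoc (Fin.snoc t p : Fin (2 * n + 1) → _) q :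
        Fin (2 * n + 2) → Fin k × ZMod 2) = p.2 + q.2 := by
      have e1 : (Fin.snoc (Fin.snoc t p : Fin (2 * n + 1) → _) q :
        Fin (2 * n + 2) → Fin k × ZMod 2) ⟨2 * n, by omega⟩ = p :=
        (Fin.snoc_castSucc (α := fun _ => Fin k × ZMod 2) q _ (Fin.last (2 * n))).trans
          (Fin.snoc_last (α := fun _ => Fin k × ZMod 2) _ _)
      have e2 : (Fin.snoc (Fin.snoc t p : Fin (2 * n + 1) → _) q :
        Fin (2 * n + 2) → Fin k × ZMod 2) ⟨2 * n + 1, by omega⟩ = q :=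
        Fin.snoc_last (α := fun _ => Fin k × ZMod 2) _ _
      simp only [noisyJump]
      rw [e1, e2, chars_snoc, chars_snoc, strikes_update _ _ _ _ _ (by omega),
        strikes_update _ _ _ _ _ (by omega), if_neg (by omega)]
    rw [hout]
    have hm : ∀ (w : Input n k) (p : Fin k × ZMod 2), roundMessage m ε pointMass w n (chars t) p
        = uniform (Fin k) p.1 * if p.2 = w.2 (walk (chars t) n) then 1 else 0 := by
      intro w p
      unfold roundMessage
      rw [if_neg (by omega), dif_neg (lt_irrefl n), prodSimplex_apply, pointMass_apply]
    rw [hm, hm]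
    by_cases hp : p.2 = u.2 (walk (chars t) n)
    · by_cases hq : q.2 = v.2 (walk (chars t) n)
      · have ht : p.2 + q.2 = target u v := by
          rw [hp, hq]
          exact h.add_eq_target _ hc
        rw [if_pos ht, mul_zero]
      · rw [if_neg hq, mul_zero, mul_zero, zero_mul]
    · rw [if_neg hp, mul_zero, zero_mul, zero_mul]

end

end PointerJumping

namespace PointerJumping

/-! ### Information revealed by the noisy jumping protocol -/

theorem klDiv_le_logb {α : Type} [Fintype α] (p q : stdSimplex ℝ α) {C : ℝ} (hC : 0 < C)
    (h : ∀ a, p a ≤ C * q a) : MessageScheme.klDiv p q ≤ Real.logb 2 C := by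
  calc MessageScheme.klDiv p q ≤ ∑ a, p a * Real.logb 2 C := by
        refine Finset.sum_le_sum fun a _ => ?_
        rcases (stdSimplex_nonneg p a).eq_or_lt with h0 | h0
        · rw [← h0, zero_mul, zero_mul]
        · have hq : 0 < q a := pos_of_mul_pos_right (h0.trans_le (h a)) hC.le
          refine mul_le_mul_of_nonneg_left ?_ h0.le
          exact Real.logb_le_logb_of_le one_lt_two (by positivity) ((div_le_iff₀ hq).2 (h a))
    _ = Real.logb 2 C := by rw [← Finset.sum_mul, stdSimplex_sum, one_mul]

variable {n k : ℕ} [NeZero k] {m : ℕ} {ε : unitInterval}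

theorem noisy_pos (hε : 0 < (ε : ℝ)) (c a : Fin k) : 0 < noisy ε c a := by
  have hk : 0 < (k : ℝ) := Nat.cast_pos.2 (NeZero.pos k)
  have h2 : 0 ≤ 1 - (ε : ℝ) := sub_nonneg.2 ε.2.2
  rw [noisy_apply]
  positivity

/-- The players have different values at the node `z`. -/
def Disagree (u v : Input n k) (s : ℕ) (z : Fin s → Fin k) : Prop :=
  ∃ hs : s < n, u.1 ⟨⟨s, hs⟩, z⟩ ≠ v.1 ⟨⟨s, hs⟩, z⟩

open Classical in
/-- The expected number of rounds in which the players are at a node where their values differ. -/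
noncomputable def disagreements (m : ℕ) (ε : unitInterval) (u v : Input n k) : ℝ :=
  ∑ s ∈ Finset.range n, expect m ε u v s fun z c => if c < m ∧ Disagree u v s z then 1 else 0

open Classical in
/-- A player predicts the message of the other one by a message made from the own input. The
prediction is perfect where the two functions agree. -/
theorem klDiv_roundMessage_le (hε : 0 < (ε : ℝ)) (u v : Input n k) {s : ℕ} (hs : s < n)
    (ω : ℕ → Fin k) :
    MessageScheme.klDiv (roundMessage m ε pointMass u s ω)
      (roundMessage m ε (fun _ => uniform (ZMod 2)) v s ω)
      ≤ Real.logb 2 (k / ε) * if strikes m ω s < m ∧ Disagree u v s (walk ω s) then 1 else 0 := by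
  have hk : 0 < (k : ℝ) := Nat.cast_pos.2 (NeZero.pos k)
  split_ifs with h
  · rw [mul_one]
    refine klDiv_le_logb _ _ (by positivity) fun a => ?_
    unfold roundMessage
    rw [if_neg (by omega), if_neg (by omega), dif_pos hs, dif_pos hs, prodSimplex_apply,
      prodSimplex_apply, ← mul_assoc]
    refine mul_le_mul_of_nonneg_right ?_ (stdSimplex_nonneg _ _)
    have h1 : noisy ε (u.1 ⟨⟨s, hs⟩, walk ω s⟩) a.1 ≤ 1 := by
      rw [← stdSimplex_sum (noisy ε (u.1 ⟨⟨s, hs⟩, walk ω s⟩))]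
      exact Finset.single_le_sum (fun b _ => stdSimplex_nonneg (noisy ε _) b) (Finset.mem_univ _)
    have h2 : (ε : ℝ) / k ≤ noisy ε (v.1 ⟨⟨s, hs⟩, walk ω s⟩) a.1 := by
      have h2 : 0 ≤ 1 - (ε : ℝ) := sub_nonneg.2 ε.2.2
      rw [noisy_apply]
      exact le_add_of_nonneg_left (by positivity)
    calc _ ≤ (1 : ℝ) := h1
      _ = k / ε * (ε / k) := by field_simp
      _ ≤ _ := by gcongr
  · rw [mul_zero]
    refine le_of_eq ?_
    have : roundMessage m ε pointMass u s ω
        = roundMessage m ε (fun _ => uniform (ZMod 2)) v s ω := by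
      unfold roundMessage
      split_ifs with h1
      · rfl
      · have h2 : u.1 ⟨⟨s, hs⟩, walk ω s⟩ = v.1 ⟨⟨s, hs⟩, walk ω s⟩ :=
          by_contra fun h3 => h ⟨by omega, hs, h3⟩
        rw [h2]
    rw [this, MessageScheme.klDiv_self]

theorem klDiv_roundMessage_last_le (u v : Input n k) (ω : ℕ → Fin k) :
    MessageScheme.klDiv (roundMessage m ε pointMass u n ω)
      (roundMessage m ε (fun _ => uniform (ZMod 2)) v n ω) ≤ 1 := by
  have h2 : Real.logb 2 2 = 1 := Real.logb_self_eq_one one_lt_two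
  rw [← h2]
  refine klDiv_le_logb _ _ two_pos fun a => ?_
  unfold roundMessage
  rw [dif_neg (lt_irrefl n), dif_neg (lt_irrefl n)]
  split_ifs
  · linarith [stdSimplex_nonneg (prodSimplex (uniform (Fin k)) (pointMass (0 : ZMod 2))) a]
  · rw [prodSimplex_apply, prodSimplex_apply, mul_left_comm]
    refine mul_le_mul_of_nonneg_left ?_ (stdSimplex_nonneg _ _)
    rw [pointMass_apply, uniform_apply, ZMod.card]
    split_ifs <;> norm_num

theorem roundMessage_ne_zero (hε : 0 < (ε : ℝ)) (u v : Input n k) (r : ℕ) (ω : ℕ → Fin k)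
    (p : Fin k × ZMod 2) (h : roundMessage m ε pointMass u r ω p ≠ 0) :
    roundMessage m ε (fun _ => uniform (ZMod 2)) v r ω p ≠ 0 := by
  unfold roundMessage at h ⊢
  split_ifs at h ⊢
  · exact h
  · rw [prodSimplex_apply] at h ⊢
    exact mul_ne_zero (noisy_pos hε _ _).ne' (right_ne_zero_of_mul h)
  · rw [prodSimplex_apply] at h ⊢
    refine mul_ne_zero (left_ne_zero_of_mul h) ?_
    rw [uniform_apply, ZMod.card]
    norm_num

omit [NeZero k] in
theorem disagree_comm {u v : Input n k} {s : ℕ} {z : Fin s → Fin k} :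
    Disagree v u s z ↔ Disagree u v s z := by
  simp only [Disagree, ne_comm]

/-- Alice's message of round `s` and Bob's see the same history of the rounds before. -/
theorem sum_prob_odd (u v : Input n k) (s : ℕ) (F : (ℕ → Fin k) → ℝ)
    (hF : ∀ ω a, F (Function.update ω (2 * s) a) = F ω) :
    ∑ h, (noisyJump n k m ε).prob u v (2 * s + 1) h * F (chars h)
      = ∑ h, (noisyJump n k m ε).prob u v (2 * s) h * F (chars h) := by
  rw [sum_snoc]
  refine Finset.sum_congr rfl fun h _ => ?_
  simp only [MessageScheme.prob_snoc, chars_snoc, hF]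
  rw [← Finset.sum_mul, ← Finset.mul_sum, MessageScheme.sum_kernel, mul_one]

/-- The information cost is governed by the number of disagreements. -/
theorem IC_noisyJump_le (hε : 0 < (ε : ℝ)) (mu : Input n k × Input n k → ℝ) (hmu : ∀ i, 0 ≤ mu i) :
    (noisyJump n k m ε).toClassical.IC mu
      ≤ ∑ u, ∑ v, mu (u, v) * (2 * (Real.logb 2 (k / ε) * disagreements m ε u v + 1)) := by
  classical
  refine ((noisyJump n k m ε).IC_toClassical_le mu hmu
    (fun v i h => roundMessage m ε (fun _ => uniform (ZMod 2)) v (i / 2) (chars h))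
    (fun u i h => roundMessage m ε (fun _ => uniform (ZMod 2)) u (i / 2) (chars h))
    (fun u v i h p => roundMessage_ne_zero hε u v _ _ p)
    (fun u v i h p => roundMessage_ne_zero hε v u _ _ p)).trans ?_
  refine Finset.sum_le_sum fun u _ => Finset.sum_le_sum fun v _ =>
    mul_le_mul_of_nonneg_left ?_ (hmu _)
  have h1 : ∀ s : ℕ, 2 * s / 2 = s := fun s => by omega
  have h2 : ∀ s : ℕ, (2 * s + 1) / 2 = s := fun s => by omega
  have hodd : ∀ s, ∑ h, (noisyJump n k m ε).prob u v (2 * s + 1) h *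
        MessageScheme.klDiv (roundMessage m ε pointMass v s (chars h))
          (roundMessage m ε (fun _ => uniform (ZMod 2)) u s (chars h))
      = ∑ h, (noisyJump n k m ε).prob u v (2 * s) h *
        MessageScheme.klDiv (roundMessage m ε pointMass v s (chars h))
          (roundMessage m ε (fun _ => uniform (ZMod 2)) u s (chars h)) := fun s =>
    sum_prob_odd u v s (fun ω => MessageScheme.klDiv (roundMessage m ε pointMass v s ω)
          (roundMessage m ε (fun _ => uniform (ZMod 2)) u s ω)) fun ω a => by
      rw [roundMessage_update _ _ _ _ _ _ le_rfl, roundMessage_update _ _ _ _ _ _ le_rfl]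
  have key : ∀ s < n + 1,
      (∑ h, (noisyJump n k m ε).prob u v (2 * s) h *
        MessageScheme.klDiv (roundMessage m ε pointMass u s (chars h))
          (roundMessage m ε (fun _ => uniform (ZMod 2)) v s (chars h))
      + ∑ h, (noisyJump n k m ε).prob u v (2 * s + 1) h *
        MessageScheme.klDiv (roundMessage m ε pointMass v s (chars h))
          (roundMessage m ε (fun _ => uniform (ZMod 2)) u s (chars h)))
      ≤ if s < n then 2 * (Real.logb 2 (k / ε) * expect m ε u v s fun z c =>
          if c < m ∧ Disagree u v s z then 1 else 0) else 2 := by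
    intro s hs
    rw [hodd]
    have hP := MessageScheme.prob_nonneg (noisyJump n k m ε) u v (2 * s)
    split_ifs with hsn
    · rw [← expect_const_mul, two_mul (expect m ε u v s _)]
      refine add_le_add (Finset.sum_le_sum fun h _ => mul_le_mul_of_nonneg_left ?_ (hP h))
        (Finset.sum_le_sum fun h _ => mul_le_mul_of_nonneg_left ?_ (hP h))
      · exact klDiv_roundMessage_le hε u v hsn _
      · refine (klDiv_roundMessage_le hε v u hsn _).trans (le_of_eq ?_)
        simp only [disagree_comm]
    · obtain rfl : s = n := by omega
      have h3 := (noisyJump s k m ε).sum_prob u v (2 * s)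
      have h4 : (2 : ℝ) = ∑ h, (noisyJump s k m ε).prob u v (2 * s) h * 1
          + ∑ h, (noisyJump s k m ε).prob u v (2 * s) h * 1 := by
        simp only [mul_one, h3]
        norm_num
      rw [h4]
      exact add_le_add
        (Finset.sum_le_sum fun h _ => mul_le_mul_of_nonneg_left
          (klDiv_roundMessage_last_le u v _) (hP h))
        (Finset.sum_le_sum fun h _ => mul_le_mul_of_nonneg_left
          (klDiv_roundMessage_last_le v u _) (hP h))
  refine le_trans (le_of_eq ?_) ((Finset.sum_le_sum fun s hs =>
    key s (Finset.mem_range.1 hs)).trans (le_of_eq ?_))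
  · refine Finset.sum_congr rfl fun s _ => ?_
    simp only [noisyJump, h1, h2]
  · rw [Finset.sum_range_succ, if_neg (lt_irrefl n), mul_add, mul_one, disagreements,
      Finset.mul_sum, Finset.mul_sum]
    congr 1
    exact Finset.sum_congr rfl fun s hs => if_pos (Finset.mem_range.1 hs)

/-! ### Resampling a value at an inconsistent node -/

/-- The input with the value at the node `ν` replaced by `t`. -/
def setValue (u : Input n k) (ν : Node n k) (t : Fin k) : Input n k :=
  (Function.update u.1 ν t, u.2)

omit [NeZero k] in
theorem setValue_of_ne (u : Input n k) {ν z : Node n k} (t : Fin k) (h : z ≠ ν) :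
    (setValue u ν t).1 z = u.1 z := Function.update_of_ne h _ _

/-- If a weight does not depend on the value of `u` at `ν`, that value is uniformly distributed. -/
theorem sum_mul_value (ν : Node n k) (W : Input n k → ℝ) (hW : ∀ u t, W (setValue u ν t) = W u)
    (H : Fin k → ℝ) :
    ∑ u : Input n k, W u * H (u.1 ν) = ∑ u : Input n k, W u * ((1 / (k : ℝ)) * ∑ t, H t) := by
  have hk : (k : ℝ) ≠ 0 := NeZero.ne _
  have shift : ∀ t : Fin k, ∑ u : Input n k, W u * H (u.1 ν)
      = ∑ u : Input n k, W u * H (u.1 ν + t) := by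
    intro t
    let e : Input n k ≃ Input n k :=
      { toFun := fun u => setValue u ν (u.1 ν + t)
        invFun := fun u => setValue u ν (u.1 ν - t)
        left_inv := fun u => by simp [setValue]
        right_inv := fun u => by simp [setValue] }
    rw [← e.sum_comp]
    refine Finset.sum_congr rfl fun u _ => ?_
    show W (setValue u ν (u.1 ν + t)) * H ((setValue u ν (u.1 ν + t)).1 ν) = _
    rw [hW]
    simp [setValue]
  have h1 : ∑ t : Fin k, ∑ u : Input n k, W u * H (u.1 ν)
      = ∑ t : Fin k, ∑ u : Input n k, W u * H (u.1 ν + t) :=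
    Finset.sum_congr rfl fun t _ => shift t
  rw [Finset.sum_const, Finset.card_univ, Fintype.card_fin, nsmul_eq_mul, Finset.sum_comm] at h1
  have h2 : ∀ u : Input n k, ∑ t, W u * H (u.1 ν + t) = W u * ∑ t, H t := fun u => by
    rw [← Finset.mul_sum]
    exact congrArg (W u * ·) (Equiv.sum_comp (Equiv.addLeft (u.1 ν)) H)
  simp only [h2] at h1
  simp only [mul_left_comm _ (1 / (k : ℝ))]
  rw [← Finset.mul_sum, ← h1]
  field_simp

omit [NeZero k] in
theorem consistent_setValue {u v : Input n k} {j : Fin n} {ν : Node n k} (hν : (j : ℕ) < ν.1)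
    (t : Fin k) {r : ℕ} (z : Fin r → Fin k) :
    Consistent (setValue u ν t).1 v.1 j z ↔ Consistent u.1 v.1 j z := by
  have h1 : ∀ w : Fin j → Fin k, (setValue u ν t).1 ⟨j, w⟩ = u.1 ⟨j, w⟩ := fun w =>
    setValue_of_ne u t fun h => by
      rw [← h] at hν
      exact lt_irrefl _ hν
  unfold Consistent
  simp only [h1]

omit [NeZero k] in
/-- The hard distributions do not see the values at inconsistent nodes. -/
theorem hard_setValue {u v : Input n k} {j : Fin n} {ν : Node n k} (hν : OffPath j u v ν.2)
    (t : Fin k) : Hard j (setValue u ν t) v ↔ Hard j u v := by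
  have h1 : ∀ z : Node n k, z.1 < j → (setValue u ν t).1 z = u.1 z := fun z hz =>
    setValue_of_ne u t fun h => by
      rw [h] at hz
      exact absurd hν.1 (by simpa using hz.le)
  have h2 : ∀ z : Node n k, Consistent u.1 v.1 j z.2 → (setValue u ν t).1 z = u.1 z := fun z hz =>
    setValue_of_ne u t fun h => by
      rw [h] at hz
      exact hν.2 hz
  unfold Hard AgreeBelow Event0 Event1
  simp only [consistent_setValue hν.1]
  refine and_congr (forall₂_congr fun z hz => by rw [h1 z hz]) (or_congr
    (and_congr (forall₂_congr fun z hz => by rw [h2 z hz]) Iff.rfl)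
    (and_congr (forall₂_congr fun z hz => by rw [h2 z hz]) Iff.rfl))

omit [NeZero k] in
theorem offPath_setValue {u v : Input n k} {j : Fin n} {ν : Node n k} (hν : (j : ℕ) < ν.1)
    (t : Fin k) {r : ℕ} (z : Fin r → Fin k) :
    OffPath j (setValue u ν t) v z ↔ OffPath j u v z := by
  unfold OffPath
  rw [consistent_setValue hν]

theorem roundMessage_setValue (last : ZMod 2 → stdSimplex ℝ (ZMod 2)) (u : Input n k)
    (ν : Node n k) (t : Fin k) {r : ℕ} (hr : r < ν.1) (ω : ℕ → Fin k) :
    roundMessage m ε last (setValue u ν t) r ω = roundMessage m ε last u r ω := by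
  unfold roundMessage
  split_ifs with h1 h2
  · rfl
  · rw [setValue_of_ne]
    intro h
    rw [← h] at hr
    exact lt_irrefl _ hr
  · rfl

theorem prob_setValue (u v : Input n k) (ν : Node n k) (t : Fin k) :
    ∀ (i : ℕ) (_ : i ≤ 2 * ν.1) (h : Fin i → Fin k × ZMod 2),
      (noisyJump n k m ε).prob (setValue u ν t) v i h = (noisyJump n k m ε).prob u v i h
  | 0, _, _ => rfl
  | i + 1, hi, h => by
    induction h using Fin.snocCases with | snoc h p =>
    rw [MessageScheme.prob_snoc, MessageScheme.prob_snoc, prob_setValue u v ν t i (by omega)]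
    congr 1
    unfold MessageScheme.kernel
    split_ifs
    · show roundMessage m ε pointMass (setValue u ν t) (i / 2) (chars h) p = _
      rw [roundMessage_setValue _ _ _ _ (by omega)]
      rfl
    · rfl

end PointerJumping

namespace PointerJumping

variable {n k : ℕ} [NeZero k] {m : ℕ} {ε : unitInterval}

/-! ### Average number of disagreements -/

open Classical in
/-- Sum over the hard pairs of inputs of the expectation of `G` after `s` rounds. -/
noncomputable def hardSum (m : ℕ) (ε : unitInterval) (j : Fin n) (s : ℕ)
    (G : Input n k → Input n k → (Fin s → Fin k) → ℕ → ℝ) : ℝ :=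
  ∑ v : Input n k, ∑ u : Input n k, if Hard j u v then expect m ε u v s (G u v) else 0

open Classical in
/-- The number of hard pairs of inputs. -/
noncomputable def hardCount (k : ℕ) (j : Fin n) : ℝ :=
  ∑ v : Input n k, ∑ u : Input n k, if Hard j u v then 1 else 0

theorem hardSum_mono {j : Fin n} {s : ℕ} {G G' : Input n k → Input n k → (Fin s → Fin k) → ℕ → ℝ}
    (h : ∀ u v z c, Hard j u v → G u v z c ≤ G' u v z c) :
    hardSum m ε j s G ≤ hardSum m ε j s G' := by
  refine Finset.sum_le_sum fun v _ => Finset.sum_le_sum fun u _ => ?_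
  split_ifs with H
  · exact expect_mono fun z c => h u v z c H
  · exact le_rfl

theorem hardSum_const (j : Fin n) (s : ℕ) (a : ℝ) :
    hardSum m ε j s (fun (_ _ : Input n k) _ _ => a) = a * hardCount k j := by
  simp only [hardSum, expect_const, hardCount, Finset.mul_sum, mul_ite, mul_one, mul_zero]

theorem hardSum_add (j : Fin n) (s : ℕ)
    (G G' : Input n k → Input n k → (Fin s → Fin k) → ℕ → ℝ) :
    hardSum m ε j s (fun (u v : Input n k) z c => G u v z c + G' u v z c)
      = hardSum m ε j s G + hardSum m ε j s G' := by
  simp only [hardSum, ← Finset.sum_add_distrib]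
  refine Finset.sum_congr rfl fun v _ => Finset.sum_congr rfl fun u _ => ?_
  split_ifs
  · exact expect_add _ _ _ _ _ _ _
  · simp

theorem hardSum_succ (j : Fin n) {s : ℕ} (hs : s < n)
    (G : Input n k → Input n k → (Fin (s + 1) → Fin k) → ℕ → ℝ) :
    hardSum m ε j (s + 1) G = hardSum m ε j s fun u v z c =>
      if m ≤ c then
        ∑ a, uniform (Fin k) a * ∑ b, uniform (Fin k) b * G u v (Fin.snoc z (a + b)) c
      else
        ∑ a, noisy ε (u.1 ⟨⟨s, hs⟩, z⟩) a * ∑ b, noisy ε (v.1 ⟨⟨s, hs⟩, z⟩) b *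
          G u v (Fin.snoc z (a + b)) (if a = b then 0 else c + 1) := by
  simp only [hardSum, expect_succ _ _ _ _ hs]

open Classical in
/-- At a node off the path Alice's value, hence her message, is uniform given all the rest. -/
theorem hardSum_offPath (j : Fin n) {s : ℕ} (hs : s < n) (hsj : (j : ℕ) < s)
    (g : Input n k → (Fin s → Fin k) → ℕ → Fin k → ℝ) :
    hardSum m ε j s (fun (u v : Input n k) z c => if OffPath j u v z then
        ∑ a, noisy ε (u.1 ⟨⟨s, hs⟩, z⟩) a * g v z c a else 0)
      = hardSum m ε j s (fun (u v : Input n k) z c => if OffPath j u v z then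
        (1 / (k : ℝ)) * ∑ a, g v z c a else 0) := by
  unfold hardSum expect
  refine Finset.sum_congr rfl fun v _ => ?_
  have swap : ∀ F : Input n k → (Fin (2 * s) → Fin k × ZMod 2) → ℝ,
      (∑ u, if Hard j u v then ∑ h, F u h else 0) = ∑ h, ∑ u, if Hard j u v then F u h else 0 := by
    intro F
    rw [Finset.sum_comm]
    refine Finset.sum_congr rfl fun u _ => ?_
    rw [Finset.sum_ite_irrel, Finset.sum_const_zero]
  rw [swap, swap]
  refine Finset.sum_congr rfl fun h _ => ?_
  set z := walk (chars h) s
  set c := strikes m (chars h) s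
  let ν : Node n k := ⟨⟨s, hs⟩, z⟩
  let W : Input n k → ℝ := fun u => if OffPath j u v z ∧ Hard j u v then
    (noisyJump n k m ε).prob u v (2 * s) h else 0
  have hW : ∀ u t, W (setValue u ν t) = W u := by
    intro u t
    have h1 : (noisyJump n k m ε).prob (setValue u ν t) v (2 * s) h
        = (noisyJump n k m ε).prob u v (2 * s) h := prob_setValue u v ν t (2 * s) le_rfl h
    have h2 : OffPath j (setValue u ν t) v z ∧ Hard j (setValue u ν t) v
        ↔ OffPath j u v z ∧ Hard j u v := by
      rw [offPath_setValue (ν := ν) hsj]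
      exact and_congr_right fun h3 => hard_setValue (ν := ν) h3 t
    simp only [W, h1, h2]
  have key := sum_mul_value ν W hW fun t => ∑ a, noisy ε t a * g v z c a
  have avg : (1 / (k : ℝ)) * ∑ t : Fin k, ∑ a, noisy ε t a * g v z c a
      = (1 / (k : ℝ)) * ∑ a, g v z c a := by
    rw [Finset.sum_comm]
    congr 1
    refine Finset.sum_congr rfl fun a _ => ?_
    have hk : (k : ℝ) ≠ 0 := NeZero.ne _
    rw [← Finset.sum_mul]
    simp only [noisy_apply, Finset.sum_add_distrib, ← Finset.mul_sum, Finset.sum_ite_eq,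
      Finset.mem_univ, if_true, Finset.sum_const, Finset.card_univ, Fintype.card_fin, nsmul_eq_mul]
    field_simp
    ring
  simp only [avg] at key
  have conv : ∀ x : Input n k → ℝ, (∑ u, if Hard j u v then
      (noisyJump n k m ε).prob u v (2 * s) h * (if OffPath j u v z then x u else 0) else 0)
      = ∑ u, W u * x u := by
    intro x
    refine Finset.sum_congr rfl fun u _ => ?_
    simp only [W]
    split_ifs <;> simp_all
  rw [conv, conv]
  exact key

/-- `φ` bounds the expected number of further rounds until abortion, in terms of the current number
of strikes, when each round is a disagreement with probability `1 - 1 / k`. For `k = 1` there is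
nothing to bound, as no jump can be wrong. -/
structure RoundsBound (k m : ℕ) (φ : ℕ → ℝ) (B : ℝ) : Prop where
  nonneg : ∀ c, 0 ≤ φ c
  le : ∀ c, φ c ≤ B
  eq_zero : ∀ c, m ≤ c → φ c = 0
  step : k ≠ 1 → ∀ c < m, (1 / (k : ℝ)) * φ 0 + (1 - 1 / (k : ℝ)) * φ (c + 1) ≤ φ c - 1

open Classical in
theorem hardSum_potential_succ {φ : ℕ → ℝ} {B : ℝ} (hφ : RoundsBound k m φ B) (j : Fin n) {s : ℕ}
    (hs : s < n) (hsj : (j : ℕ) < s) :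
    hardSum m ε j (s + 1) (fun (u v : Input n k) z c => if OffPath j u v z then φ c else 0)
      + hardSum m ε j s (fun (u v : Input n k) z c => if c < m ∧ OffPath j u v z then 1 else 0)
      ≤ hardSum m ε j s (fun (u v : Input n k) z c => if OffPath j u v z then φ c else 0) := by
  have hk : (k : ℝ) ≠ 0 := NeZero.ne _
  let g : Input n k → (Fin s → Fin k) → ℕ → Fin k → ℝ := fun v z c a =>
    if m ≤ c then 0 else
      ∑ b, noisy ε (v.1 ⟨⟨s, hs⟩, z⟩) b * φ (if a = b then 0 else c + 1)
  have h1 : hardSum m ε j (s + 1) (fun (u v : Input n k) z c => if OffPath j u v z then φ c else 0)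
      = hardSum m ε j s (fun (u v : Input n k) z c => if OffPath j u v z then
        ∑ a, noisy ε (u.1 ⟨⟨s, hs⟩, z⟩) a * g v z c a else 0) := by
    rw [hardSum_succ _ hs]
    congr 1
    funext u v z c
    simp only [offPath_snoc_of_lt hsj, g]
    split_ifs with hc ho ho
    · simp [hφ.eq_zero c hc]
    · simp
    · rfl
    · simp
  rw [h1, hardSum_offPath j hs hsj, ← hardSum_add]
  refine hardSum_mono fun u v z c _ => ?_
  by_cases ho : OffPath j u v z
  · rw [if_pos ho, if_pos ho]
    simp only [g]
    by_cases hc : m ≤ c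
    · rw [if_neg (by omega)]
      simp [hc, hφ.nonneg c]
    · rw [if_pos ⟨by omega, ho⟩]
      simp only [hc, if_false]
      rw [Finset.sum_comm]
      have h2 : ∀ b : Fin k, ∑ a, noisy ε (v.1 ⟨⟨s, hs⟩, z⟩) b * φ (if a = b then 0 else c + 1)
          = noisy ε (v.1 ⟨⟨s, hs⟩, z⟩) b * (φ 0 + (k - 1) * φ (c + 1)) := by
        intro b
        rw [← Finset.mul_sum]
        congr 1
        have : ∀ a : Fin k, φ (if a = b then 0 else c + 1)
            = (if a = b then φ 0 - φ (c + 1) else 0) + φ (c + 1) := fun a => by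
          split_ifs <;> ring
        simp only [this, Finset.sum_add_distrib, Finset.sum_ite_eq', Finset.mem_univ, if_true,
          Finset.sum_const, Finset.card_univ, Fintype.card_fin, nsmul_eq_mul]
        ring
      simp only [h2, ← Finset.sum_mul, stdSimplex_sum, one_mul]
      have hk1 : k ≠ 1 := by
        rintro rfl
        exact ho.2 ⟨hsj, Subsingleton.elim _ _⟩
      have h3 := hφ.step hk1 c (by omega)
      have h4 : 1 / (k : ℝ) * (φ 0 + (k - 1) * φ (c + 1))
          = (1 / (k : ℝ)) * φ 0 + (1 - 1 / (k : ℝ)) * φ (c + 1) := by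
        field_simp
      rw [h4]
      linarith
  · rw [if_neg ho, if_neg ho, if_neg fun h => ho h.2, add_zero]

open Classical in
theorem hardSum_potential_level {φ : ℕ → ℝ} {B : ℝ} (hφ : RoundsBound k m φ B) (j : Fin n) :
    hardSum m ε j (j + 1) (fun (u v : Input n k) z c => if OffPath j u v z then φ c else 0)
      ≤ 2 * ε * B * hardCount k j := by
  have hε := ε.2.1
  have hB : 0 ≤ B := (hφ.nonneg 0).trans (hφ.le 0)
  rw [hardSum_succ _ j.2, ← hardSum_const (m := m) (ε := ε) j j (2 * ε * B)]
  refine hardSum_mono fun u v z c _ => ?_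
  split_ifs with hc
  · simp only [hφ.eq_zero c hc, ite_self, mul_zero, Finset.sum_const_zero]
    positivity
  · refine (sum_noisy_noisy_mul_le _ _ (fun a b =>
      if OffPath j u v (Fin.snoc z (a + b) : Fin (j + 1) → Fin k) then
        φ (if a = b then 0 else c + 1) else 0) (B := B) (fun a b => ?_) fun a b => ?_).trans ?_
    · split_ifs
      exacts [hφ.nonneg _, hφ.nonneg _, le_rfl]
    · split_ifs
      exacts [hφ.le _, hφ.le _, hB]
    · rw [if_neg fun h => h.2 ((consistent_snoc_self z _).2 rfl), zero_add]

open Classical in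
theorem hardSum_disagreements_le {φ : ℕ → ℝ} {B : ℝ} (hφ : RoundsBound k m φ B) (j : Fin n) :
    ∑ s ∈ Finset.range n, hardSum m ε j s
      (fun (u v : Input n k) z c => if c < m ∧ Disagree u v s z then 1 else 0)
      ≤ (1 + 2 * ε * B) * hardCount k j := by
  have hcount : 0 ≤ hardCount k j := Finset.sum_nonneg fun v _ => Finset.sum_nonneg fun u _ => by
    split_ifs
    exacts [zero_le_one, le_rfl]
  have before : ∀ s < (j : ℕ), hardSum m ε j s
      (fun (u v : Input n k) z c => if c < m ∧ Disagree u v s z then 1 else 0) ≤ 0 := by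
    intro s hs
    refine (hardSum_mono (G' := fun _ _ _ _ => 0) fun u v z c h => ?_).trans
      (by rw [hardSum_const, zero_mul])
    rw [if_neg]
    rintro ⟨-, hn, hne⟩
    exact hne (h.eq_of_not_offPath hn hs.ne z (not_offPath_of_le hs.le z))
  have level : hardSum m ε j j
      (fun (u v : Input n k) z c => if c < m ∧ Disagree u v j z then 1 else 0)
      ≤ hardCount k j := by
    rw [← one_mul (hardCount k j), ← hardSum_const (m := m) (ε := ε) j j 1]
    refine hardSum_mono fun u v z c h => ?_
    split_ifs <;> norm_num
  have after : ∀ s, (j : ℕ) < s → s < n → hardSum m ε j s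
      (fun (u v : Input n k) z c => if c < m ∧ Disagree u v s z then 1 else 0)
      ≤ hardSum m ε j s (fun (u v : Input n k) z c => if c < m ∧ OffPath j u v z then 1 else 0) := by
    intro s hs hn
    refine hardSum_mono fun u v z c h => ?_
    by_cases hd : c < m ∧ Disagree u v s z
    · have ho : OffPath j u v z := by
        by_contra ho
        obtain ⟨-, hn, hne⟩ := hd
        exact hne (h.eq_of_not_offPath hn hs.ne' z ho)
      rw [if_pos hd, if_pos ⟨hd.1, ho⟩]
    · rw [if_neg hd]
      split_ifs <;> norm_num
  have total : ∀ N, (j : ℕ) + 1 ≤ N → N ≤ n → ∑ s ∈ Finset.range N, hardSum m ε j s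
      (fun (u v : Input n k) z c => if c < m ∧ Disagree u v s z then 1 else 0)
      + hardSum m ε j N (fun (u v : Input n k) z c => if OffPath j u v z then φ c else 0)
      ≤ (1 + 2 * ε * B) * hardCount k j := by
    intro N hN
    induction N, hN using Nat.le_induction with
    | base =>
      intro _
      rw [Finset.sum_range_succ]
      have h1 := Finset.sum_nonpos fun s hs => before s (Finset.mem_range.1 hs)
      have h2 := hardSum_potential_level (ε := ε) hφ j
      linarith
    | succ s hs ih =>
      intro hn
      rw [Finset.sum_range_succ]
      have h1 := ih (by omega)
      have h2 := after s (by omega) (by omega)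
      have h3 := hardSum_potential_succ (ε := ε) hφ j (s := s) (by omega) (by omega)
      linarith
  have h1 := total n j.2 le_rfl
  have h2 : 0 ≤ hardSum m ε j n
      (fun (u v : Input n k) z c => if OffPath j u v z then φ c else 0) := by
    refine (le_of_eq (by rw [hardSum_const, zero_mul])).trans
      (hardSum_mono (G := fun _ _ _ _ => 0) fun u v z c h => ?_)
    split_ifs
    exacts [hφ.nonneg c, le_rfl]
  linarith

open Classical in
/-- Off the path a player's message is uniform and independent of the other one's, so that the
protocol is soon aborted. -/
theorem sum_disagreements_le {φ : ℕ → ℝ} {B : ℝ} (hφ : RoundsBound k m φ B) (j : Fin n) :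
    (∑ u : Input n k, ∑ v : Input n k, if Hard j u v then disagreements m ε u v else 0)
      ≤ (1 + 2 * ε * B) * ∑ u : Input n k, ∑ v : Input n k, if Hard j u v then 1 else 0 := by
  have h1 := hardSum_disagreements_le (ε := ε) hφ j
  have h2 : hardCount k j = ∑ u : Input n k, ∑ v : Input n k, if Hard j u v then 1 else 0 :=
    Finset.sum_comm
  rw [← h2]
  refine le_trans (le_of_eq ?_) h1
  unfold disagreements hardSum
  rw [Finset.sum_comm, Finset.sum_comm (s := Finset.range n)]
  refine Finset.sum_congr rfl fun v _ => ?_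
  rw [Finset.sum_comm (s := Finset.range n)]
  refine Finset.sum_congr rfl fun u _ => ?_
  rw [Finset.sum_ite_irrel, Finset.sum_const_zero]

end PointerJumping

namespace PointerJumping

/-! ### The expected number of rounds until a run of disagreements -/

theorem one_sub_inv_pow_inv_le {k : ℕ} (hk : 2 ≤ k) (m : ℕ) :
    ((1 - 1 / (k : ℝ)) ^ m)⁻¹ ≤ (2 : ℝ) ^ (2 * (m : ℝ) / k) := by
  have hk' : (2 : ℝ) ≤ k := by exact_mod_cast hk
  have hk0 : (0 : ℝ) < k := by linarith
  have hx : 1 / (k : ℝ) ≤ 1 / 2 := one_div_le_one_div_of_le two_pos hk'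
  have hp : (0 : ℝ) < 1 - 1 / (k : ℝ) := by linarith
  -- Bernoulli's inequality with exponent `k / 2` gives `(1 - 1 / k) ^ (k / 2) ≥ 1 / 2`.
  have bern : (1 : ℝ) / 2 ≤ (1 - 1 / (k : ℝ)) ^ ((k : ℝ) / 2) := by
    have := one_add_mul_self_le_rpow_one_add (s := -(1 / (k : ℝ))) (by linarith)
      (p := (k : ℝ) / 2) (by linarith)
    have e : 1 + (k : ℝ) / 2 * -(1 / (k : ℝ)) = 1 / 2 := by
      field_simp
      norm_num
    rwa [e, ← sub_eq_add_neg] at this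
  have h1 : ((1 : ℝ) / 2) ^ (2 * (m : ℝ) / k) ≤ (1 - 1 / (k : ℝ)) ^ m := by
    calc ((1 : ℝ) / 2) ^ (2 * (m : ℝ) / k)
        ≤ ((1 - 1 / (k : ℝ)) ^ ((k : ℝ) / 2)) ^ (2 * (m : ℝ) / k) :=
          Real.rpow_le_rpow (by norm_num) bern (by positivity)
      _ = (1 - 1 / (k : ℝ)) ^ m := by
          rw [← Real.rpow_mul hp.le, ← Real.rpow_natCast]
          congr 1
          field_simp
  have h2 : ((2 : ℝ) ^ (2 * (m : ℝ) / k))⁻¹ = ((1 : ℝ) / 2) ^ (2 * (m : ℝ) / k) := by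
    rw [one_div, Real.inv_rpow two_pos.le]
  rw [inv_le_comm₀ (by positivity) (by positivity), h2]
  exact h1

/-- The waiting time for `m` differences in a row, if each round gives equal characters with
probability `1 / k`: with `p = 1 - 1 / k` and `c` differences so far, it is `k (p⁻ᵐ - p⁻ᶜ)`. -/
theorem exists_roundsBound {k : ℕ} (hk : 1 ≤ k) (m : ℕ) :
    ∃ φ, RoundsBound k m φ (m * (2 : ℝ) ^ (2 * (m : ℝ) / k)) := by
  rcases hk.eq_or_lt with rfl | hk2
  · exact ⟨fun _ => 0, fun _ => le_rfl, fun _ => by positivity, fun _ _ => rfl,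
      fun h => absurd rfl h⟩
  have hk' : (2 : ℝ) ≤ k := by exact_mod_cast hk2
  have hx : 1 / (k : ℝ) ≤ 1 / 2 := one_div_le_one_div_of_le two_pos hk'
  have hx0 : 0 < 1 / (k : ℝ) := by positivity
  set p : ℝ := 1 - 1 / (k : ℝ) with hp
  have hp0 : 0 < p := by linarith
  have hp1 : p ≤ 1 := by linarith
  have hq1 : 1 ≤ p⁻¹ := (one_le_inv₀ hp0).2 hp1
  have hmono : ∀ c ≤ m, p⁻¹ ^ c ≤ p⁻¹ ^ m := fun c hc => pow_le_pow_right₀ hq1 hc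
  refine ⟨fun c => if c < m then k * (p⁻¹ ^ m - p⁻¹ ^ c) else 0, fun c => ?_, fun c => ?_,
    fun c hc => if_neg (by omega), fun _ c hc => ?_⟩
  · show 0 ≤ if c < m then k * (p⁻¹ ^ m - p⁻¹ ^ c) else 0
    split_ifs with h
    · have := sub_nonneg.2 (hmono c h.le)
      positivity
    · exact le_rfl
  · show (if c < m then k * (p⁻¹ ^ m - p⁻¹ ^ c) else 0) ≤ _
    split_ifs with h
    · have bern : 1 - m * (1 / (k : ℝ)) ≤ p ^ m := by
        have := one_add_mul_le_pow (a := -(1 / (k : ℝ))) (by linarith) m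
        rw [hp, sub_eq_add_neg, sub_eq_add_neg, ← mul_neg]
        exact this
      have h1 : (k : ℝ) * (p⁻¹ ^ m - 1) ≤ m * p⁻¹ ^ m := by
        have h2 : (1 - m * (1 / (k : ℝ))) * p⁻¹ ^ m ≤ p ^ m * p⁻¹ ^ m :=
          mul_le_mul_of_nonneg_right bern (by positivity)
        rw [← mul_pow, mul_inv_cancel₀ hp0.ne', one_pow] at h2
        have h3 : (k : ℝ) * ((1 - m * (1 / (k : ℝ))) * p⁻¹ ^ m)
            = k * p⁻¹ ^ m - m * p⁻¹ ^ m := by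
          field_simp
        have h4 := mul_le_mul_of_nonneg_left h2 (by positivity : (0 : ℝ) ≤ k)
        rw [h3] at h4
        linarith
      calc (k : ℝ) * (p⁻¹ ^ m - p⁻¹ ^ c) ≤ k * (p⁻¹ ^ m - 1) := by
            gcongr
            exact one_le_pow₀ hq1
        _ ≤ m * p⁻¹ ^ m := h1
        _ ≤ _ := by
            rw [inv_pow]
            exact mul_le_mul_of_nonneg_left (one_sub_inv_pow_inv_le hk2 m) (by positivity)
    · positivity
  · have h1 : (if c + 1 < m then (k : ℝ) * (p⁻¹ ^ m - p⁻¹ ^ (c + 1)) else 0)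
        = k * (p⁻¹ ^ m - p⁻¹ ^ (c + 1)) := by
      split_ifs with h
      · rfl
      · rw [show c + 1 = m by omega, sub_self, mul_zero]
    show (1 / (k : ℝ)) * (if 0 < m then (k : ℝ) * (p⁻¹ ^ m - p⁻¹ ^ 0) else 0)
      + p * (if c + 1 < m then (k : ℝ) * (p⁻¹ ^ m - p⁻¹ ^ (c + 1)) else 0)
      ≤ (if c < m then (k : ℝ) * (p⁻¹ ^ m - p⁻¹ ^ c) else 0) - 1
    rw [h1, if_pos hc, if_pos (by omega), pow_zero, pow_succ]
    have h2 : 1 / (k : ℝ) * ((k : ℝ) * (p⁻¹ ^ m - 1)) = p⁻¹ ^ m - 1 := by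
      field_simp
    have h3 : p * ((k : ℝ) * (p⁻¹ ^ m - p⁻¹ ^ c * p⁻¹)) = k * p * p⁻¹ ^ m - k * p⁻¹ ^ c := by
      rw [mul_sub, mul_sub]
      congr 1
      · ring
      · field_simp
    have h4 : (k : ℝ) * p = k - 1 := by
      rw [hp]
      field_simp
    rw [h2, h3, h4]
    linarith

/-! ### The input distributions as mixtures of hard pairs -/

/-- The distribution `mu` is a mixture of the uniform distributions on the hard pairs;
`c j` is the weight of each single pair that is hard for `j`. -/
structure IsHardMixture {n k : ℕ} (mu : Input n k × Input n k → ℝ) (c : Fin n → ℝ) : Prop where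
  nonneg : ∀ j, 0 ≤ c j
  eq : ∀ i, mu i = ∑ j, c j * (open Classical in if Hard j i.1 i.2 then 1 else 0)
  sum : ∑ i, mu i = 1

theorem IsHardMixture.mu_nonneg {n k : ℕ} {mu : Input n k × Input n k → ℝ} {c : Fin n → ℝ}
    (h : IsHardMixture mu c) (i : Input n k × Input n k) : 0 ≤ mu i := by
  rw [h.eq]
  refine Finset.sum_nonneg fun j _ => mul_nonneg (h.nonneg j) ?_
  split_ifs
  exacts [zero_le_one, le_rfl]

theorem IsHardMixture.exists_hard {n k : ℕ} {mu : Input n k × Input n k → ℝ} {c : Fin n → ℝ}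
    (h : IsHardMixture mu c) {u v : Input n k} (hmu : mu (u, v) ≠ 0) : ∃ j, Hard j u v := by
  rw [h.eq] at hmu
  obtain ⟨j, -, hj⟩ := Finset.exists_ne_zero_of_sum_ne_zero hmu
  exact ⟨j, by_contra fun H => hj (by rw [if_neg H, mul_zero])⟩

section

variable {n k : ℕ}

open Classical in
/-- The weight of the hard pairs in the fooling distribution. -/
theorem foolingDist_hard (i : Input n k × Input n k) (j : Fin n) :
    (if Event0 (i, j) ∨ Event1 (i, j) then foolingDist n k (i, j) else 0)
      = 1 / (n : ℝ) * (1 / (Fintype.card {w : Input n k × Input n k // AgreeBelow j w.1 w.2} : ℝ))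
        * if Hard j i.1 i.2 then 1 else 0 := by
  unfold foolingDist Hard
  by_cases h1 : AgreeBelow j i.1 i.2 <;> by_cases h2 : Event0 (i, j) ∨ Event1 (i, j) <;>
    simp [h1, h2]

theorem hard_self (j : Fin n) (u : Input n k) : Hard j u u :=
  ⟨fun _ _ => rfl, Or.inl ⟨fun _ _ => rfl, fun _ _ => rfl⟩⟩

open Classical in
theorem foolingDist_hard_sum_pos [NeZero k] (j : Fin n) :
    0 < ∑ w : Input n k × Input n k,
      if Event0 (w, j) ∨ Event1 (w, j) then foolingDist n k (w, j) else 0 := by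
  have hn : 0 < n := Fin.pos j
  let u : Input n k := (fun _ => 0, fun _ => 0)
  simp only [foolingDist_hard]
  have : Nonempty {w : Input n k × Input n k // AgreeBelow j w.1 w.2} := ⟨⟨(u, u), fun _ _ => rfl⟩⟩
  have hcard : 0 < (Fintype.card {w : Input n k × Input n k // AgreeBelow j w.1 w.2} : ℝ) := by
    exact_mod_cast Fintype.card_pos
  have hn' : (0 : ℝ) < n := by exact_mod_cast hn
  refine Finset.sum_pos' (fun w _ => ?_) ⟨(u, u), Finset.mem_univ _, ?_⟩
  · split_ifs <;> positivity
  · rw [if_pos (hard_self j u)]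
    positivity

theorem exists_isHardMixture_hardDist [NeZero k] (hn : 0 < n) :
    ∃ c, IsHardMixture (hardDist n k) c := by
  classical
  set Z := ∑ w : (Input n k × Input n k) × Fin n,
    if Event0 w ∨ Event1 w then foolingDist n k w else 0 with hZ
  have hZ' : Z = ∑ j : Fin n, ∑ w : Input n k × Input n k,
      if Event0 (w, j) ∨ Event1 (w, j) then foolingDist n k (w, j) else 0 :=
    Fintype.sum_prod_type_right _
  have hZpos : 0 < Z := by
    rw [hZ']
    exact Finset.sum_pos (fun j _ => foolingDist_hard_sum_pos j) ⟨⟨0, hn⟩, Finset.mem_univ _⟩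
  refine ⟨fun j => 1 / (n : ℝ) *
    (1 / (Fintype.card {w : Input n k × Input n k // AgreeBelow j w.1 w.2} : ℝ)) / Z,
    fun j => by positivity, fun i => ?_, ?_⟩
  · refine Finset.sum_congr rfl fun j _ => ?_
    show (if Event0 (i, j) ∨ Event1 (i, j) then foolingDist n k (i, j) else 0) / Z = _
    rw [foolingDist_hard]
    ring
  · show ∑ i, ∑ j, (if Event0 (i, j) ∨ Event1 (i, j) then foolingDist n k (i, j) else 0) / Z = 1
    rw [Finset.sum_comm]
    simp only [← Finset.sum_div]
    rw [← hZ', div_self hZpos.ne']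

theorem exists_isHardMixture_hardDistUniform [NeZero k] (hn : 0 < n) :
    ∃ c, IsHardMixture (hardDistUniform n k) c := by
  classical
  have hn' : (n : ℝ) ≠ 0 := by exact_mod_cast hn.ne'
  set Z : Fin n → ℝ := fun j => ∑ w : Input n k × Input n k,
    if Event0 (w, j) ∨ Event1 (w, j) then foolingDist n k (w, j) else 0 with hZ
  have hZpos : ∀ j, 0 < Z j := fun j => foolingDist_hard_sum_pos j
  refine ⟨fun j => 1 / (n : ℝ) * (1 / (n : ℝ) *
    (1 / (Fintype.card {w : Input n k × Input n k // AgreeBelow j w.1 w.2} : ℝ)) / Z j),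
    fun j => ?_, fun i => ?_, ?_⟩
  · have := hZpos j
    positivity
  · refine Finset.sum_congr rfl fun j _ => ?_
    show 1 / (n : ℝ) *
      ((if Event0 (i, j) ∨ Event1 (i, j) then foolingDist n k (i, j) else 0) / Z j) = _
    rw [foolingDist_hard]
    ring
  · show ∑ i, ∑ j, 1 / (n : ℝ) *
      ((if Event0 (i, j) ∨ Event1 (i, j) then foolingDist n k (i, j) else 0) / Z j) = 1
    rw [Finset.sum_comm]
    simp only [← Finset.mul_sum, ← Finset.sum_div]
    have h1 : ∀ j, Z j / Z j = 1 := fun j => div_self (hZpos j).ne'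
    change 1 / (n : ℝ) * ∑ j, Z j / Z j = 1
    rw [Finset.sum_congr rfl fun j _ => h1 j, Finset.sum_const, Finset.card_univ,
      Fintype.card_fin, nsmul_eq_mul]
    field_simp

variable [NeZero k] {m : ℕ} {ε : unitInterval} {mu : Input n k × Input n k → ℝ} {c : Fin n → ℝ}

theorem errorProb_noisyJump_le (h : IsHardMixture mu c) (hε0 : 0 < (ε : ℝ)) (hε : 2 * (ε : ℝ) ≤ 1) :
    (noisyJump n k m ε).toClassical.errorProb mu target
      ≤ (2 * (ε : ℝ))⁻¹ * (n * (2 * ε) ^ m) + 2 * ε := by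
  classical
  rw [MessageScheme.errorProb_toClassical]
  calc _ ≤ ∑ u, ∑ v, mu (u, v) * ((2 * (ε : ℝ))⁻¹ * (n * (2 * ε) ^ m) + 2 * ε) := by
        refine Finset.sum_le_sum fun u _ => Finset.sum_le_sum fun v _ => ?_
        rcases eq_or_ne (mu (u, v)) 0 with h0 | h0
        · rw [h0, zero_mul, zero_mul]
        · obtain ⟨j, hj⟩ := h.exists_hard h0
          refine mul_le_mul_of_nonneg_left ?_ (h.mu_nonneg _)
          refine le_of_eq_of_le (Finset.sum_congr rfl fun t _ => ?_)
            (sum_prob_wrong_le (m := m) hj hε0 hε)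
          congr
    _ = _ := by
        have h1 := h.sum
        rw [Fintype.sum_prod_type] at h1
        simp only [← Finset.sum_mul]
        rw [h1, one_mul]

theorem IC_noisyJump_le_of_mixture (h : IsHardMixture mu c) (hε0 : 0 < (ε : ℝ)) {φ : ℕ → ℝ} {B : ℝ}
    (hφ : RoundsBound k m φ B) :
    (noisyJump n k m ε).toClassical.IC mu
      ≤ 2 * (Real.logb 2 (k / ε) * (1 + 2 * ε * B) + 1) := by
  classical
  have hk : (1 : ℝ) ≤ k := by exact_mod_cast NeZero.one_le
  have hL : 0 ≤ Real.logb 2 (k / ε) := by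
    refine Real.logb_nonneg one_lt_two ((one_le_div hε0).2 (le_trans ε.2.2 hk))
  have h1 := h.sum
  rw [Fintype.sum_prod_type] at h1
  have h2 : ∑ u, ∑ v, mu (u, v) * disagreements m ε u v ≤ 1 + 2 * ε * B := by
    have e1 : ∀ F : Input n k → Input n k → ℝ, ∑ u, ∑ v, mu (u, v) * F u v
        = ∑ j, c j * ∑ u, ∑ v, if Hard j u v then F u v else 0 := by
      intro F
      simp only [h.eq, Finset.sum_mul, Finset.mul_sum, mul_ite, ite_mul, mul_one, mul_zero,
        zero_mul]
      rw [Finset.sum_congr rfl fun u _ => Finset.sum_comm, Finset.sum_comm]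
    rw [e1]
    have e2 := e1 fun _ _ => 1
    simp only [mul_one] at e2
    rw [h1] at e2
    calc _ ≤ ∑ j, c j * ((1 + 2 * ε * B) *
          ∑ u : Input n k, ∑ v : Input n k, if Hard j u v then (1 : ℝ) else 0) :=
          Finset.sum_le_sum fun j _ =>
            mul_le_mul_of_nonneg_left (sum_disagreements_le hφ j) (h.nonneg j)
      _ = (1 + 2 * ε * B) * ∑ j, c j *
          ∑ u : Input n k, ∑ v : Input n k, if Hard j u v then (1 : ℝ) else 0 := by
          rw [Finset.mul_sum]
          exact Finset.sum_congr rfl fun j _ => by ring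
      _ = 1 + 2 * ε * B := by rw [← e2, mul_one]
  refine (IC_noisyJump_le hε0 mu h.mu_nonneg).trans ?_
  have h3 : ∑ u, ∑ v, mu (u, v) * (2 * (Real.logb 2 (k / ε) * disagreements m ε u v + 1))
      = 2 * (Real.logb 2 (k / ε) * ∑ u, ∑ v, mu (u, v) * disagreements m ε u v
        + ∑ u, ∑ v, mu (u, v)) := by
    simp only [Finset.mul_sum, ← Finset.sum_add_distrib]
    exact Finset.sum_congr rfl fun u _ => Finset.sum_congr rfl fun v _ => by ring
  rw [h3, h1]
  gcongr

end

/-! ### Choice of the parameters -/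

/-- The protocol without messages, in which both players output 0. -/
noncomputable def silent (n k : ℕ) : MessageScheme (Input n k) (Input n k) (ZMod 2) Unit where
  turns := 0
  alice _ _ _ := pointMass ()
  bob _ _ _ := pointMass ()
  outA _ _ := 0
  outB _ _ := 0

theorem IC_silent_le {n k : ℕ} {mu : Input n k × Input n k → ℝ} (hmu : ∀ i, 0 ≤ mu i) :
    (silent n k).toClassical.IC mu ≤ 0 := by
  refine ((silent n k).IC_toClassical_le mu hmu (fun _ _ _ => pointMass ())
    (fun _ _ _ => pointMass ()) (fun _ _ _ _ _ h => h) (fun _ _ _ _ _ h => h)).trans (le_of_eq ?_)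
  simp [silent]

theorem errorProb_toClassical_le_one {X Y O M : Type} [Fintype M] [Fintype X] [Fintype Y]
    [Fintype O] (P : MessageScheme X Y O M) {mu : X × Y → ℝ} (hmu : ∀ i, 0 ≤ mu i)
    (hsum : ∑ i, mu i = 1) (v : X → Y → O) : P.toClassical.errorProb mu v ≤ 1 := by
  classical
  rw [MessageScheme.errorProb_toClassical, ← hsum, Fintype.sum_prod_type]
  refine Finset.sum_le_sum fun x _ => Finset.sum_le_sum fun y _ =>
    mul_le_of_le_one_right (hmu _) ?_
  rw [← P.sum_prob x y (2 * P.turns)]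
  refine Finset.sum_le_sum fun h _ => ?_
  split_ifs
  exacts [P.prob_nonneg _ _ _ _, le_rfl]

theorem three_halves_le_logb {n : ℕ} (hn : 3 ≤ n) : (3 : ℝ) / 2 ≤ Real.logb 2 n := by
  have hn' : (3 : ℝ) ≤ n := by exact_mod_cast hn
  rw [Real.le_logb_iff_rpow_le one_lt_two (by linarith)]
  refine le_trans ?_ hn'
  have h1 : ((2 : ℝ) ^ ((3 : ℝ) / 2)) ^ 2 = 8 := by
    rw [← Real.rpow_natCast, ← Real.rpow_mul two_pos.le]
    norm_num
  nlinarith [Real.rpow_pos_of_pos two_pos ((3 : ℝ) / 2)]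

theorem half_le_logb {x : ℝ} (hx : 3 / 2 ≤ x) : (1 : ℝ) / 2 ≤ Real.logb 2 x := by
  rw [Real.le_logb_iff_rpow_le one_lt_two (by linarith)]
  refine le_trans ?_ hx
  have h1 : ((2 : ℝ) ^ ((1 : ℝ) / 2)) ^ 2 = 2 := by
    rw [← Real.rpow_natCast, ← Real.rpow_mul two_pos.le]
    norm_num
  nlinarith [Real.rpow_pos_of_pos two_pos ((1 : ℝ) / 2)]

/-- With noise `1 / (16 log n)` and abortion after about `log n` disagreements, the error is at most
`1 / log n`: a wrong jump at level `j` and an early abortion cost `1 / (8 log n)` each. -/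
theorem noisyJump_error_le {n : ℕ} {l ε : ℝ} (hl : 1 ≤ l) (hε : ε = 1 / (16 * l)) :
    (2 * ε)⁻¹ * (n * (2 * ε) ^ (Nat.log 2 n + 3)) + 2 * ε ≤ 1 / l := by
  have h2 : 2 * ε = 1 / (8 * l) := by
    rw [hε]
    field_simp
    norm_num
  set δ := 2 * ε
  have hδ0 : 0 < δ := by rw [h2]; positivity
  have hδ : δ ≤ 1 / 2 := by
    rw [h2, div_le_div_iff₀ (by positivity) two_pos]
    linarith
  have hpow : (n : ℝ) * δ ^ (Nat.log 2 n + 1) ≤ 1 := by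
    have h3 : (n : ℝ) ≤ 2 ^ (Nat.log 2 n + 1) := by
      exact_mod_cast (Nat.lt_pow_succ_log_self one_lt_two n).le
    calc (n : ℝ) * δ ^ (Nat.log 2 n + 1) ≤ 2 ^ (Nat.log 2 n + 1) * (1 / 2) ^ (Nat.log 2 n + 1) := by
          gcongr
      _ = 1 := by rw [← mul_pow]; norm_num
  have h4 : δ⁻¹ * (n * δ ^ (Nat.log 2 n + 3)) = δ * (n * δ ^ (Nat.log 2 n + 1)) := by
    rw [show Nat.log 2 n + 3 = Nat.log 2 n + 1 + 1 + 1 by omega, pow_succ, pow_succ _ (_ + 1)]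
    field_simp
  rw [h4]
  have h5 : δ * (n * δ ^ (Nat.log 2 n + 1)) ≤ δ * 1 := mul_le_mul_of_nonneg_left hpow hδ0.le
  have h6 : δ ≤ 1 / (2 * l) := by
    rw [h2]
    exact one_div_le_one_div_of_le (by positivity) (by linarith)
  have h7 : 1 / l = 1 / (2 * l) + 1 / (2 * l) := by
    field_simp
    norm_num
  linarith

theorem noisyJump_cost_le {n k : ℕ} {l ε : ℝ} (hn : 3 ≤ n) (hk : 1 ≤ k) (hl : l = Real.logb 2 n)
    (hε : ε = 1 / (16 * l)) :
    2 * (Real.logb 2 (k / ε) * (1 + 2 * ε * (((Nat.log 2 n + 3 : ℕ) : ℝ) *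
      (2 : ℝ) ^ (2 * ((Nat.log 2 n + 3 : ℕ) : ℝ) / k))) + 1)
      ≤ 598 * (Real.logb 2 (k * l) * (2 : ℝ) ^ (2 * l / k)) := by
  have hk' : (1 : ℝ) ≤ k := by exact_mod_cast hk
  have hl1 : 3 / 2 ≤ l := hl ▸ three_halves_le_logb hn
  have hl0 : 0 < l := by linarith
  set m : ℕ := Nat.log 2 n + 3
  have hm : (m : ℝ) ≤ l + 3 := by
    have h1 : ((Nat.log 2 n : ℕ) : ℝ) ≤ l := by
      rw [hl]
      exact_mod_cast Real.natLog_le_logb n 2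
    simp only [m]
    push_cast
    linarith
  set lam := Real.logb 2 (k * l)
  have hkl : 3 / 2 ≤ k * l := by nlinarith
  have hlam : 1 / 2 ≤ lam := half_le_logb hkl
  have hL : Real.logb 2 (k / ε) = 4 + lam := by
    have e : (k : ℝ) / ε = 2 ^ (4 : ℕ) * (k * l) := by
      rw [hε]
      field_simp
      norm_num
    rw [e, Real.logb_mul (by norm_num) (by positivity), Real.logb_pow,
      Real.logb_self_eq_one one_lt_two]
    norm_num
    rfl
  set E := (2 : ℝ) ^ (2 * l / k)
  have hE : 1 ≤ E := Real.one_le_rpow one_le_two (by positivity)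
  have hpow : (2 : ℝ) ^ (2 * (m : ℝ) / k) ≤ 64 * E := by
    calc (2 : ℝ) ^ (2 * (m : ℝ) / k) ≤ (2 : ℝ) ^ (6 + 2 * l / k) := by
          refine Real.rpow_le_rpow_of_exponent_le one_le_two ?_
          rw [div_le_iff₀ (by linarith), add_mul, div_mul_cancel₀ _ (by positivity)]
          nlinarith
      _ = 64 * E := by
          rw [Real.rpow_add two_pos]
          norm_num [E]
  have hεm : 2 * ε * m ≤ 1 / 2 := by
    rw [hε]
    have : 2 * (1 / (16 * l)) * (m : ℝ) = m / (8 * l) := by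
      field_simp
      ring
    rw [this, div_le_iff₀ (by positivity)]
    linarith
  have hε0 : 0 ≤ 2 * ε * m := by
    rw [hε]
    positivity
  have hcost : 2 * ε * ((m : ℝ) * (2 : ℝ) ^ (2 * (m : ℝ) / k)) ≤ 32 * E := by
    calc _ = 2 * ε * m * (2 : ℝ) ^ (2 * (m : ℝ) / k) := by ring
      _ ≤ 1 / 2 * (64 * E) := by gcongr
      _ = 32 * E := by ring
  rw [hL]
  have h1 : (4 + lam) * (1 + 2 * ε * ((m : ℝ) * (2 : ℝ) ^ (2 * (m : ℝ) / k)))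
      ≤ (9 * lam) * (33 * E) := by
    refine mul_le_mul (by linarith) (by linarith) ?_ (by linarith)
    have : 0 ≤ 2 * ε * ((m : ℝ) * (2 : ℝ) ^ (2 * (m : ℝ) / k)) := by
      rw [← mul_assoc]
      positivity
    linarith
  have h2 : 1 ≤ 2 * lam * E := by nlinarith
  linarith

end PointerJumping

theorem theorem3 :
    ∃ K : ℝ, 0 < K ∧ ∀ n k : ℕ, 2 ≤ n → 1 ≤ k →
      ∃ (PiQ : QuantumProtocol (PointerJumping.Input n k) (PointerJumping.Input n k) (ZMod 2))
        (PiC : ClassicalProtocol (PointerJumping.Input n k) (PointerJumping.Input n k) (ZMod 2)),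
        ∀ mu : PointerJumping.Input n k × PointerJumping.Input n k → ℝ,
          mu = PointerJumping.hardDist n k ∨ mu = PointerJumping.hardDistUniform n k →
          PiQ.Solves mu PointerJumping.target (1 / Real.logb 2 n) ∧
          PiC.errorProb mu PointerJumping.target ≤ 1 / Real.logb 2 n ∧
          PiQ.QIC mu ≤ PiC.IC mu ∧
          PiC.IC mu
            ≤ K * (Real.logb 2 (k * Real.logb 2 n) * (2 : ℝ) ^ (2 * Real.logb 2 n / k)) := by
  refine ⟨598, by norm_num, fun n k hn hk => ?_⟩
  have : NeZero k := ⟨by omega⟩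
  have mixture : ∀ mu : PointerJumping.Input n k × PointerJumping.Input n k → ℝ,
      mu = PointerJumping.hardDist n k ∨ mu = PointerJumping.hardDistUniform n k →
      ∃ c, PointerJumping.IsHardMixture mu c := by
    rintro mu (rfl | rfl)
    · exact PointerJumping.exists_isHardMixture_hardDist (by omega)
    · exact PointerJumping.exists_isHardMixture_hardDistUniform (by omega)
  -- It suffices to treat the classical protocol, as the coherent simulation has the same costs.
  suffices H : ∃ (M : Type) (_ : Fintype M) (P : MessageScheme (PointerJumping.Input n k)
      (PointerJumping.Input n k) (ZMod 2) M),
      ∀ (mu : PointerJumping.Input n k × PointerJumping.Input n k → ℝ) (c : Fin n → ℝ),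
        PointerJumping.IsHardMixture mu c →
        P.toClassical.errorProb mu PointerJumping.target ≤ 1 / Real.logb 2 n ∧
        P.toClassical.IC mu
          ≤ 598 * (Real.logb 2 (k * Real.logb 2 n) * (2 : ℝ) ^ (2 * Real.logb 2 n / k)) by
    obtain ⟨M, _, P, hP⟩ := H
    refine ⟨P.toQuantum, P.toClassical, fun mu hmu => ?_⟩
    obtain ⟨c, hc⟩ := mixture mu hmu
    obtain ⟨h1, h2⟩ := hP mu c hc
    refine ⟨⟨P.isDiag_output_toQuantum mu hc.mu_nonneg, ?_⟩, h1,
      (P.QIC_toQuantum mu hc.mu_nonneg).le, h2⟩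
    rw [P.errorProb_toQuantum mu hc.mu_nonneg]
    exact h1
  rcases hn.eq_or_lt with rfl | hn3
  · -- For `n = 2` the error may be 1.
    have hlog : Real.logb 2 ((2 : ℕ) : ℝ) = 1 := by
      rw [Nat.cast_ofNat]
      exact Real.logb_self_eq_one one_lt_two
    refine ⟨Unit, inferInstance, PointerJumping.silent 2 k, fun mu c h => ⟨?_, ?_⟩⟩
    · rw [hlog, div_one]
      exact PointerJumping.errorProb_toClassical_le_one _ h.mu_nonneg h.sum _
    · refine (PointerJumping.IC_silent_le h.mu_nonneg).trans ?_
      have hk' : (1 : ℝ) ≤ k := by exact_mod_cast hk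
      have := Real.logb_nonneg one_lt_two hk'
      rw [hlog, mul_one, mul_one]
      positivity
  · have hl := PointerJumping.three_halves_le_logb hn3
    have hε0 : 0 < 1 / (16 * Real.logb 2 n) := by positivity
    have hε1 : 1 / (16 * Real.logb 2 n) ≤ 1 / 2 :=
      one_div_le_one_div_of_le two_pos (by linarith)
    let ε : unitInterval := ⟨1 / (16 * Real.logb 2 n), hε0.le, by linarith⟩
    obtain ⟨φ, hφ⟩ := PointerJumping.exists_roundsBound hk (Nat.log 2 n + 3)
    refine ⟨Fin k × ZMod 2, inferInstance, PointerJumping.noisyJump n k (Nat.log 2 n + 3) ε,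
      fun mu c h => ⟨?_, ?_⟩⟩
    · refine (PointerJumping.errorProb_noisyJump_le h hε0 ?_).trans
        (PointerJumping.noisyJump_error_le (by linarith) rfl)
      show 2 * (1 / (16 * Real.logb 2 n)) ≤ 1
      linarith
    · exact (PointerJumping.IC_noisyJump_le_of_mixture h hε0 hφ).trans
        (PointerJumping.noisyJump_cost_le hn3 hk rfl rfl)
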